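/- Let $d\ge 3$ and let $V:\mathbb{R}^d\to\mathbb{R}$ satisfy one of the following conditions: (i) $d=3$ and $V\in L^{3/2}(\mathbb{R}^3)$; (ii) $d=4$ and $V\in L^2(\mathbb{R}^4)\cap L^{2+\mu}(\mathbb{R}^4)$ for some $\mu>0$; (iii) $d\ge 5$ and $V\in L^{d/2}(\mathbb{R}^d)$. Let $h=-\Delta+V$ be the self-adjoint operator in $L^2(\mathbb{R}^d)$ associated with the quadratic form $\Vert\nabla u\Vert^2+\int_{\mathbb{R}^d} V|u|^2\,dx$ on $H^1(\mathbb{R}^d)$, and for $\varepsilon\in(0,1)$ let $h_\varepsilon=h+\varepsilon\Delta$ be the one associated with $(1-\varepsilon)\Vert\nabla u\Vert^2+\int_{\mathbb{R}^d} V|u|^2\,dx$. Assume that $h$ has a virtual level at zero, i.e. $h\ge 0$ and, for all sufficiently small $\varepsilon>0$, $$\inf \mathcal{S}_{\mathrm{ess}}(h_\varepsilon)=0\qquad\text{and}\qquad \inf\mathcal{S}(h_\varepsilon)<0,$$ where $\mathcal{S}$ and $\mathcal{S}_{\mathrm{ess}}$ denote the spectrum and the essential spectrum. Then there exists a function $\varphi_0\in\dot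 H^1(\mathbb{R}^d)$, not almost everywhere zero, where $\dot H^1(\mathbb{R}^d)$ is the closure of $C_c^\infty(\mathbb{R}^d)$ in the norm $\Vert\nabla\,\cdot\,\Vert_{L^2}$ (realized as a space of functions), such that $V|\varphi_0|^2$ is integrable, $$\Vert\nabla\varphi_0\Vert^2+\int_{\mathbb{R}^d} V|\varphi_0|^2\,dx=0,$$ and for every $\alpha$ with $0\le\alpha<\frac{d-2}{2}$ $$\nabla\bigl(|x|^{\alpha}\varphi_0\bigr)\in L^2(\mathbb{R}^d)\qquad\text{and}\qquad (1+|x|)^{\alpha-1}\varphi_0\in L^2(\mathbb{R}^d).$$ In particular, if $d\ge 5$, then zero is an eigenvalue of $h$, with eigenfunction $\varphi_0$. -/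

import Mathlib

open MeasureTheory Filter Topology
open scoped ENNReal ContDiff ComplexConjugate

/-- Euclidean space `ℝ^d`. -/
abbrev RSpace (d : ℕ) : Type := EuclideanSpace ℝ (Fin d)

/-- The complex Hilbert space `L²(ℝ^d)`. -/
abbrev L2Space (d : ℕ) : Type := Lp ℂ 2 (volume : Measure (RSpace d))

/-- The coordinate direction `e_i`. -/
noncomputable abbrev coordVec {d : ℕ} (i : Fin d) : RSpace d := EuclideanSpace.single i (1 : ℝ)

/-- The classical gradient `(∂₁η, …, ∂_dη)` of a complex-valued function. -/
noncomputable def classicalGrad {d : ℕ} (η : RSpace d → ℂ) (x : RSpace d) :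
    EuclideanSpace ℂ (Fin d) :=
  WithLp.toLp 2 fun i => fderiv ℝ η x (coordVec i)

/-- `g` is the weak gradient of `u` on `ℝ^d`: both are locally integrable and
`∫ u ∂_i η = - ∫ g_i η` for every test function `η` and every `i`. -/
def HasWeakGrad {d : ℕ} (u : RSpace d → ℂ) (g : RSpace d → EuclideanSpace ℂ (Fin d)) : Prop :=
  LocallyIntegrable u ∧ LocallyIntegrable g ∧
    ∀ η : RSpace d → ℝ, ContDiff ℝ ∞ η → HasCompactSupport η → ∀ i : Fin d,
      ∫ x, fderiv ℝ η x (coordVec i) • u x = - ∫ x, η x • g x i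

/-- `u ∈ H¹(ℝ^d)`, with weak gradient `g`. -/
def MemH1 {d : ℕ} (u : RSpace d → ℂ) (g : RSpace d → EuclideanSpace ℂ (Fin d)) : Prop :=
  MemLp u 2 ∧ HasWeakGrad u g ∧ MemLp g 2

/-- `u ∈ Ḣ¹(ℝ^d)`, with weak gradient `g`. The space `Ḣ¹` is the closure of `C_c^∞` in the
gradient norm; an element of the closure is identified with the function to which an approximating
sequence converges in `L¹_loc` (for `d ≥ 3` that limit exists and is unique). -/
def MemHDot1 {d : ℕ} (u : RSpace d → ℂ) (g : RSpace d → EuclideanSpace ℂ (Fin d)) : Prop :=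
  HasWeakGrad u g ∧ MemLp g 2 ∧
    ∃ η : ℕ → RSpace d → ℂ,
      (∀ n, ContDiff ℝ ∞ (η n) ∧ HasCompactSupport (η n)) ∧
      Tendsto (fun n => eLpNorm (fun x => classicalGrad (η n) x - g x) 2 volume) atTop (𝓝 0) ∧
      ∀ R : ℝ, Tendsto (fun n => ∫ x in Metric.closedBall 0 R, ‖η n x - u x‖) atTop (𝓝 0)

/-- `u` belongs to the form domain of `-Δ + V`, with weak gradient `g`: it is an `H¹` function
with `∫ |V| |u|² < ∞` (which is automatic if `V` is form-bounded relative to `-Δ`). -/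
def MemFormDomain {d : ℕ} (V : RSpace d → ℝ) (u : RSpace d → ℂ)
    (g : RSpace d → EuclideanSpace ℂ (Fin d)) : Prop :=
  MemH1 u g ∧ Integrable fun x => V x * ‖u x‖ ^ 2

/-- `-Δ + V ≥ 0`: the quadratic form `‖∇u‖² + ⟨Vu, u⟩` is nonnegative on the form domain. -/
def SchrodingerNonneg {d : ℕ} (V : RSpace d → ℝ) : Prop :=
  ∀ (u : RSpace d → ℂ) (g : RSpace d → EuclideanSpace ℂ (Fin d)), MemFormDomain V u g →
    0 ≤ (∫ x, ‖g x‖ ^ 2) + ∫ x, V x * ‖u x‖ ^ 2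

section WeakGradFacts

variable {d : ℕ}

theorem HasWeakGrad.add {u v : RSpace d → ℂ} {g k : RSpace d → EuclideanSpace ℂ (Fin d)}
    (hu : HasWeakGrad u g) (hv : HasWeakGrad v k) : HasWeakGrad (u + v) (g + k) := by
  refine ⟨hu.1.add hv.1, hu.2.1.add hv.2.1, fun η hη hc i => ?_⟩
  have cη : Continuous fun x => fderiv ℝ η x (coordVec i) :=
    (hη.continuous_fderiv (by simp)).clm_apply continuous_const
  have sη : HasCompactSupport fun x => fderiv ℝ η x (coordVec i) :=
    hc.fderiv_apply (𝕜 := ℝ) (coordVec i)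
  have hgi : LocallyIntegrable fun x => g x i := fun x => by
    obtain ⟨s, hs, h⟩ := hu.2.1 x
    exact ⟨s, hs, (EuclideanSpace.proj (𝕜 := ℂ) i).integrable_comp h⟩
  have hki : LocallyIntegrable fun x => k x i := fun x => by
    obtain ⟨s, hs, h⟩ := hv.2.1 x
    exact ⟨s, hs, (EuclideanSpace.proj (𝕜 := ℂ) i).integrable_comp h⟩
  have e1 := hu.2.2 η hη hc i
  have e2 := hv.2.2 η hη hc i
  simp only [Pi.add_apply, PiLp.add_apply, smul_add]
  rw [integral_add (hu.1.integrable_smul_left_of_hasCompactSupport cη sη)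
      (hv.1.integrable_smul_left_of_hasCompactSupport cη sη),
    integral_add (hgi.integrable_smul_left_of_hasCompactSupport hη.continuous hc)
      (hki.integrable_smul_left_of_hasCompactSupport hη.continuous hc), e1, e2]
  ring

theorem HasWeakGrad.const_smul {u : RSpace d → ℂ} {g : RSpace d → EuclideanSpace ℂ (Fin d)}
    (hu : HasWeakGrad u g) (c : ℂ) : HasWeakGrad (c • u) (c • g) := by
  refine ⟨hu.1.smul c, hu.2.1.smul c, fun η hη hc i => ?_⟩
  simp only [Pi.smul_apply, PiLp.smul_apply]
  simp_rw [smul_comm _ c]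
  rw [integral_smul, integral_smul, hu.2.2 η hη hc i, smul_neg]

theorem HasWeakGrad.congr {u v : RSpace d → ℂ} {g : RSpace d → EuclideanSpace ℂ (Fin d)}
    (hu : HasWeakGrad u g) (h : u =ᵐ[volume] v) : HasWeakGrad v g := by
  refine ⟨hu.1.congr h, hu.2.1, fun η hη hc i => ?_⟩
  rw [← hu.2.2 η hη hc i]
  refine integral_congr_ae ?_
  filter_upwards [h] with x hx
  rw [hx]

theorem MemFormDomain.integrable_mul {V : RSpace d → ℝ} {u v : RSpace d → ℂ}
    {g k : RSpace d → EuclideanSpace ℂ (Fin d)}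
    (hu : MemFormDomain V u g) (hv : MemFormDomain V v k) :
    Integrable fun x => (V x : ℂ) * (conj (v x) * u x) := by
  have hm : AEStronglyMeasurable (fun x => (V x : ℂ) * (conj (v x) * u x)) volume := by
    have h1 : AEStronglyMeasurable
        (fun x => (((V x * ‖u x‖ ^ 2 : ℝ) : ℂ)) * (((‖u x‖ ^ 2 : ℝ) : ℂ)⁻¹ * (conj (v x) * u x)))
        volume := by
      have a := hu.2.aestronglyMeasurable.aemeasurable
      have b := hu.1.1.aestronglyMeasurable.aemeasurable
      have c := hv.1.1.aestronglyMeasurable.aemeasurable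
      have c' : AEMeasurable (fun x => conj (v x)) volume :=
        Complex.continuous_conj.measurable.comp_aemeasurable c
      have e : AEMeasurable (fun x => ((‖u x‖ ^ 2 : ℝ) : ℂ)) volume :=
        Complex.measurable_ofReal.comp_aemeasurable (b.norm.pow_const 2)
      exact ((Complex.measurable_ofReal.comp_aemeasurable a).mul
        (e.inv.mul (c'.mul b))).aestronglyMeasurable
    refine h1.congr (Eventually.of_forall fun x => ?_)
    by_cases h : u x = 0
    · simp [h]
    · have h2 : ((‖u x‖ ^ 2 : ℝ) : ℂ) ≠ 0 := by
        simpa using h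
      simp only [Complex.ofReal_mul]
      rw [mul_assoc, mul_inv_cancel_left₀ h2]
  refine (hu.2.norm.add hv.2.norm).mono' hm (Eventually.of_forall fun x => ?_)
  simp only [norm_mul, Complex.norm_real, Pi.add_apply, norm_pow, norm_norm, RCLike.norm_conj]
  nlinarith [mul_nonneg (norm_nonneg (V x)) (sq_nonneg (‖u x‖ - ‖v x‖)),
    mul_nonneg (norm_nonneg (V x)) (sq_nonneg (‖u x‖)),
    mul_nonneg (norm_nonneg (V x)) (sq_nonneg (‖v x‖))]

theorem MemFormDomain.congr {V : RSpace d → ℝ} {u v : RSpace d → ℂ}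
    {g : RSpace d → EuclideanSpace ℂ (Fin d)}
    (hu : MemFormDomain V u g) (h : u =ᵐ[volume] v) : MemFormDomain V v g := by
  refine ⟨⟨hu.1.1.ae_eq h, hu.1.2.1.congr h, hu.1.2.2⟩, hu.2.congr ?_⟩
  filter_upwards [h] with x hx
  rw [hx]

theorem MemFormDomain.const_smul {V : RSpace d → ℝ} {u : RSpace d → ℂ}
    {g : RSpace d → EuclideanSpace ℂ (Fin d)}
    (hu : MemFormDomain V u g) (c : ℂ) : MemFormDomain V (c • u) (c • g) := by
  refine ⟨⟨hu.1.1.const_smul c, hu.1.2.1.const_smul c, hu.1.2.2.const_smul c⟩,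
    (hu.2.const_mul (‖c‖ ^ 2)).congr (Eventually.of_forall fun x => ?_)⟩
  simp only [Pi.smul_apply, norm_smul]
  ring

theorem MemFormDomain.add {V : RSpace d → ℝ} {u v : RSpace d → ℂ}
    {g k : RSpace d → EuclideanSpace ℂ (Fin d)}
    (hu : MemFormDomain V u g) (hv : MemFormDomain V v k) : MemFormDomain V (u + v) (g + k) := by
  refine ⟨⟨hu.1.1.add hv.1.1, hu.1.2.1.add hv.1.2.1, hu.1.2.2.add hv.1.2.2⟩, ?_⟩
  refine ((hu.2.add hv.2).add ((hu.integrable_mul hv).re.const_mul 2)).congr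
    (Eventually.of_forall fun x => ?_)
  simp only [Pi.add_apply]
  have h1 : ‖u x + v x‖ ^ 2 = ‖u x‖ ^ 2 + ‖v x‖ ^ 2 + 2 * (conj (v x) * u x).re := by
    simp only [← Complex.normSq_eq_norm_sq, Complex.normSq_apply, Complex.add_re, Complex.add_im,
      Complex.mul_re, Complex.conj_re, Complex.conj_im]
    ring
  rw [h1]
  simp only [RCLike.re_to_complex, Complex.re_ofReal_mul]
  ring

theorem MemFormDomain.zero (V : RSpace d → ℝ) :
    MemFormDomain V (0 : RSpace d → ℂ) (0 : RSpace d → EuclideanSpace ℂ (Fin d)) := by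
  refine ⟨⟨MemLp.zero, ⟨locallyIntegrable_zero, locallyIntegrable_zero, fun η _ _ i => by simp⟩,
    MemLp.zero⟩, by simp⟩

end WeakGradFacts

/-- The graph of the operator associated with the quadratic form `c‖∇u‖² + ⟨Vu, u⟩`:
all pairs `(u, f)` such that `u` is in the form domain and
`c⟨∇v, ∇u⟩ + ⟨v, Vu⟩ = ⟨v, f⟩` for every `v` in the form domain. -/
noncomputable def schrodingerGraph {d : ℕ} (c : ℝ) (V : RSpace d → ℝ) :
    Submodule ℂ (L2Space d × L2Space d) where
  carrier := {p | ∃ g, MemFormDomain V p.1 g ∧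
    ∀ (v : L2Space d) (k : RSpace d → EuclideanSpace ℂ (Fin d)), MemFormDomain V v k →
      (c : ℂ) * (∫ x, inner ℂ (k x) (g x)) + ∫ x, (V x : ℂ) * (conj (v x) * p.1 x)
        = inner ℂ v p.2}
  zero_mem' := by
    have h0 : ((0 : L2Space d) : RSpace d → ℂ) =ᵐ[volume] 0 := Lp.coeFn_zero ℂ 2 volume
    refine ⟨0, (MemFormDomain.zero V).congr h0.symm, fun v k _ => ?_⟩
    have : ∫ x, (V x : ℂ) * (conj (v x) * (0 : L2Space d) x) = ∫ _ : RSpace d, (0 : ℂ) := by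
      refine integral_congr_ae ?_
      filter_upwards [h0] with x hx
      rw [hx]
      simp
    simp only [Prod.fst_zero, Prod.snd_zero, Pi.zero_apply, inner_zero_right]
    rw [this]
    simp
  add_mem' := by
    rintro ⟨u₁, f₁⟩ ⟨u₂, f₂⟩ ⟨g₁, h₁, e₁⟩ ⟨g₂, h₂, e₂⟩
    have hadd : ((u₁ + u₂ : L2Space d) : RSpace d → ℂ) =ᵐ[volume] u₁ + u₂ := Lp.coeFn_add u₁ u₂
    refine ⟨g₁ + g₂, (h₁.add h₂).congr hadd.symm, fun v k hv => ?_⟩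
    have hi : ∀ {g : RSpace d → EuclideanSpace ℂ (Fin d)}, MemLp g 2 →
        Integrable fun x => inner ℂ (k x) (g x) := fun hg => by
      refine (L2.integrable_inner (𝕜 := ℂ) (hv.1.2.2.toLp k) (hg.toLp _)).congr ?_
      filter_upwards [hv.1.2.2.coeFn_toLp, hg.coeFn_toLp] with x hx hy
      rw [hx, hy]
    have k1 : ∫ x, (V x : ℂ) * (conj (v x) * (u₁ + u₂ : L2Space d) x) =
        (∫ x, (V x : ℂ) * (conj (v x) * u₁ x)) + ∫ x, (V x : ℂ) * (conj (v x) * u₂ x) := by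
      rw [← integral_add (h₁.integrable_mul hv) (h₂.integrable_mul hv)]
      refine integral_congr_ae ?_
      filter_upwards [hadd] with x hx
      rw [hx, Pi.add_apply]
      ring
    have k2 : ∫ x, inner ℂ (k x) ((g₁ + g₂) x) =
        (∫ x, inner ℂ (k x) (g₁ x)) + ∫ x, inner ℂ (k x) (g₂ x) := by
      rw [← integral_add (hi h₁.1.2.2) (hi h₂.1.2.2)]
      simp only [Pi.add_apply, inner_add_right]
    have a₁ := e₁ v k hv
    have a₂ := e₂ v k hv
    simp only [Prod.mk_add_mk] at *
    rw [k1, k2, inner_add_right, ← a₁, ← a₂]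
    ring
  smul_mem' := by
    rintro a ⟨u, f⟩ ⟨g, h, e⟩
    have hs : ((a • u : L2Space d) : RSpace d → ℂ) =ᵐ[volume] a • u := Lp.coeFn_smul a u
    refine ⟨a • g, (h.const_smul a).congr hs.symm, fun v k hv => ?_⟩
    have k1 : ∫ x, (V x : ℂ) * (conj (v x) * (a • u : L2Space d) x) =
        a * ∫ x, (V x : ℂ) * (conj (v x) * u x) := by
      rw [← integral_const_mul]
      refine integral_congr_ae ?_
      filter_upwards [hs] with x hx
      rw [hx, Pi.smul_apply, smul_eq_mul]
      ring
    have k2 : ∫ x, inner ℂ (k x) ((a • g) x) = a * ∫ x, inner ℂ (k x) (g x) := by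
      rw [← integral_const_mul]
      simp only [Pi.smul_apply, inner_smul_right]
    have a₁ := e v k hv
    simp only [Prod.smul_mk] at *
    rw [k1, k2, inner_smul_right, ← a₁]
    ring

theorem HasWeakGrad.of_contDiff {d : ℕ} {η : RSpace d → ℂ} (hη : ContDiff ℝ ∞ η) :
    HasWeakGrad η (classicalGrad η) := by
  have cd : ∀ i : Fin d, Continuous fun x => fderiv ℝ η x (coordVec i) := fun i =>
    (hη.continuous_fderiv (by simp)).clm_apply continuous_const
  have cg : Continuous (classicalGrad η) :=
    (PiLp.continuous_toLp 2 _).comp (continuous_pi cd)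
  refine ⟨hη.continuous.locallyIntegrable, cg.locallyIntegrable, fun ζ hζ hc i => ?_⟩
  have cz : Continuous fun x => fderiv ℝ ζ x (coordVec i) :=
    (hζ.continuous_fderiv (by simp)).clm_apply continuous_const
  have sz : HasCompactSupport fun x => fderiv ℝ ζ x (coordVec i) :=
    hc.fderiv_apply (𝕜 := ℝ) (coordVec i)
  have := integral_smul_fderiv_eq_neg_fderiv_smul_of_integrable (μ := volume) (f := ζ) (g := η)
    (v := coordVec i)
    ((cz.smul hη.continuous).integrable_of_hasCompactSupport sz.smul_right)
    ((hζ.continuous.smul (cd i)).integrable_of_hasCompactSupport hc.smul_right)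
    ((hζ.continuous.smul hη.continuous).integrable_of_hasCompactSupport hc.smul_right)
    (fun x _ => (hζ.differentiable (by simp)).differentiableAt)
    (fun x _ => (hη.differentiable (by simp)).differentiableAt)
  change _ = -∫ x, ζ x • fderiv ℝ η x (coordVec i)
  rw [this, neg_neg]

theorem HasWeakGrad.eq_zero {d : ℕ} {u : RSpace d → ℂ}
    {g : RSpace d → EuclideanSpace ℂ (Fin d)} (h : HasWeakGrad u g) (hu : u =ᵐ[volume] 0) :
    g =ᵐ[volume] 0 := by
  have hi : ∀ i : Fin d, ∀ᵐ x, g x i = 0 := fun i => by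
    refine ae_eq_zero_of_integral_contDiff_smul_eq_zero (fun x => ?_) fun η hη hc => ?_
    · obtain ⟨s, hs, hg⟩ := h.2.1 x
      exact ⟨s, hs, (EuclideanSpace.proj (𝕜 := ℂ) i).integrable_comp hg⟩
    · have e := h.2.2 η hη hc i
      rw [← neg_eq_zero, ← e]
      refine integral_eq_zero_of_ae ?_
      filter_upwards [hu] with x hx
      simp [hx]
  filter_upwards [ae_all_iff.2 hi] with x hx
  ext i
  simpa using hx i

theorem MemFormDomain.of_contDiff {d : ℕ} {V : RSpace d → ℝ} (hV : LocallyIntegrable V)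
    {η : RSpace d → ℂ} (hη : ContDiff ℝ ∞ η) (hc : HasCompactSupport η) :
    MemFormDomain V η (classicalGrad η) := by
  have cg : Continuous (classicalGrad η) :=
    (PiLp.continuous_toLp 2 _).comp (continuous_pi fun i =>
      (hη.continuous_fderiv (by simp)).clm_apply continuous_const)
  have sg : HasCompactSupport (classicalGrad η) := by
    refine (hc.fderiv (𝕜 := ℝ)).mono fun x hx => ?_
    rw [Function.mem_support] at hx ⊢
    intro h0
    refine hx ?_
    ext i
    simp [classicalGrad, h0]
  refine ⟨⟨hη.continuous.memLp_of_hasCompactSupport hc, HasWeakGrad.of_contDiff hη,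
    cg.memLp_of_hasCompactSupport sg⟩, ?_⟩
  have := hV.integrable_smul_left_of_hasCompactSupport (g := fun x => ‖η x‖ ^ 2)
    (hη.continuous.norm.pow 2) (hc.comp_left (g := fun z : ℂ => ‖z‖ ^ 2) (by simp))
  refine this.congr (Eventually.of_forall fun x => ?_)
  simp only [smul_eq_mul]
  ring

/-- For a locally integrable potential the graph is the graph of an operator. -/
theorem schrodingerGraph_eq_zero {d : ℕ} (c : ℝ) {V : RSpace d → ℝ} (hV : LocallyIntegrable V) :
    ∀ p ∈ schrodingerGraph c V, p.1 = 0 → p.2 = 0 := by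
  rintro ⟨u, f⟩ ⟨g, hg, he⟩ hu
  simp only at hu hg he ⊢
  subst hu
  have h0 : ((0 : L2Space d) : RSpace d → ℂ) =ᵐ[volume] 0 := Lp.coeFn_zero ℂ 2 volume
  have hg0 := hg.1.2.1.eq_zero h0
  have hz : ∀ᵐ x, f x = 0 := by
    refine ae_eq_zero_of_integral_contDiff_smul_eq_zero
      ((Lp.memLp f).locallyIntegrable (by norm_num)) fun η hη hc => ?_
    have hη' : ContDiff ℝ ∞ fun x => (η x : ℂ) := Complex.ofRealCLM.contDiff.comp hη
    have hc' : HasCompactSupport fun x => (η x : ℂ) :=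
      hc.comp_left (g := fun t : ℝ => (t : ℂ)) (by simp)
    have hm := MemFormDomain.of_contDiff hV hη' hc'
    have hv := hm.1.1.coeFn_toLp
    have e := he (hm.1.1.toLp _) _ (hm.congr hv.symm)
    have z1 : ∫ x, inner ℂ (classicalGrad (fun x => (η x : ℂ)) x) (g x) = 0 := by
      refine integral_eq_zero_of_ae ?_
      filter_upwards [hg0] with x hx
      simp [hx]
    have z2 : ∫ x, (V x : ℂ) * (conj ((hm.1.1.toLp _ : L2Space d) x) * (0 : L2Space d) x) = 0 := by
      refine integral_eq_zero_of_ae ?_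
      filter_upwards with x
      simp
    rw [z1, z2, mul_zero, zero_add, L2.inner_def] at e
    rw [e]
    refine integral_congr_ae ?_
    filter_upwards [hv] with x hx
    rw [hx]
    simp [mul_comm]
  exact Lp.ext (by filter_upwards [hz, h0] with x hx hy; rw [hx, hy]; rfl)

/-- The operator `-cΔ + V` in `L²(ℝ^d)`, defined by its quadratic form. -/
noncomputable def schrodingerOp {d : ℕ} (c : ℝ) (V : RSpace d → ℝ) :
    L2Space d →ₗ.[ℂ] L2Space d :=
  (schrodingerGraph c V).toLinearPMap

section Spectrum

variable {H : Type*} [NormedAddCommGroup H] [InnerProductSpace ℂ H]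

/-- The map `A - z` from the domain of the unbounded operator `A`. -/
noncomputable def shiftedOp (A : H →ₗ.[ℂ] H) (z : ℂ) : A.domain →ₗ[ℂ] H :=
  A.toFun - z • A.domain.subtype

/-- The eigenspace `ker (A - z)`. -/
noncomputable def opEigenspace (A : H →ₗ.[ℂ] H) (z : ℂ) : Submodule ℂ A.domain :=
  LinearMap.ker (shiftedOp A z)

/-- The resolvent set: `A - z` is a bijection from the domain of `A` onto the whole space with a
bounded inverse. -/
def opResolventSet (A : H →ₗ.[ℂ] H) : Set ℂ :=
  {z | Function.Bijective (shiftedOp A z) ∧ ∃ C : ℝ, ∀ u : A.domain, ‖u‖ ≤ C * ‖shiftedOp A z u‖}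

/-- The spectrum of a self-adjoint operator, as a set of real numbers. -/
def opSpectrum (A : H →ₗ.[ℂ] H) : Set ℝ :=
  {t | (t : ℂ) ∉ opResolventSet A}

/-- The discrete spectrum: isolated points of the spectrum that are eigenvalues of finite
multiplicity. -/
def opDiscSpectrum (A : H →ₗ.[ℂ] H) : Set ℝ :=
  {t | t ∈ opSpectrum A ∧ (∃ δ > 0, ∀ s ∈ opSpectrum A, |s - t| < δ → s = t) ∧
    opEigenspace A t ≠ ⊥ ∧ FiniteDimensional ℂ (opEigenspace A t)}

/-- The essential spectrum: the complement of the discrete spectrum in the spectrum. -/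
def opEssSpectrum (A : H →ₗ.[ℂ] H) : Set ℝ :=
  opSpectrum A \ opDiscSpectrum A

/-- The infimum of a set of real numbers as an extended real number (`+∞` for the empty set,
`-∞` for a set that is not bounded below). -/
noncomputable def extInf (S : Set ℝ) : EReal := ⨅ t ∈ S, (t : EReal)

end Spectrum

/-- `h = -Δ + V` has a virtual level at zero: `h ≥ 0` and, for all sufficiently small `ε > 0`, the
operator `h_ε = h + εΔ` satisfies `inf S_ess(h_ε) = 0` and `inf S(h_ε) < 0`. -/
def HasVirtualLevelAtZero {d : ℕ} (V : RSpace d → ℝ) : Prop :=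
  SchrodingerNonneg V ∧
    ∀ᶠ ε : ℝ in 𝓝[>] 0,
      extInf (opEssSpectrum (schrodingerOp (1 - ε) V)) = 0 ∧
        extInf (opSpectrum (schrodingerOp (1 - ε) V)) < 0

/-- The integrability condition on the potential. -/
def ShortRange {d : ℕ} (V : RSpace d → ℝ) : Prop :=
  (d = 3 ∧ MemLp V (3 / 2)) ∨
  (d = 4 ∧ MemLp V 2 ∧ ∃ μ : ℝ, 0 < μ ∧ MemLp V (ENNReal.ofReal (2 + μ))) ∨
  (5 ≤ d ∧ MemLp V ((d : ℝ≥0∞) / 2))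

/-! ### Translation estimates in `L²` and mollification. -/

section Mollification

variable {d : ℕ}

/-! The natural space is `Ḣ¹` with norm `‖∇u‖`. By Sobolev it embeds in `L^{2d/(d-2)}`, so for `V ∈
L^{d/2}` Hölder makes `∫ V|u|²` a bounded form on it. This form is weakly sequentially continuous
(`tendsto_potForm_of_weak`): `V` is a limit in `L^{d/2}` of continuous compactly supported
functions, and weak convergence in `Ḣ¹` is strong in `L²` on balls (Rellich).

Existence. If `(1-ε)‖∇u‖² + ∫ V|u|² ≥ ε‖∇u‖²` held for all `u`, Lax–Milgram would put every negative
number in the resolvent set of `h_ε` (`exists_form_lt_of_extInf_neg`). Since `h_ε` has negative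
spectrum, there are `u_ε` with `‖∇u_ε‖ = 1` and `∫ V|u_ε|² ≤ -(1-2ε)`. A weak limit `φ₀` as `ε → 0`
has `∫ V|φ₀|² ≤ -1` and `‖∇φ₀‖ ≤ 1`; nonnegativity of `h`, extended to `Ḣ¹` by density, forces the
form to vanish at `φ₀`, and `φ₀ ≠ 0` (`exists_zero_of_virtualLevel`). A zero of a nonnegative form
is a critical point, so `-Δφ₀ + Vφ₀ = 0` weakly against all of `Ḣ¹` (`euler_lagrange`).

Decay. Testing with `G²φ₀`, where `G` is a bounded truncation of `(1+|x|²)^{α/2}`, gives `‖∇(Gφ₀)‖²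
- ‖φ₀∇G‖² + ∫ V|Gφ₀|² = 0`. As `|∇G| ≤ αG/√(1+|x|²)`, Hardy with its sharp constant (`InHDot.hardy`)
bounds the middle term by `(2α/(d-2))²‖∇(Gφ₀)‖²`, a factor below one exactly when `α < (d-2)/2`. The
potential term is a small multiple of `‖∇(Gφ₀)‖²` plus a local term. The resulting bound
(`exists_weighted_bound`) does not depend on the truncation, and Fatou removes it. For `d ≥ 5` the
value `α = 1` is admissible and gives `φ₀ ∈ L²`, an eigenfunction. -/

theorem sq_lintegral_le_lintegral_sq {α : Type*} [MeasurableSpace α] {ν : Measure α}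
    [IsProbabilityMeasure ν] {h : α → ℝ≥0∞} (hh : AEMeasurable h ν) :
    (∫⁻ x, h x ∂ν) ^ 2 ≤ ∫⁻ x, h x ^ 2 ∂ν := by
  have h1 := ENNReal.lintegral_mul_le_Lp_mul_Lq ν Real.HolderConjugate.two_two hh
    (aemeasurable_const (b := (1 : ℝ≥0∞)))
  simp only [Pi.mul_apply, mul_one, ENNReal.one_rpow, lintegral_const, measure_univ] at h1
  calc (∫⁻ x, h x ∂ν) ^ 2 ≤ ((∫⁻ x, h x ^ (2 : ℝ) ∂ν) ^ (1 / 2 : ℝ)) ^ 2 := by gcongr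
    _ = ∫⁻ x, h x ^ 2 ∂ν := by
      rw [← ENNReal.rpow_natCast, ← ENNReal.rpow_mul]
      norm_num

theorem norm_fderiv_apply_le (η : RSpace d → ℂ) (x y : RSpace d) :
    ‖fderiv ℝ η x y‖ ≤ ‖classicalGrad η x‖ * ‖y‖ := by
  have h : y = ∑ i, y i • coordVec i := by
    ext j
    simp [Finset.sum_apply, Pi.single_apply]
  have h2 : fderiv ℝ η x y = ∑ i, y i • fderiv ℝ η x (coordVec i) := by
    conv_lhs => rw [h]
    simp [map_sum]
  rw [h2, EuclideanSpace.norm_eq, EuclideanSpace.norm_eq]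
  refine (norm_sum_le _ _).trans ?_
  simp only [norm_smul]
  refine (Finset.sum_congr rfl fun i _ => mul_comm _ _).trans_le ?_
  exact Real.sum_mul_le_sqrt_mul_sqrt _ _ _

theorem continuous_classicalGrad {η : RSpace d → ℂ} (hη : ContDiff ℝ ∞ η) :
    Continuous (classicalGrad η) :=
  (PiLp.continuous_toLp 2 _).comp (continuous_pi fun i =>
      (hη.continuous_fderiv (by simp)).clm_apply continuous_const)

theorem hasCompactSupport_classicalGrad {η : RSpace d → ℂ} (hc : HasCompactSupport η) :
    HasCompactSupport (classicalGrad η) := by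
  refine (hc.fderiv (𝕜 := ℝ)).mono fun x hx => ?_
  rw [Function.mem_support] at hx ⊢
  intro h0
  refine hx ?_
  ext i
  simp [classicalGrad, h0]

/-- The fundamental theorem of calculus along the segment from `x` to `x - y`, followed by Jensen on
the unit interval. -/
theorem sq_enorm_sub_translate_le {η : RSpace d → ℂ} (hη : ContDiff ℝ ∞ η) (x y : RSpace d) :
    ‖η (x - y) - η x‖ₑ ^ 2 ≤
      ‖y‖ₑ ^ 2 * ∫⁻ t in Set.Ioc (0 : ℝ) 1, ‖classicalGrad η (x - t • y)‖ₑ ^ 2 := by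
  have hd : ∀ t : ℝ, HasDerivAt (fun t : ℝ => η (x - t • y)) (fderiv ℝ η (x - t • y) (-y)) t := by
    intro t
    have h1 : HasDerivAt (fun t : ℝ => x - t • y) (-y) t := by
      simpa using ((hasDerivAt_id t).smul_const y).const_sub x
    exact ((hη.differentiable (by simp)).differentiableAt.hasFDerivAt).comp_hasDerivAt t h1
  have hcl : Continuous fun t : ℝ => x - t • y := by fun_prop
  have hc : Continuous fun t : ℝ => fderiv ℝ η (x - t • y) (-y) :=
    ((hη.continuous_fderiv (by simp)).comp hcl).clm_apply continuous_const
  have e := intervalIntegral.integral_eq_sub_of_hasDerivAt (a := 0) (b := 1)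
    (fun t _ => hd t) (hc.intervalIntegrable 0 1)
  simp only [one_smul, zero_smul, sub_zero] at e
  rw [← e, intervalIntegral.integral_of_le zero_le_one]
  have : IsProbabilityMeasure (volume.restrict (Set.Ioc (0 : ℝ) 1)) := ⟨by simp⟩
  have cg := (continuous_classicalGrad hη).comp hcl
  calc ‖∫ t in Set.Ioc (0 : ℝ) 1, fderiv ℝ η (x - t • y) (-y)‖ₑ ^ 2
      ≤ (∫⁻ t in Set.Ioc (0 : ℝ) 1, ‖fderiv ℝ η (x - t • y) (-y)‖ₑ) ^ 2 := by
        gcongr; exact enorm_integral_le_lintegral_enorm _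
    _ ≤ ∫⁻ t in Set.Ioc (0 : ℝ) 1, ‖fderiv ℝ η (x - t • y) (-y)‖ₑ ^ 2 :=
        sq_lintegral_le_lintegral_sq hc.enorm.measurable.aemeasurable
    _ ≤ ∫⁻ t in Set.Ioc (0 : ℝ) 1, ‖y‖ₑ ^ 2 * ‖classicalGrad η (x - t • y)‖ₑ ^ 2 := by
        gcongr with t
        rw [← mul_pow]
        gcongr
        rw [← ofReal_norm, ← ofReal_norm, ← ofReal_norm,
          ← ENNReal.ofReal_mul (norm_nonneg _)]
        refine ENNReal.ofReal_le_ofReal ?_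
        rw [mul_comm]
        simpa using norm_fderiv_apply_le η (x - t • y) (-y)
    _ = _ := lintegral_const_mul _ (cg.enorm.measurable.pow_const 2)

/-- A translation modulus that depends on the gradient alone. It is the source of the uniform
mollification rate on bounded sets of `Ḣ¹`, hence of compactness. -/
theorem lintegral_sq_sub_translate_le {η : RSpace d → ℂ} (hη : ContDiff ℝ ∞ η) (y : RSpace d) :
    ∫⁻ x, ‖η (x - y) - η x‖ₑ ^ 2 ≤ ‖y‖ₑ ^ 2 * ∫⁻ x, ‖classicalGrad η x‖ₑ ^ 2 := by
  have hm : Measurable fun q : RSpace d × ℝ => ‖classicalGrad η (q.1 - q.2 • y)‖ₑ ^ 2 :=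
    (((continuous_classicalGrad hη).comp (by fun_prop : Continuous
      fun q : RSpace d × ℝ => q.1 - q.2 • y)).enorm.measurable).pow_const 2
  calc ∫⁻ x, ‖η (x - y) - η x‖ₑ ^ 2
      ≤ ∫⁻ x, ‖y‖ₑ ^ 2 * ∫⁻ t in Set.Ioc (0 : ℝ) 1, ‖classicalGrad η (x - t • y)‖ₑ ^ 2 :=
        lintegral_mono fun x => sq_enorm_sub_translate_le hη x y
    _ = ‖y‖ₑ ^ 2 * ∫⁻ x, ∫⁻ t in Set.Ioc (0 : ℝ) 1, ‖classicalGrad η (x - t • y)‖ₑ ^ 2 :=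
        lintegral_const_mul _ hm.lintegral_prod_right'
    _ = ‖y‖ₑ ^ 2 * ∫⁻ t in Set.Ioc (0 : ℝ) 1, ∫⁻ x, ‖classicalGrad η (x - t • y)‖ₑ ^ 2 := by
        rw [lintegral_lintegral_swap hm.aemeasurable]
    _ = ‖y‖ₑ ^ 2 * ∫⁻ x, ‖classicalGrad η x‖ₑ ^ 2 := by
        congr 1
        have : ∀ t : ℝ, ∫⁻ x, ‖classicalGrad η (x - t • y)‖ₑ ^ 2 =
            ∫⁻ x, ‖classicalGrad η x‖ₑ ^ 2 := fun t =>
          lintegral_sub_right_eq_self (fun x => ‖classicalGrad η x‖ₑ ^ 2) (t • y)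
        simp [this]

/-- Translation acts continuously on `L²`; no gradient is available here, so there is no rate. -/
theorem exists_translate_lintegral_le {F : Type*} [NormedAddCommGroup F]
    {f : RSpace d → F} (hf : MemLp f 2)
    {ε : ℝ≥0∞} (hε : ε ≠ 0) :
    ∃ δ > 0, ∀ y : RSpace d, ‖y‖ < δ → ∫⁻ x, ‖f (x - y) - f x‖ₑ ^ 2 ≤ ε := by
  have hmp : ∀ y : RSpace d, MeasurePreserving (fun x : RSpace d => x - y) volume volume :=
    fun y => measurePreserving_sub_right volume y
  let g : C(RSpace d, C(RSpace d, RSpace d)) :=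
    (ContinuousMap.mk (fun q : RSpace d × RSpace d => q.2 - q.1) (by fun_prop)).curry
  have hc : Continuous fun y : RSpace d =>
      Lp.compMeasurePreserving (g y) (hmp y) (hf.toLp f) :=
    (continuous_const (y := hf.toLp f)).compMeasurePreservingLp g.continuous hmp (by simp)
  have h0 : Lp.compMeasurePreserving (g 0) (hmp 0) (hf.toLp f) = hf.toLp f := by
    refine Lp.ext ((Lp.coeFn_compMeasurePreserving _ _).trans (Eventually.of_forall fun x => ?_))
    simp [g]
  have ht : Tendsto (fun y => ‖Lp.compMeasurePreserving (g y) (hmp y) (hf.toLp f) - hf.toLp f‖ₑ ^ 2)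
      (𝓝 0) (𝓝 0) := by
    have h1 : Continuous fun y =>
        ‖Lp.compMeasurePreserving (g y) (hmp y) (hf.toLp f) - hf.toLp f‖ₑ :=
      (hc.sub continuous_const).enorm
    have h2 := ((ENNReal.continuous_pow 2).comp h1).tendsto 0
    simp only [Function.comp_apply] at h2
    rwa [h0, sub_self, enorm_zero, zero_pow (by norm_num)] at h2
  have h3 := ht.eventually (ge_mem_nhds (pos_iff_ne_zero.2 hε))
  obtain ⟨δ, hδ, h4⟩ := Metric.eventually_nhds_iff.1 h3
  refine ⟨δ, hδ, fun y hy => le_of_eq_of_le ?_ (h4 (by simpa using hy))⟩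
  rw [Lp.enorm_def, eLpNorm_eq_lintegral_rpow_enorm_toReal (by norm_num) (by norm_num)]
  simp only [ENNReal.toReal_ofNat, ENNReal.rpow_ofNat]
  rw [← ENNReal.rpow_natCast, ← ENNReal.rpow_mul]
  norm_num
  refine lintegral_congr_ae ?_
  filter_upwards [Lp.coeFn_sub (Lp.compMeasurePreserving (g y) (hmp y) (hf.toLp f)) (hf.toLp f),
    hf.coeFn_toLp, Lp.coeFn_compMeasurePreserving (hf.toLp f) (hmp y),
    (hmp y).quasiMeasurePreserving.ae hf.coeFn_toLp] with x a1 a2 a3 a4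
  erw [a1, Pi.sub_apply, a2, a3, Function.comp_apply, a4]

variable {F : Type*} [NormedAddCommGroup F] [NormedSpace ℝ F]

/-- Convolution with a real weight. -/
noncomputable abbrev mollify (ρ : RSpace d → ℝ) (f : RSpace d → F) : RSpace d → F :=
  convolution ρ f (ContinuousLinearMap.lsmul ℝ ℝ) volume

theorem mollify_apply_swap (ρ : RSpace d → ℝ) (f : RSpace d → F) (x : RSpace d) :
    mollify ρ f x = ∫ y, ρ (x - y) • f y := by
  rw [mollify, convolution_eq_swap]
  rfl

/-- A smooth nonnegative weight with integral one and support in a ball of radius `δ`. -/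
structure IsMollifier (ρ : RSpace d → ℝ) (δ : ℝ) : Prop where
  contDiff : ContDiff ℝ ∞ ρ
  compact : HasCompactSupport ρ
  nonneg : ∀ x, 0 ≤ ρ x
  integral_eq : ∫ x, ρ x = 1
  support : ∀ x, ρ x ≠ 0 → ‖x‖ < δ

theorem exists_isMollifier (d : ℕ) {δ : ℝ} (hδ : 0 < δ) : ∃ ρ : RSpace d → ℝ, IsMollifier ρ δ := by
  let b : ContDiffBump (0 : RSpace d) := ⟨δ / 2, δ, by positivity, by linarith⟩
  refine ⟨b.normed volume, b.contDiff_normed, b.hasCompactSupport_normed, b.nonneg_normed,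
    b.integral_normed, fun x hx => ?_⟩
  have : x ∈ Function.support (b.normed volume) := hx
  rw [b.support_normed_eq] at this
  simpa using this

/-- Since `ρ dy` is a probability measure, `ρ * f - f` is an average of translation differences;
Jensen and Tonelli reduce it to the bound `M` for translations by less than `δ`. -/
theorem IsMollifier.eLpNorm_mollify_sub_le [CompleteSpace F] {ρ : RSpace d → ℝ} {δ : ℝ}
    (hρ : IsMollifier ρ δ) {f : RSpace d → F} (hf : LocallyIntegrable f)
    {M : ℝ≥0∞} (hM : ∀ y : RSpace d, ‖y‖ < δ → ∫⁻ x, ‖f (x - y) - f x‖ₑ ^ 2 ≤ M) :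
    ∫⁻ x, ‖mollify ρ f x - f x‖ₑ ^ 2 ≤ M := by
  have hρc : Continuous ρ := hρ.contDiff.continuous
  have hρi : Integrable ρ := hρc.integrable_of_hasCompactSupport hρ.compact
  have hρ1 : ∫⁻ y, ENNReal.ofReal (ρ y) = 1 := by
    rw [← ofReal_integral_eq_lintegral_ofReal hρi (Eventually.of_forall hρ.nonneg),
      hρ.integral_eq, ENNReal.ofReal_one]
  have hρm : Measurable fun y => ENNReal.ofReal (ρ y) := hρc.measurable.ennreal_ofReal
  let ν : Measure (RSpace d) := volume.withDensity fun y => ENNReal.ofReal (ρ y)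
  have hν : IsProbabilityMeasure ν := ⟨by simp [ν, hρ1]⟩
  have hac : ν ≪ volume := withDensity_absolutelyContinuous _ _
  have hfm : AEStronglyMeasurable f volume := hf.aestronglyMeasurable
  have hqm : ∀ x : RSpace d, AEStronglyMeasurable (fun y => f (x - y) - f x) volume := fun x =>
    (hfm.comp_quasiMeasurePreserving
      (quasiMeasurePreserving_sub_left_of_right_invariant volume x)).sub
      aestronglyMeasurable_const
  have hpt : ∀ x, ‖mollify ρ f x - f x‖ₑ ^ 2 ≤ ∫⁻ y, ‖f (x - y) - f x‖ₑ ^ 2 ∂ν := fun x => by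
    have e : mollify ρ f x - f x = ∫ y, ρ y • (f (x - y) - f x) := by
      have i1 : Integrable fun y => ρ y • f (x - y) :=
        hρ.compact.convolutionExists_left (ContinuousLinearMap.lsmul ℝ ℝ) hρc hf x
      simp only [smul_sub]
      rw [integral_sub i1 (hρi.smul_const _), integral_smul_const, hρ.integral_eq, one_smul]
      rfl
    rw [e]
    calc ‖∫ y, ρ y • (f (x - y) - f x)‖ₑ ^ 2
        ≤ (∫⁻ y, ‖ρ y • (f (x - y) - f x)‖ₑ) ^ 2 := by
          gcongr; exact enorm_integral_le_lintegral_enorm _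
      _ = (∫⁻ y, ‖f (x - y) - f x‖ₑ ∂ν) ^ 2 := by
          rw [lintegral_withDensity_eq_lintegral_mul₀ hρm.aemeasurable (hqm x).enorm]
          congr 1
          refine lintegral_congr fun y => ?_
          rw [enorm_smul, Real.enorm_of_nonneg (hρ.nonneg y), Pi.mul_apply]
      _ ≤ _ := sq_lintegral_le_lintegral_sq ((hqm x).enorm.mono_ac hac)
  -- `f` is only a.e. measurable for Lebesgue measure, so joint measurability is obtained for
  -- `volume.prod volume` and transferred by absolute continuity.
  have hprod : AEMeasurable (fun q : RSpace d × RSpace d => ‖f (q.1 - q.2) - f q.1‖ₑ ^ 2)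
      (volume.prod ν) := by
    have h1 : AEStronglyMeasurable (fun q : RSpace d × RSpace d => f (q.1 - q.2))
        (volume.prod volume) :=
      hfm.comp_quasiMeasurePreserving (quasiMeasurePreserving_sub_of_right_invariant volume volume)
    have h2 : AEStronglyMeasurable (fun q : RSpace d × RSpace d => f q.1) (volume.prod volume) :=
      hfm.comp_quasiMeasurePreserving Measure.quasiMeasurePreserving_fst
    exact ((h1.sub h2).enorm.pow_const 2).mono_ac (Measure.AbsolutelyContinuous.rfl.prod hac)
  calc ∫⁻ x, ‖mollify ρ f x - f x‖ₑ ^ 2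
      ≤ ∫⁻ x, ∫⁻ y, ‖f (x - y) - f x‖ₑ ^ 2 ∂ν := lintegral_mono hpt
    _ = ∫⁻ y, (∫⁻ x, ‖f (x - y) - f x‖ₑ ^ 2) ∂ν := lintegral_lintegral_swap hprod
    _ ≤ ∫⁻ _, M ∂ν := by
        refine lintegral_mono_ae ?_
        rw [ae_withDensity_iff hρm]
        refine Eventually.of_forall fun y hy => hM y (hρ.support y ?_)
        intro h0
        simp [h0] at hy
    _ = M := by simp

end Mollification

/-! ### The space `Ḣ¹` as a Hilbert space of gradients, with its Sobolev embedding. -/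

section HomogeneousSobolev

variable {d : ℕ}

theorem tendsto_integral_smul_of_tendsto_eLpNorm {F : Type*} [NormedAddCommGroup F]
    [NormedSpace ℝ F] {p : ℝ≥0∞} (hp : 1 ≤ p) {f : ℕ → RSpace d → F}
    {f₀ : RSpace d → F} (hf : ∀ n, MemLp (f n) p) (hf₀ : MemLp f₀ p)
    (h : Tendsto (fun n => eLpNorm (f n - f₀) p volume) atTop (𝓝 0))
    {ζ : RSpace d → ℝ} (hζ : Continuous ζ) (hc : HasCompactSupport ζ) :
    Tendsto (fun n => ∫ x, ζ x • f n x) atTop (𝓝 (∫ x, ζ x • f₀ x)) := by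
  have hpq : p.HolderConjugate p.conjExponent := ENNReal.HolderConjugate.conjExponent hp
  have hqp : p.conjExponent.HolderTriple p 1 := hpq.symm
  have hi : ∀ {g : RSpace d → F}, MemLp g p → Integrable fun x => ζ x • g x := fun hg =>
    (hg.locallyIntegrable hp).integrable_smul_left_of_hasCompactSupport hζ hc
  refine tendsto_integral_of_L1' _ (hi hf₀).1 (Eventually.of_forall fun n => hi (hf n)) ?_
  have hq : eLpNorm ζ p.conjExponent volume ≠ ⊤ :=
    (hζ.memLp_of_hasCompactSupport hc).eLpNorm_ne_top
  have hz := ENNReal.Tendsto.const_mul h (Or.inr hq)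
  rw [mul_zero] at hz
  refine tendsto_of_tendsto_of_tendsto_of_le_of_le tendsto_const_nhds hz (fun _ => zero_le)
    fun n => ?_
  have e : ((fun x => ζ x • f n x) - fun x => ζ x • f₀ x) = ζ • (f n - f₀) := by
    ext x
    simp [smul_sub]
  simp only
  rw [e]
  exact eLpNorm_smul_le_mul_eLpNorm ((hf n).sub hf₀).1 hζ.aestronglyMeasurable

/-- The critical Sobolev exponent `2d/(d-2)`. -/
noncomputable def sobExp (d : ℕ) : ℝ≥0∞ := ENNReal.ofReal (2 * d / (d - 2))

theorem sobExp_ne_top : sobExp d ≠ ⊤ := ENNReal.ofReal_ne_top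

theorem two_le_sobExp [hd : Fact (3 ≤ d)] : 2 ≤ sobExp d := by
  have h : (3 : ℝ) ≤ d := by exact_mod_cast hd.out
  rw [sobExp, ← ENNReal.ofReal_ofNat]
  refine ENNReal.ofReal_le_ofReal ?_
  rw [le_div_iff₀ (by linarith)]
  linarith

instance sobExp_fact [Fact (3 ≤ d)] : Fact (1 ≤ sobExp d) :=
  ⟨one_le_two.trans two_le_sobExp⟩

theorem sobExp_ne_zero [Fact (3 ≤ d)] : sobExp d ≠ 0 :=
  fun h => by simpa [h] using two_le_sobExp (d := d)

/-- Smooth compactly supported functions. -/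
def IsTestFun (η : RSpace d → ℂ) : Prop := ContDiff ℝ ∞ η ∧ HasCompactSupport η

theorem IsTestFun.memLp {η : RSpace d → ℂ} (h : IsTestFun η) (p : ℝ≥0∞) : MemLp η p :=
  h.1.continuous.memLp_of_hasCompactSupport h.2

theorem IsTestFun.memLp_grad {η : RSpace d → ℂ} (h : IsTestFun η) (p : ℝ≥0∞) :
    MemLp (classicalGrad η) p :=
  (continuous_classicalGrad h.1).memLp_of_hasCompactSupport (hasCompactSupport_classicalGrad h.2)

theorem IsTestFun.add {η ζ : RSpace d → ℂ} (h : IsTestFun η) (k : IsTestFun ζ) :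
    IsTestFun (η + ζ) := ⟨h.1.add k.1, h.2.add k.2⟩

theorem IsTestFun.const_smul {η : RSpace d → ℂ} (h : IsTestFun η) (c : ℂ) :
    IsTestFun (c • η) := ⟨h.1.const_smul c, h.2.smul_left⟩

theorem isTestFun_zero : IsTestFun (0 : RSpace d → ℂ) :=
  ⟨contDiff_const, HasCompactSupport.zero⟩

theorem IsTestFun.differentiable {η : RSpace d → ℂ} (h : IsTestFun η) : Differentiable ℝ η :=
  h.1.differentiable (by simp)

theorem classicalGrad_add {η ζ : RSpace d → ℂ} (h : Differentiable ℝ η) (k : Differentiable ℝ ζ) :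
    classicalGrad (η + ζ) = classicalGrad η + classicalGrad ζ := by
  ext x i
  simp [classicalGrad, fderiv_add (h x) (k x)]

theorem classicalGrad_const_smul {η : RSpace d → ℂ} (h : Differentiable ℝ η) (c : ℂ) :
    classicalGrad (c • η) = c • classicalGrad η := by
  ext x i
  simp [classicalGrad, fderiv_const_smul (h x) c]

/-- The Gagliardo–Nirenberg–Sobolev inequality with `p = 2`; the operator norm of the derivative is
dominated by the length of the gradient through Cauchy–Schwarz. -/
theorem exists_sobolev_const (d : ℕ) [hd : Fact (3 ≤ d)] : ∃ C : NNReal, ∀ η : RSpace d → ℂ,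
    IsTestFun η → eLpNorm η (sobExp d) volume ≤ C * eLpNorm (classicalGrad η) 2 volume := by
  have h3 : (3 : ℝ) ≤ d := by exact_mod_cast hd.out
  refine ⟨eLpNormLESNormFDerivOfEqInnerConst (volume : Measure (RSpace d)) ((2 : NNReal) : ℝ),
    fun η hη => ?_⟩
  have h := eLpNorm_le_eLpNorm_fderiv_of_eq_inner (volume : Measure (RSpace d)) (u := η)
    (hη.1.of_le (by simp)) hη.2 (p := 2) (p' := Real.toNNReal (2 * d / (d - 2))) one_le_two
    (by rw [finrank_euclideanSpace, Fintype.card_fin]; have := hd.out; omega) (by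
      rw [Real.coe_toNNReal _ (div_nonneg (by linarith) (by linarith))]
      have : (d : ℝ) - 2 ≠ 0 := by linarith
      simp only [finrank_euclideanSpace, Fintype.card_fin, NNReal.coe_inv, NNReal.coe_ofNat]
      field_simp)
  refine h.trans ?_
  gcongr
  exact eLpNorm_mono fun x => ContinuousLinearMap.opNorm_le_bound _ (norm_nonneg _)
    fun y => norm_fderiv_apply_le η x y

theorem eLpNorm_coord_le (f : RSpace d → EuclideanSpace ℂ (Fin d)) (i : Fin d) (p : ℝ≥0∞) :
    eLpNorm (fun x => f x i) p volume ≤ eLpNorm f p volume :=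
  eLpNorm_mono fun x => PiLp.norm_apply_le (f x) i

theorem MeasureTheory.MemLp.coord {f : RSpace d → EuclideanSpace ℂ (Fin d)} {p : ℝ≥0∞}
    (hf : MemLp f p) (i : Fin d) : MemLp (fun x => f x i) p :=
  hf.continuousLinearMap_comp (EuclideanSpace.proj (𝕜 := ℂ) i)

variable [Fact (3 ≤ d)]

/-- A constant in the Sobolev inequality on test functions. -/
noncomputable def sobConst (d : ℕ) [Fact (3 ≤ d)] : NNReal := (exists_sobolev_const d).choose

theorem IsTestFun.eLpNorm_le {η : RSpace d → ℂ} (hη : IsTestFun η) :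
    eLpNorm η (sobExp d) volume ≤ sobConst d * eLpNorm (classicalGrad η) 2 volume :=
  (exists_sobolev_const d).choose_spec η hη

/-- Square integrable vector fields. -/
abbrev GradSpace (d : ℕ) : Type := Lp (EuclideanSpace ℂ (Fin d)) 2 (volume : Measure (RSpace d))

/-- Functions with critical Sobolev integrability. -/
abbrev CritSpace (d : ℕ) : Type := Lp ℂ (sobExp d) (volume : Measure (RSpace d))

/-- The pairs `(η, ∇η)` with `η` a test function. -/
noncomputable def testGraph (d : ℕ) [Fact (3 ≤ d)] :
    Submodule ℂ (CritSpace d × GradSpace d) where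
  carrier := {z | ∃ η, IsTestFun η ∧ z.1 =ᵐ[volume] η ∧ z.2 =ᵐ[volume] classicalGrad η}
  zero_mem' := by
    refine ⟨0, isTestFun_zero, Lp.coeFn_zero _ _ _, (Lp.coeFn_zero _ _ _).trans
      (Eventually.of_forall fun x => ?_)⟩
    ext i
    simp [classicalGrad]
  add_mem' := by
    rintro a b ⟨η, h1, h2, h3⟩ ⟨ζ, k1, k2, k3⟩
    refine ⟨η + ζ, h1.add k1, (Lp.coeFn_add _ _).trans (h2.add k2), ?_⟩
    rw [classicalGrad_add h1.differentiable k1.differentiable]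
    exact (Lp.coeFn_add _ _).trans (h3.add k3)
  smul_mem' := by
    rintro c a ⟨η, h1, h2, h3⟩
    refine ⟨c • η, h1.const_smul c, (Lp.coeFn_smul _ _).trans (h2.const_smul c), ?_⟩
    rw [classicalGrad_const_smul h1.differentiable]
    exact (Lp.coeFn_smul _ _).trans (h3.const_smul c)

/-- The closure of the graph of the gradient on test functions. -/
noncomputable def hdotGraph (d : ℕ) [Fact (3 ≤ d)] :
    Submodule ℂ (CritSpace d × GradSpace d) :=
  (testGraph d).topologicalClosure

theorem norm_fst_le_of_mem_testGraph {z : CritSpace d × GradSpace d} (hz : z ∈ testGraph d) :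
    ‖z.1‖ ≤ sobConst d * ‖z.2‖ := by
  obtain ⟨η, h1, h2, h3⟩ := hz
  rw [Lp.norm_def, Lp.norm_def, eLpNorm_congr_ae h2, eLpNorm_congr_ae h3]
  have h4 := ENNReal.toReal_mono (ENNReal.mul_ne_top ENNReal.coe_ne_top
    (h1.memLp_grad 2).eLpNorm_ne_top) h1.eLpNorm_le
  rwa [ENNReal.toReal_mul, ENNReal.coe_toReal] at h4

/-- The Sobolev inequality is a closed condition on pairs, so it survives the closure. It makes the
gradient determine the function. -/
theorem norm_fst_le_of_mem_hdotGraph {z : CritSpace d × GradSpace d} (hz : z ∈ hdotGraph d) :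
    ‖z.1‖ ≤ sobConst d * ‖z.2‖ := by
  have hcl : IsClosed {z : CritSpace d × GradSpace d | ‖z.1‖ ≤ sobConst d * ‖z.2‖} :=
    isClosed_le (by fun_prop) (by fun_prop)
  exact closure_minimal (fun w hw => norm_fst_le_of_mem_testGraph hw) hcl hz

instance hdotGraph_complete : CompleteSpace (hdotGraph d) :=
  (Submodule.isClosed_topologicalClosure _).completeSpace_coe

/-- The gradient on the closed graph. -/
noncomputable def hdotGrad (d : ℕ) [Fact (3 ≤ d)] : hdotGraph d →L[ℂ] GradSpace d :=
  (ContinuousLinearMap.snd ℂ _ _).comp (hdotGraph d).subtypeL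

theorem hdotGrad_antilipschitz : AntilipschitzWith (max (sobConst d) 1) (hdotGrad d) := by
  refine ContinuousLinearMap.antilipschitz_of_bound _ fun z => ?_
  have h := norm_fst_le_of_mem_hdotGraph z.2
  have h0 : 0 ≤ ‖z.1.2‖ := norm_nonneg _
  change max ‖z.1.1‖ ‖z.1.2‖ ≤ _ * ‖z.1.2‖
  rw [NNReal.coe_max, NNReal.coe_one]
  refine max_le (h.trans ?_) ?_
  · gcongr; exact le_max_left _ _
  · exact le_mul_of_one_le_left h0 (le_max_right _ _)

/-- An antilipschitz map on a complete space has closed range; this makes the space of gradients a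
Hilbert space, where Riesz and weak compactness are available. -/
theorem hdotGrad_isClosed_range : IsClosed (Set.range (hdotGrad d)) :=
  hdotGrad_antilipschitz.isClosed_range (hdotGrad d).uniformContinuous

theorem hdotGraph_fst_unique {u v : CritSpace d} {g : GradSpace d} (hu : (u, g) ∈ hdotGraph d)
    (hv : (v, g) ∈ hdotGraph d) : u = v := by
  have := norm_fst_le_of_mem_hdotGraph ((hdotGraph d).sub_mem hu hv)
  simp only [Prod.mk_sub_mk, sub_self, norm_zero, mul_zero] at this
  exact sub_eq_zero.1 (norm_le_zero_iff.1 this)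

/-- The space of gradients of elements of `Ḣ¹`, a closed subspace of `L²`. -/
noncomputable def hdotSpace (d : ℕ) [Fact (3 ≤ d)] : Submodule ℂ (GradSpace d) :=
  (hdotGraph d).map (LinearMap.snd ℂ _ _)

theorem mem_hdotSpace_of_mem {z : CritSpace d × GradSpace d} (hz : z ∈ hdotGraph d) :
    z.2 ∈ hdotSpace d := ⟨z, hz, rfl⟩

theorem hdotSpace_isClosed : IsClosed (hdotSpace d : Set (GradSpace d)) := by
  have h : (hdotSpace d : Set (GradSpace d)) = Set.range (hdotGrad d) := by
    ext g
    constructor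
    · rintro ⟨z, hz, rfl⟩
      exact ⟨⟨z, hz⟩, rfl⟩
    · rintro ⟨z, rfl⟩
      exact mem_hdotSpace_of_mem z.2
  rw [h]
  exact hdotGrad_isClosed_range

instance hdotSpace_complete : CompleteSpace (hdotSpace d) := hdotSpace_isClosed.completeSpace_coe

theorem exists_mem_hdotGraph (g : hdotSpace d) :
    ∃ u : CritSpace d, (u, (g : GradSpace d)) ∈ hdotGraph d := by
  obtain ⟨z, hz, h⟩ := g.2
  refine ⟨z.1, ?_⟩
  rw [← h]
  exact hz

/-- The potential of a gradient. -/
noncomputable def hdotPot (g : hdotSpace d) : CritSpace d := (exists_mem_hdotGraph g).choose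

theorem hdotPot_mem (g : hdotSpace d) : (hdotPot g, (g : GradSpace d)) ∈ hdotGraph d :=
  (exists_mem_hdotGraph g).choose_spec

theorem hdotPot_add (g k : hdotSpace d) : hdotPot (g + k) = hdotPot g + hdotPot k :=
  hdotGraph_fst_unique (hdotPot_mem (g + k)) ((hdotGraph d).add_mem (hdotPot_mem g) (hdotPot_mem k))

theorem hdotPot_smul (c : ℂ) (g : hdotSpace d) : hdotPot (c • g) = c • hdotPot g :=
  hdotGraph_fst_unique (hdotPot_mem (c • g)) ((hdotGraph d).smul_mem c (hdotPot_mem g))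

theorem norm_hdotPot_le (g : hdotSpace d) : ‖hdotPot g‖ ≤ sobConst d * ‖g‖ := by
  rw [Submodule.coe_norm]
  exact norm_fst_le_of_mem_hdotGraph (z := (hdotPot g, (g : GradSpace d))) (hdotPot_mem g)

/-- The potential as a linear map. -/
noncomputable def hdotLin (d : ℕ) [Fact (3 ≤ d)] : hdotSpace d →ₗ[ℂ] CritSpace d where
  toFun := hdotPot
  map_add' := hdotPot_add
  map_smul' := hdotPot_smul

/-- The Sobolev embedding, taking a gradient to its potential. -/
noncomputable def hdotFun (d : ℕ) [Fact (3 ≤ d)] : hdotSpace d →L[ℂ] CritSpace d :=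
  (hdotLin d).mkContinuous (sobConst d) norm_hdotPot_le

theorem hdotFun_mem (g : hdotSpace d) : (hdotFun d g, (g : GradSpace d)) ∈ hdotGraph d :=
  hdotPot_mem g

/-- `u` is a function in the homogeneous Sobolev space, with gradient `g`. -/
def InHDot (u : RSpace d → ℂ) (g : RSpace d → EuclideanSpace ℂ (Fin d)) : Prop :=
  ∃ z ∈ hdotGraph d, z.1 =ᵐ[volume] u ∧ z.2 =ᵐ[volume] g

theorem InHDot.memLp {u : RSpace d → ℂ} {g : RSpace d → EuclideanSpace ℂ (Fin d)}
    (h : InHDot u g) : MemLp u (sobExp d) := by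
  obtain ⟨z, -, h1, -⟩ := h
  exact (Lp.memLp z.1).ae_eq h1

theorem InHDot.memLp_grad {u : RSpace d → ℂ} {g : RSpace d → EuclideanSpace ℂ (Fin d)}
    (h : InHDot u g) : MemLp g 2 := by
  obtain ⟨z, -, -, h1⟩ := h
  exact (Lp.memLp z.2).ae_eq h1

theorem InHDot.toLp_mem {u : RSpace d → ℂ} {g : RSpace d → EuclideanSpace ℂ (Fin d)}
    (h : InHDot u g) : (h.memLp.toLp u, h.memLp_grad.toLp g) ∈ hdotGraph d := by
  obtain ⟨z, hz, h1, h2⟩ := id h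
  have : (h.memLp.toLp u, h.memLp_grad.toLp g) = z :=
    Prod.ext (Lp.ext (h.memLp.coeFn_toLp.trans h1.symm))
      (Lp.ext (h.memLp_grad.coeFn_toLp.trans h2.symm))
  rwa [this]

theorem inHDot_hdotFun (g : hdotSpace d) : InHDot (hdotFun d g) (g : GradSpace d) :=
  ⟨_, hdotFun_mem g, EventuallyEq.rfl, EventuallyEq.rfl⟩

theorem InHDot.congr {u v : RSpace d → ℂ} {g k : RSpace d → EuclideanSpace ℂ (Fin d)}
    (h : InHDot u g) (hu : u =ᵐ[volume] v) (hg : g =ᵐ[volume] k) : InHDot v k := by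
  obtain ⟨z, hz, h1, h2⟩ := h
  exact ⟨z, hz, h1.trans hu, h2.trans hg⟩

theorem InHDot.add {u v : RSpace d → ℂ} {g k : RSpace d → EuclideanSpace ℂ (Fin d)}
    (h : InHDot u g) (h' : InHDot v k) : InHDot (u + v) (g + k) := by
  obtain ⟨z, hz, h1, h2⟩ := h
  obtain ⟨w, hw, k1, k2⟩ := h'
  exact ⟨z + w, (hdotGraph d).add_mem hz hw, (Lp.coeFn_add _ _).trans (h1.add k1),
    (Lp.coeFn_add _ _).trans (h2.add k2)⟩

theorem InHDot.const_smul {u : RSpace d → ℂ} {g : RSpace d → EuclideanSpace ℂ (Fin d)}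
    (h : InHDot u g) (c : ℂ) : InHDot (c • u) (c • g) := by
  obtain ⟨z, hz, h1, h2⟩ := h
  exact ⟨c • z, (hdotGraph d).smul_mem c hz, (Lp.coeFn_smul _ _).trans (h1.const_smul c),
    (Lp.coeFn_smul _ _).trans (h2.const_smul c)⟩

theorem InHDot.sub {u v : RSpace d → ℂ} {g k : RSpace d → EuclideanSpace ℂ (Fin d)}
    (h : InHDot u g) (h' : InHDot v k) : InHDot (u - v) (g - k) := by
  have := h.add (h'.const_smul (-1))
  simpa [sub_eq_add_neg] using this

theorem IsTestFun.inHDot {η : RSpace d → ℂ} (hη : IsTestFun η) : InHDot η (classicalGrad η) :=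
  ⟨((hη.memLp _).toLp η, (hη.memLp_grad 2).toLp _), Submodule.le_topologicalClosure _
    ⟨η, hη, (hη.memLp _).coeFn_toLp, (hη.memLp_grad 2).coeFn_toLp⟩,
    (hη.memLp _).coeFn_toLp, (hη.memLp_grad 2).coeFn_toLp⟩

theorem InHDot.eLpNorm_le {u : RSpace d → ℂ} {g : RSpace d → EuclideanSpace ℂ (Fin d)}
    (h : InHDot u g) : eLpNorm u (sobExp d) volume ≤ sobConst d * eLpNorm g 2 volume := by
  have h1 := norm_fst_le_of_mem_hdotGraph h.toLp_mem
  simp only [Lp.norm_toLp] at h1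
  rw [← ENNReal.toReal_le_toReal h.memLp.eLpNorm_ne_top
    (ENNReal.mul_ne_top ENNReal.coe_ne_top h.memLp_grad.eLpNorm_ne_top), ENNReal.toReal_mul,
    ENNReal.coe_toReal]
  exact h1

/-- The a.e. convergence, obtained along a subsequence, is there for the Fatou arguments that carry
inequalities from test functions to `Ḣ¹`. -/
theorem InHDot.exists_seq {u : RSpace d → ℂ} {g : RSpace d → EuclideanSpace ℂ (Fin d)}
    (h : InHDot u g) : ∃ η : ℕ → RSpace d → ℂ, (∀ n, IsTestFun (η n)) ∧
      Tendsto (fun n => eLpNorm (η n - u) (sobExp d) volume) atTop (𝓝 0) ∧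
      Tendsto (fun n => eLpNorm (classicalGrad (η n) - g) 2 volume) atTop (𝓝 0) ∧
      ∀ᵐ x, Tendsto (fun n => η n x) atTop (𝓝 (u x)) := by
  have h0 := h.toLp_mem
  obtain ⟨z, hz, hlim⟩ := mem_closure_iff_seq_limit.1
    (show (h.memLp.toLp u, h.memLp_grad.toLp g) ∈
      closure (testGraph d : Set (CritSpace d × GradSpace d)) from h0)
  choose η h1 h2 h3 using hz
  have e1 : ∀ n, (z n).1 = ((h1 n).memLp _).toLp (η n) := fun n =>
    Lp.ext ((h2 n).trans (MemLp.coeFn_toLp _).symm)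
  have e2 : ∀ n, (z n).2 = ((h1 n).memLp_grad 2).toLp (classicalGrad (η n)) := fun n =>
    Lp.ext ((h3 n).trans (MemLp.coeFn_toLp _).symm)
  have t1 := (continuous_fst.tendsto _).comp hlim
  have t2 := (continuous_snd.tendsto _).comp hlim
  simp only [Function.comp_def, e1] at t1
  simp only [Function.comp_def, e2] at t2
  rw [Lp.tendsto_Lp_iff_tendsto_eLpNorm''] at t1 t2
  obtain ⟨ns, hns, hae⟩ := (tendstoInMeasure_of_tendsto_eLpNorm sobExp_ne_zero
    (fun n => ((h1 n).memLp (sobExp d)).1) h.memLp.1 t1).exists_seq_tendsto_ae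
  exact ⟨fun n => η (ns n), fun n => h1 _, t1.comp hns.tendsto_atTop, t2.comp hns.tendsto_atTop, hae⟩

theorem InHDot.of_tendsto {u : RSpace d → ℂ} {g : RSpace d → EuclideanSpace ℂ (Fin d)}
    (hu : MemLp u (sobExp d)) (hg : MemLp g 2) {v : ℕ → RSpace d → ℂ}
    {k : ℕ → RSpace d → EuclideanSpace ℂ (Fin d)} (h : ∀ n, InHDot (v n) (k n))
    (h1 : Tendsto (fun n => eLpNorm (v n - u) (sobExp d) volume) atTop (𝓝 0))
    (h2 : Tendsto (fun n => eLpNorm (k n - g) 2 volume) atTop (𝓝 0)) : InHDot u g := by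
  refine ⟨(hu.toLp u, hg.toLp g), ?_, hu.coeFn_toLp, hg.coeFn_toLp⟩
  refine (Submodule.isClosed_topologicalClosure _).mem_of_tendsto
    (f := fun n => ((h n).memLp.toLp (v n), (h n).memLp_grad.toLp (k n))) (b := atTop) ?_
    (Eventually.of_forall fun n => (h n).toLp_mem)
  exact (((Lp.tendsto_Lp_iff_tendsto_eLpNorm'' _ (fun n => (h n).memLp) _ hu).2 h1)).prodMk_nhds
    (((Lp.tendsto_Lp_iff_tendsto_eLpNorm'' _ (fun n => (h n).memLp_grad) _ hg).2 h2))

/-- A limit of gradients is the gradient of a limit. -/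
theorem exists_inHDot_of_tendsto {g : RSpace d → EuclideanSpace ℂ (Fin d)} (hg : MemLp g 2)
    {v : ℕ → RSpace d → ℂ} {k : ℕ → RSpace d → EuclideanSpace ℂ (Fin d)}
    (h : ∀ n, InHDot (v n) (k n))
    (h2 : Tendsto (fun n => eLpNorm (k n - g) 2 volume) atTop (𝓝 0)) :
    ∃ u, InHDot u g ∧ Tendsto (fun n => eLpNorm (v n - u) (sobExp d) volume) atTop (𝓝 0) := by
  have t := (Lp.tendsto_Lp_iff_tendsto_eLpNorm'' _ (fun n => (h n).memLp_grad) _ hg).2 h2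
  have hm : hg.toLp g ∈ hdotSpace d :=
    hdotSpace_isClosed.mem_of_tendsto t (Eventually.of_forall fun n => mem_hdotSpace_of_mem (h n).toLp_mem)
  have hi : InHDot (hdotFun d ⟨_, hm⟩) g :=
    (inHDot_hdotFun ⟨_, hm⟩).congr EventuallyEq.rfl hg.coeFn_toLp
  refine ⟨_, hi, ?_⟩
  have hz := ENNReal.Tendsto.const_mul h2 (Or.inr (ENNReal.coe_ne_top (r := sobConst d)))
  rw [mul_zero] at hz
  exact tendsto_of_tendsto_of_tendsto_of_le_of_le tendsto_const_nhds hz (fun _ => zero_le)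
    fun n => ((h n).sub hi).eLpNorm_le

theorem InHDot.hasWeakGrad {u : RSpace d → ℂ} {g : RSpace d → EuclideanSpace ℂ (Fin d)}
    (h : InHDot u g) : HasWeakGrad u g := by
  obtain ⟨η, h1, h2, h3, -⟩ := h.exists_seq
  have hp : 1 ≤ sobExp d := Fact.out
  refine ⟨h.memLp.locallyIntegrable hp, h.memLp_grad.locallyIntegrable one_le_two,
    fun ζ hζ hc i => ?_⟩
  have l1 := tendsto_integral_smul_of_tendsto_eLpNorm hp (fun n => (h1 n).memLp _) h.memLp h2
    (ζ := fun x => fderiv ℝ ζ x (coordVec i))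
    ((hζ.continuous_fderiv (by simp)).clm_apply continuous_const)
    (hc.fderiv_apply (𝕜 := ℝ) (coordVec i))
  have h3' : Tendsto (fun n => eLpNorm ((fun x => classicalGrad (η n) x i) - fun x => g x i) 2
      volume) atTop (𝓝 0) :=
    tendsto_of_tendsto_of_tendsto_of_le_of_le tendsto_const_nhds h3 (fun _ => zero_le)
      fun n => eLpNorm_coord_le (classicalGrad (η n) - g) i 2
  have l2 := tendsto_integral_smul_of_tendsto_eLpNorm one_le_two
    (fun n => ((h1 n).memLp_grad 2).coord i) (h.memLp_grad.coord i) h3' hζ.continuous hc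
  refine tendsto_nhds_unique l1 (l2.neg.congr fun n => ?_)
  exact ((HasWeakGrad.of_contDiff (h1 n).1).2.2 ζ hζ hc i).symm

/-- Convergence in the critical Sobolev norm implies convergence in `L¹` on balls, by Hölder on a
set of finite measure. -/
theorem InHDot.memHDot1 {u : RSpace d → ℂ} {g : RSpace d → EuclideanSpace ℂ (Fin d)}
    (h : InHDot u g) : MemHDot1 u g := by
  obtain ⟨η, h1, h2, h3, -⟩ := h.exists_seq
  have hp : 1 ≤ sobExp d := Fact.out
  refine ⟨h.hasWeakGrad, h.memLp_grad, η, h1, h3, fun R => ?_⟩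
  let C := (volume.restrict (Metric.closedBall (0 : RSpace d) R)) Set.univ ^
    (1 / (1 : ℝ≥0∞).toReal - 1 / (sobExp d).toReal)
  have hC : C ≠ ⊤ := by
    refine ENNReal.rpow_ne_top_of_nonneg ?_ ?_
    · have : 1 ≤ (sobExp d).toReal := by
        simpa using ENNReal.toReal_mono sobExp_ne_top hp
      simp only [ENNReal.toReal_one, div_one, one_div, sub_nonneg]
      exact inv_le_one_of_one_le₀ this
    · rw [Measure.restrict_apply_univ]
      exact (isCompact_closedBall 0 R).measure_lt_top.ne
  have hz := ENNReal.Tendsto.mul_const h2 (Or.inr hC)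
  rw [zero_mul] at hz
  have hz2 := (ENNReal.tendsto_toReal ENNReal.zero_ne_top).comp hz
  refine squeeze_zero' (Eventually.of_forall fun n => by positivity) ?_ hz2
  -- `toReal` sends `⊤` to `0`, so it is monotone only where the norms are known to be finite.
  have hfin := (tendsto_order.1 h2).2 1 one_pos
  filter_upwards [hfin] with n hn
  have hm : AEStronglyMeasurable (η n - u) volume := ((h1 n).memLp (sobExp d)).1.sub h.memLp.1
  have e := integral_norm_eq_lintegral_enorm (hm.restrict (s := Metric.closedBall 0 R))
  simp only [Pi.sub_apply] at e
  rw [e, Function.comp_apply]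
  refine ENNReal.toReal_mono (ENNReal.mul_ne_top (hn.trans ENNReal.one_lt_top).ne hC) ?_
  have := eLpNorm_le_eLpNorm_mul_rpow_measure_univ (μ := volume.restrict (Metric.closedBall 0 R))
    hp hm.restrict
  rw [eLpNorm_one_eq_lintegral_enorm] at this
  exact this.trans (mul_le_mul_left (eLpNorm_restrict_le _ _ _ _) _)

end HomogeneousSobolev

/-! ### Density of test functions: `H¹ ⊆ Ḣ¹` by mollification and cutoff. -/

section Density

variable {d : ℕ}

theorem eLpNorm_two_sq {α F : Type*} [MeasurableSpace α] [NormedAddCommGroup F] (f : α → F)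
    (μ : Measure α) : eLpNorm f 2 μ ^ 2 = ∫⁻ x, ‖f x‖ₑ ^ 2 ∂μ := by
  rw [eLpNorm_eq_lintegral_rpow_enorm_toReal (by norm_num) (by norm_num)]
  simp only [ENNReal.toReal_ofNat, ENNReal.rpow_ofNat]
  rw [← ENNReal.rpow_natCast, ← ENNReal.rpow_mul]
  norm_num

theorem eLpNorm_two_le_iff {α F : Type*} [MeasurableSpace α] [NormedAddCommGroup F] {f : α → F}
    {μ : Measure α} {c : ℝ≥0∞} : eLpNorm f 2 μ ≤ c ↔ ∫⁻ x, ‖f x‖ₑ ^ 2 ∂μ ≤ c ^ 2 := by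
  rw [← eLpNorm_two_sq]
  exact (ENNReal.pow_le_pow_left_iff two_ne_zero).symm

theorem tendsto_eLpNorm_two_zero_iff {α F : Type*} [MeasurableSpace α] [NormedAddCommGroup F]
    {f : ℕ → α → F} {μ : Measure α} : Tendsto (fun n => eLpNorm (f n) 2 μ) atTop (𝓝 0) ↔
      Tendsto (fun n => ∫⁻ x, ‖f n x‖ₑ ^ 2 ∂μ) atTop (𝓝 0) := by
  simp only [← eLpNorm_two_sq]
  constructor
  · intro h
    simpa [Function.comp_def] using ((ENNReal.continuous_pow 2).tendsto _).comp h
  · intro h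
    have := ((ENNReal.continuous_rpow_const (y := (1 / 2 : ℝ))).tendsto _).comp h
    rw [ENNReal.zero_rpow_of_pos (by norm_num)] at this
    refine this.congr fun n => ?_
    rw [Function.comp_apply, ← ENNReal.rpow_natCast, ← ENNReal.rpow_mul]
    norm_num

theorem tendsto_mollify {F : Type*} [NormedAddCommGroup F] [NormedSpace ℝ F] [CompleteSpace F]
    {f : RSpace d → F} (hf : MemLp f 2) {ρ : ℕ → RSpace d → ℝ} {δ : ℕ → ℝ}
    (hρ : ∀ n, IsMollifier (ρ n) (δ n)) (hδ : Tendsto δ atTop (𝓝 0)) :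
    Tendsto (fun n => eLpNorm (mollify (ρ n) f - f) 2 volume) atTop (𝓝 0) := by
  rw [tendsto_eLpNorm_two_zero_iff, ENNReal.tendsto_nhds_zero]
  intro ε hε
  obtain ⟨r, hr, h⟩ := exists_translate_lintegral_le hf hε.ne'
  filter_upwards [hδ.eventually (gt_mem_nhds hr)] with n hn
  exact (hρ n).eLpNorm_mollify_sub_le (hf.locallyIntegrable one_le_two)
    fun y hy => h y (hy.trans hn)

/-- Differentiation falls on the mollifier, and `y ↦ ρ (x - y)` is an admissible test function; the
sign from reflecting its argument cancels the sign in the weak gradient. -/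
theorem HasWeakGrad.classicalGrad_mollify {u : RSpace d → ℂ}
    {g : RSpace d → EuclideanSpace ℂ (Fin d)} (h : HasWeakGrad u g) {ρ : RSpace d → ℝ}
    (hρ : ContDiff ℝ ∞ ρ) (hc : HasCompactSupport ρ) :
    classicalGrad (mollify ρ u) = mollify ρ g := by
  ext x i
  have hd := hc.hasFDerivAt_convolution_left (μ := volume) (ContinuousLinearMap.lsmul ℝ ℝ)
    (hρ.of_le (by simp)) h.1 x
  have hi : Integrable fun y => fderiv ℝ ρ y (coordVec i) • u (x - y) := by
    have := (hc.fderiv_apply (𝕜 := ℝ) (coordVec i)).convolutionExists_left (μ := volume)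
      (ContinuousLinearMap.lsmul ℝ ℝ) ((hρ.continuous_fderiv (by simp)).clm_apply continuous_const)
      h.1 x
    exact this
  have hi2 : Integrable fun y => (ContinuousLinearMap.precompL (RSpace d)
      (ContinuousLinearMap.lsmul ℝ ℝ : ℝ →L[ℝ] ℂ →L[ℝ] ℂ)) (fderiv ℝ ρ y) (u (x - y)) :=
    (hc.fderiv (𝕜 := ℝ)).convolutionExists_left (μ := volume) _ (hρ.continuous_fderiv (by simp))
      h.1 x
  have e1 : fderiv ℝ (mollify ρ u) x (coordVec i) =
      ∫ y, fderiv ℝ ρ y (coordVec i) • u (x - y) := by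
    rw [hd.fderiv, convolution, ContinuousLinearMap.integral_apply hi2]
    rfl
  have e2 : ∫ y, fderiv ℝ ρ y (coordVec i) • u (x - y) =
      ∫ y, fderiv ℝ ρ (x - y) (coordVec i) • u y := by
    rw [← integral_sub_left_eq_self _ volume x]
    simp
  have hz : ContDiff ℝ ∞ fun y => ρ (x - y) := hρ.comp (contDiff_const.sub contDiff_id)
  have hzc : HasCompactSupport fun y => ρ (x - y) := hc.comp_homeomorph (Homeomorph.subLeft x)
  have e3 := h.2.2 _ hz hzc i
  have e4 : ∀ y, fderiv ℝ (fun y => ρ (x - y)) y (coordVec i) =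
      -fderiv ℝ ρ (x - y) (coordVec i) := fun y => by
    have h1 : HasFDerivAt (fun y => x - y) (-ContinuousLinearMap.id ℝ (RSpace d)) y :=
      (hasFDerivAt_id y).const_sub x
    have h2 := ((hρ.differentiable (by simp)) (x - y)).hasFDerivAt.comp y h1
    change fderiv ℝ (ρ ∘ fun y => x - y) y (coordVec i) = _
    rw [h2.fderiv]
    simp
  simp only [e4, neg_smul, integral_neg, neg_inj] at e3
  have e5 : mollify ρ g x i = ∫ y, ρ (x - y) • g y i := by
    rw [mollify_apply_swap]
    have hg : Integrable fun y => ρ (x - y) • g y :=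
      h.2.1.integrable_smul_left_of_hasCompactSupport hz.continuous hzc
    exact ((EuclideanSpace.proj (𝕜 := ℂ) i).integral_comp_comm hg).symm
  rw [e5, ← e3, ← e2, ← e1]
  rfl

theorem classicalGrad_mul {a b : RSpace d → ℂ} {x : RSpace d} (ha : DifferentiableAt ℝ a x)
    (hb : DifferentiableAt ℝ b x) :
    classicalGrad (fun x => a x * b x) x = a x • classicalGrad b x + b x • classicalGrad a x := by
  ext i
  have := (ha.hasFDerivAt.mul hb.hasFDerivAt).fderiv
  simp only [classicalGrad, PiLp.add_apply, PiLp.smul_apply]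
  change fderiv ℝ (a * b) x _ = _
  rw [this]
  simp

theorem classicalGrad_comp_smul {a : RSpace d → ℂ} (ha : Differentiable ℝ a) (c : ℝ)
    (x : RSpace d) :
    classicalGrad (fun x => a (c • x)) x = (c : ℂ) • classicalGrad a (c • x) := by
  ext i
  have h1 : HasFDerivAt (fun y : RSpace d => c • y) (c • ContinuousLinearMap.id ℝ (RSpace d)) x :=
    (hasFDerivAt_id x).const_smul c
  have h2 := (ha (c • x)).hasFDerivAt.comp x h1
  simp only [classicalGrad, PiLp.smul_apply]
  change fderiv ℝ (a ∘ fun y => c • y) x _ = _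
  rw [h2.fderiv]
  simp

/-- A sequence of smooth cutoff functions with gradients tending to zero. -/
theorem exists_cutoff (d : ℕ) : ∃ (χ : ℕ → RSpace d → ℂ) (C : ℝ), (∀ n, IsTestFun (χ n)) ∧
    (∀ n x, ‖χ n x‖ ≤ 1) ∧ (∀ (n : ℕ) x, ‖x‖ ≤ n + 1 → χ n x = 1) ∧
    ∀ n x, ‖classicalGrad (χ n) x‖ ≤ C / (n + 1) := by
  let b : ContDiffBump (0 : RSpace d) := ⟨1, 2, one_pos, one_lt_two⟩
  have hb : IsTestFun fun x => (b x : ℂ) := ⟨Complex.ofRealCLM.contDiff.comp b.contDiff,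
    b.hasCompactSupport.comp_left (g := fun t : ℝ => (t : ℂ)) (by simp)⟩
  obtain ⟨C, hC⟩ := (continuous_classicalGrad hb.1).bounded_above_of_compact_support
    (hasCompactSupport_classicalGrad hb.2)
  have hn : ∀ n : ℕ, ((n : ℝ) + 1)⁻¹ ≠ 0 := fun n => by positivity
  refine ⟨fun n x => (b (((n : ℝ) + 1)⁻¹ • x) : ℂ), C, fun n => ⟨?_, ?_⟩, fun n x => ?_,
    fun n x hx => ?_, fun n x => ?_⟩
  · exact hb.1.comp (contDiff_id.const_smul _)
  · exact hb.2.comp_homeomorph (Homeomorph.smulOfNeZero _ (hn n))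
  · simp only [Complex.norm_real, Real.norm_of_nonneg b.nonneg]
    exact b.le_one
  · have : b (((n : ℝ) + 1)⁻¹ • x) = 1 := by
      refine b.one_of_mem_closedBall ?_
      have hp : (0 : ℝ) < n + 1 := by positivity
      rw [mem_closedBall_zero_iff, norm_smul, norm_inv, Real.norm_of_nonneg hp.le,
        inv_mul_le_iff₀ hp]
      simpa [b] using hx
    simp [this]
  · have hp : (0 : ℝ) < n + 1 := by positivity
    rw [classicalGrad_comp_smul hb.differentiable, norm_smul, Complex.norm_real, norm_inv,
      Real.norm_of_nonneg hp.le, div_eq_inv_mul]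
    gcongr
    exact hC _

theorem tendsto_eLpNorm_smul_sub {F : Type*} [NormedAddCommGroup F] [NormedSpace ℂ F]
    {f : RSpace d → F} (hf : MemLp f 2) {χ : ℕ → RSpace d → ℂ}
    (hm : ∀ n, AEStronglyMeasurable (χ n) volume) (h1 : ∀ n x, ‖χ n x‖ ≤ 1)
    (h2 : ∀ x, Tendsto (fun n => χ n x) atTop (𝓝 1)) :
    Tendsto (fun n => eLpNorm (fun x => χ n x • f x - f x) 2 volume) atTop (𝓝 0) := by
  rw [tendsto_eLpNorm_two_zero_iff]
  have h0 : ∫⁻ x : RSpace d, (0 : ℝ≥0∞) = 0 := by simp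
  rw [← h0]
  refine tendsto_lintegral_of_dominated_convergence' (fun x => (2 * ‖f x‖ₑ) ^ 2)
    (fun n => (((hm n).smul hf.1).sub hf.1).enorm.pow_const 2)
    (fun n => Eventually.of_forall fun x => ?_) ?_ (Eventually.of_forall fun x => ?_)
  · simp only
    gcongr
    calc ‖χ n x • f x - f x‖ₑ ≤ ‖χ n x • f x‖ₑ + ‖f x‖ₑ := enorm_sub_le
      _ ≤ 1 * ‖f x‖ₑ + ‖f x‖ₑ := by
        gcongr
        rw [enorm_smul]
        gcongr
        rw [← ofReal_norm, ← ENNReal.ofReal_one]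
        exact ENNReal.ofReal_le_ofReal (h1 n x)
      _ = 2 * ‖f x‖ₑ := by ring
  · simp only [mul_pow]
    rw [lintegral_const_mul'' _ (hf.1.enorm.pow_const 2), ← eLpNorm_two_sq]
    exact ENNReal.mul_ne_top (by norm_num) (ENNReal.pow_ne_top hf.eLpNorm_ne_top)
  · have h3 : Tendsto (fun n => χ n x • f x - f x) atTop (𝓝 0) := by
      simpa using ((h2 x).smul_const (f x)).sub_const (f x)
    have h4 := ((ENNReal.continuous_pow 2).tendsto _).comp h3.enorm
    simpa [Function.comp_def] using h4

variable [Fact (3 ≤ d)]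

/-- The cutoffs `χₙ w` converge to `w` in gradient norm: `χₙ∇w → ∇w` by dominated convergence, while
`w∇χₙ` is of order `‖w‖₂ / n`, which is where `w ∈ L²` enters. Their limit in the critical Sobolev
space agrees with `w` almost everywhere because `χₙ → 1` pointwise. -/
theorem inHDot_of_contDiff {w : RSpace d → ℂ} (hw : ContDiff ℝ ∞ w) (hw2 : MemLp w 2)
    (hg : MemLp (classicalGrad w) 2) : InHDot w (classicalGrad w) := by
  obtain ⟨χ, C, h1, h2, h3, h4⟩ := exists_cutoff d
  have ht : ∀ n, IsTestFun fun x => χ n x * w x := fun n => ⟨(h1 n).1.mul hw, (h1 n).2.mul_right⟩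
  have hlim : ∀ x, Tendsto (fun n => χ n x) atTop (𝓝 1) := fun x => by
    refine tendsto_const_nhds.congr' ?_
    filter_upwards [eventually_ge_atTop ⌈‖x‖⌉₊] with n hn
    refine (h3 n x ?_).symm
    have := Nat.le_of_ceil_le hn
    linarith
  have t1 := tendsto_eLpNorm_smul_sub hg (fun n => (h1 n).1.continuous.aestronglyMeasurable) h2 hlim
  have hgrad : ∀ n, classicalGrad (fun x => χ n x * w x) - classicalGrad w =
      (fun x => χ n x • classicalGrad w x - classicalGrad w x) +
        fun x => w x • classicalGrad (χ n) x := fun n => by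
    ext1 x
    rw [Pi.sub_apply, classicalGrad_mul (h1 n).differentiable.differentiableAt
      (hw.differentiable (by simp)).differentiableAt, Pi.add_apply]
    abel
  have t2 : Tendsto (fun n => eLpNorm (fun x => w x • classicalGrad (χ n) x) 2 volume) atTop
      (𝓝 0) := by
    have hz : Tendsto (fun n : ℕ => ENNReal.ofReal (C / ((n : ℝ) + 1)) * eLpNorm w 2 volume) atTop
        (𝓝 0) := by
      have a : Tendsto (fun n : ℕ => C / ((n : ℝ) + 1)) atTop (𝓝 0) :=
        tendsto_const_nhds.div_atTop (tendsto_natCast_atTop_atTop.atTop_add tendsto_const_nhds)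
      have b := ENNReal.Tendsto.mul_const (ENNReal.tendsto_ofReal a) (Or.inr hw2.eLpNorm_ne_top)
      simpa using b
    refine tendsto_of_tendsto_of_tendsto_of_le_of_le tendsto_const_nhds hz (fun _ => zero_le)
      fun n => ?_
    refine eLpNorm_le_mul_eLpNorm_of_ae_le_mul (Eventually.of_forall fun x => ?_) 2
    rw [norm_smul, mul_comm]
    gcongr
    exact h4 n x
  have t3 : Tendsto (fun n => eLpNorm (classicalGrad (fun x => χ n x * w x) - classicalGrad w) 2
      volume) atTop (𝓝 0) := by
    have t := t1.add t2
    rw [add_zero] at t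
    refine tendsto_of_tendsto_of_tendsto_of_le_of_le tendsto_const_nhds t (fun _ => zero_le)
      fun n => ?_
    simp only [hgrad]
    refine eLpNorm_add_le ?_ ?_ one_le_two
    · exact (((h1 n).1.continuous.smul (continuous_classicalGrad hw)).sub
        (continuous_classicalGrad hw)).aestronglyMeasurable
    · exact (hw.continuous.smul (continuous_classicalGrad (h1 n).1)).aestronglyMeasurable
  obtain ⟨u, hu, t4⟩ := exists_inHDot_of_tendsto hg (fun n => (ht n).inHDot) t3
  obtain ⟨ns, hns, hae⟩ := (tendstoInMeasure_of_tendsto_eLpNorm sobExp_ne_zero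
    (fun n => ((ht n).memLp (sobExp d)).1) hu.memLp.1 t4).exists_seq_tendsto_ae
  refine hu.congr ?_ EventuallyEq.rfl
  filter_upwards [hae] with x hx
  refine tendsto_nhds_unique hx ?_
  simpa using ((hlim x).comp hns.tendsto_atTop).mul_const (w x)

/-- `H¹ ⊆ Ḣ¹`. -/
theorem MemH1.inHDot {u : RSpace d → ℂ} {g : RSpace d → EuclideanSpace ℂ (Fin d)}
    (h : MemH1 u g) : InHDot u g := by
  have hδ : ∀ n : ℕ, (0 : ℝ) < 1 / ((n : ℝ) + 1) := fun n => by positivity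
  choose ρ hρ using fun n => exists_isMollifier d (hδ n)
  have l1 := tendsto_mollify h.1 hρ tendsto_one_div_add_atTop_nhds_zero_nat
  have l2 := tendsto_mollify h.2.2 hρ tendsto_one_div_add_atTop_nhds_zero_nat
  -- Once a mollification is within distance `1` of a function in `L²`, it is itself in `L²`; this
  -- gives membership without a convolution inequality.
  obtain ⟨N, hN⟩ := eventually_atTop.1
    (((tendsto_order.1 l1).2 1 one_pos).and ((tendsto_order.1 l2).2 1 one_pos))
  have hc : ∀ n, ContDiff ℝ ∞ (mollify (ρ n) u) := fun n =>
    (hρ n).compact.contDiff_convolution_left _ (hρ n).contDiff h.2.1.1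
  have eg : ∀ n, classicalGrad (mollify (ρ n) u) = mollify (ρ n) g := fun n =>
    h.2.1.classicalGrad_mollify (hρ n).contDiff (hρ n).compact
  have hin : ∀ n, N ≤ n → InHDot (mollify (ρ n) u) (mollify (ρ n) g) := fun n hn => by
    rw [← eg n]
    have m1 : MemLp (mollify (ρ n) u - u) 2 :=
      ⟨(hc n).continuous.aestronglyMeasurable.sub h.1.1, (hN n hn).1.trans ENNReal.one_lt_top⟩
    have m2 : MemLp (classicalGrad (mollify (ρ n) u) - g) 2 := by
      refine ⟨(continuous_classicalGrad (hc n)).aestronglyMeasurable.sub h.2.2.1, ?_⟩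
      rw [eg n]
      exact (hN n hn).2.trans ENNReal.one_lt_top
    refine inHDot_of_contDiff (hc n) ?_ ?_
    · simpa using m1.add h.1
    · simpa using m2.add h.2.2
  obtain ⟨v, hv, l3⟩ := exists_inHDot_of_tendsto h.2.2 (fun n => hin (n + N) (by omega))
    (l2.comp (tendsto_add_atTop_nat N))
  refine hv.congr ?_ EventuallyEq.rfl
  -- The mollifications converge to `v` in the critical Sobolev norm and to `u` in `L²`; both imply
  -- convergence in measure, whose limit is unique.
  refine tendstoInMeasure_ae_unique
    (tendstoInMeasure_of_tendsto_eLpNorm sobExp_ne_zero (fun n => (hin (n + N) (by omega)).memLp.1)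
      hv.memLp.1 l3)
    (tendstoInMeasure_of_tendsto_eLpNorm two_ne_zero (fun n => (hin (n + N) (by omega)).memLp.1)
      h.1.1 (l1.comp (tendsto_add_atTop_nat N)))

end Density

/-! ### The potential as a bounded sesquilinear form on `Ḣ¹`. -/

section PotentialForm

variable {d : ℕ}

/-- The exponent `d/2` is conjugate to `d/(d-2)`, the integrability exponent of `|u|²` for `u ∈ Ḣ¹`.
-/
theorem ShortRange.memLp {V : RSpace d → ℝ} (hV : ShortRange V) : MemLp V ((d : ℝ≥0∞) / 2) := by
  rcases hV with ⟨rfl, h⟩ | ⟨rfl, h, -⟩ | ⟨-, h⟩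
  · exact_mod_cast h
  · have : ((4 : ℕ) : ℝ≥0∞) / 2 = 2 := by
      rw [ENNReal.div_eq_inv_mul, show ((4 : ℕ) : ℝ≥0∞) = 2 * 2 by norm_num, ← mul_assoc,
        ENNReal.inv_mul_cancel two_ne_zero ENNReal.ofNat_ne_top, one_mul]
    rwa [this]
  · exact h

/-- Half of the critical Sobolev exponent. -/
noncomputable def halfSobExp (d : ℕ) : ℝ≥0∞ := ENNReal.ofReal (d / (d - 2))

theorem potExp_ne_top : (d : ℝ≥0∞) / 2 ≠ ⊤ :=
  ENNReal.div_ne_top (ENNReal.natCast_ne_top d) two_ne_zero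

theorem aestronglyMeasurable_potential {V : RSpace d → ℝ} {u v : RSpace d → ℂ}
    (hV : AEStronglyMeasurable V volume) (hu : AEStronglyMeasurable u volume)
    (hv : AEStronglyMeasurable v volume) :
    AEStronglyMeasurable (fun x => (V x : ℂ) * (conj (v x) * u x)) volume :=
  (Complex.continuous_ofReal.comp_aestronglyMeasurable hV).mul
    ((Complex.continuous_conj.comp_aestronglyMeasurable hv).mul hu)

theorem integral_potential_self (V : RSpace d → ℝ) (u : RSpace d → ℂ) :
    ∫ x, (V x : ℂ) * (conj (u x) * u x) = ((∫ x, V x * ‖u x‖ ^ 2 : ℝ) : ℂ) := by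
  rw [← integral_complex_ofReal]
  refine integral_congr_ae (Eventually.of_forall fun x => ?_)
  simp [Complex.conj_mul']

variable [hd : Fact (3 ≤ d)]

theorem three_le_cast : (3 : ℝ) ≤ d := by exact_mod_cast hd.out

instance sobExp_holderTriple : (sobExp d).HolderTriple (sobExp d) (halfSobExp d) := ⟨by
  have h := three_le_cast (d := d)
  have h1 : (0 : ℝ) < 2 * d / (d - 2) := div_pos (by linarith) (by linarith)
  have h2 : (0 : ℝ) < d / (d - 2) := div_pos (by linarith) (by linarith)
  have h3 : (d : ℝ) - 2 ≠ 0 := by linarith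
  rw [sobExp, halfSobExp, ← ENNReal.ofReal_inv_of_pos h1, ← ENNReal.ofReal_inv_of_pos h2,
    ← ENNReal.ofReal_add (by positivity) (by positivity)]
  congr 1
  field_simp
  norm_num⟩

instance potExp_holderTriple : ((d : ℝ≥0∞) / 2).HolderTriple (halfSobExp d) 1 := ⟨by
  have h := three_le_cast (d := d)
  have h2 : (0 : ℝ) < d / (d - 2) := div_pos (by linarith) (by linarith)
  have h3 : (d : ℝ) - 2 ≠ 0 := by linarith
  have h4 : (0 : ℝ) < d / 2 := by linarith
  have e : (d : ℝ≥0∞) / 2 = ENNReal.ofReal (d / 2) := by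
    rw [ENNReal.ofReal_div_of_pos two_pos, ENNReal.ofReal_natCast, ENNReal.ofReal_ofNat]
  rw [e, halfSobExp, ← ENNReal.ofReal_inv_of_pos h4, ← ENNReal.ofReal_inv_of_pos h2,
    ← ENNReal.ofReal_add (by positivity) (by positivity), inv_one, ← ENNReal.ofReal_one]
  congr 1
  field_simp
  norm_num⟩

theorem one_le_potExp : 1 ≤ (d : ℝ≥0∞) / 2 := by
  rw [ENNReal.le_div_iff_mul_le (by simp) (by simp), one_mul]
  have := hd.out
  exact_mod_cast (by omega : 2 ≤ d)

/-- Hölder twice, with `1/2* + 1/2* = (d-2)/d` and `2/d + (d-2)/d = 1`, where `2* = 2d/(d-2)`. -/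
theorem lintegral_potential_le {V : RSpace d → ℝ} (hV : MemLp V ((d : ℝ≥0∞) / 2))
    {u v : RSpace d → ℂ} (hu : MemLp u (sobExp d)) (hv : MemLp v (sobExp d)) :
    ∫⁻ x, ‖V x‖ₑ * (‖v x‖ₑ * ‖u x‖ₑ) ≤
      eLpNorm V ((d : ℝ≥0∞) / 2) volume *
        (eLpNorm v (sobExp d) volume * eLpNorm u (sobExp d) volume) := by
  have h1 : eLpNorm (v • u) (halfSobExp d) volume ≤
      eLpNorm v (sobExp d) volume * eLpNorm u (sobExp d) volume :=
    eLpNorm_smul_le_mul_eLpNorm hu.1 hv.1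
  have h2 : eLpNorm (V • (v • u)) 1 volume ≤
      eLpNorm V ((d : ℝ≥0∞) / 2) volume * eLpNorm (v • u) (halfSobExp d) volume :=
    eLpNorm_smul_le_mul_eLpNorm (hv.1.smul hu.1) hV.1
  rw [eLpNorm_one_eq_lintegral_enorm] at h2
  simp only [Pi.smul_apply', enorm_smul] at h2
  exact h2.trans (by gcongr)

theorem integrable_potential {V : RSpace d → ℝ} (hV : MemLp V ((d : ℝ≥0∞) / 2))
    {u v : RSpace d → ℂ} (hu : MemLp u (sobExp d)) (hv : MemLp v (sobExp d)) :
    Integrable fun x => (V x : ℂ) * (conj (v x) * u x) := by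
  refine ⟨aestronglyMeasurable_potential hV.1 hu.1 hv.1, ?_⟩
  refine lt_of_le_of_lt (le_of_eq ?_) ((lintegral_potential_le hV hu hv).trans_lt
    (ENNReal.mul_lt_top hV.2 (ENNReal.mul_lt_top hv.2 hu.2)))
  refine lintegral_congr fun x => ?_
  simp [enorm_eq_nnnorm]

theorem norm_integral_potential_le {V : RSpace d → ℝ} (hV : MemLp V ((d : ℝ≥0∞) / 2))
    {u v : RSpace d → ℂ} (hu : MemLp u (sobExp d)) (hv : MemLp v (sobExp d)) :
    ‖∫ x, (V x : ℂ) * (conj (v x) * u x)‖ ≤ (eLpNorm V ((d : ℝ≥0∞) / 2) volume).toReal *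
      ((eLpNorm v (sobExp d) volume).toReal * (eLpNorm u (sobExp d) volume).toReal) := by
  rw [← ENNReal.toReal_mul, ← ENNReal.toReal_mul, ← toReal_enorm]
  refine ENNReal.toReal_mono (ENNReal.mul_ne_top hV.2.ne (ENNReal.mul_ne_top hv.2.ne hu.2.ne))
    ((enorm_integral_le_lintegral_enorm _).trans ?_)
  refine le_of_eq_of_le (lintegral_congr fun x => ?_) (lintegral_potential_le hV hu hv)
  simp [enorm_eq_nnnorm]

theorem integrable_potential_sq {V : RSpace d → ℝ} (hV : MemLp V ((d : ℝ≥0∞) / 2))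
    {u : RSpace d → ℂ} (hu : MemLp u (sobExp d)) : Integrable fun x => V x * ‖u x‖ ^ 2 := by
  refine (integrable_potential hV hu hu).re.congr (Eventually.of_forall fun x => ?_)
  simp [Complex.conj_mul', ← Complex.ofReal_pow]

/-- The sesquilinear form `⟨v, Vu⟩` in terms of the gradients of `v` and `u`, as a linear map. -/
noncomputable def potFormLin {V : RSpace d → ℝ} (hV : MemLp V ((d : ℝ≥0∞) / 2)) :
    hdotSpace d →ₗ⋆[ℂ] hdotSpace d →ₗ[ℂ] ℂ :=
  LinearMap.mk₂'ₛₗ (starRingEnd ℂ) (RingHom.id ℂ)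
    (fun k g => ∫ x, (V x : ℂ) * (conj (hdotFun d k x) * hdotFun d g x))
    (fun k k' g => by
      rw [← integral_add (integrable_potential hV (Lp.memLp _) (Lp.memLp _))
        (integrable_potential hV (Lp.memLp _) (Lp.memLp _))]
      refine integral_congr_ae ?_
      rw [map_add]
      filter_upwards [Lp.coeFn_add (hdotFun d k) (hdotFun d k')] with x hx
      rw [hx, Pi.add_apply, map_add]
      ring)
    (fun c k g => by
      rw [smul_eq_mul, ← integral_const_mul]
      refine integral_congr_ae ?_
      rw [map_smul]
      filter_upwards [Lp.coeFn_smul c (hdotFun d k)] with x hx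
      rw [hx, Pi.smul_apply, smul_eq_mul, map_mul]
      ring)
    (fun k g g' => by
      rw [← integral_add (integrable_potential hV (Lp.memLp _) (Lp.memLp _))
        (integrable_potential hV (Lp.memLp _) (Lp.memLp _))]
      refine integral_congr_ae ?_
      rw [map_add]
      filter_upwards [Lp.coeFn_add (hdotFun d g) (hdotFun d g')] with x hx
      rw [hx, Pi.add_apply]
      ring)
    (fun c k g => by
      rw [RingHom.id_apply, smul_eq_mul, ← integral_const_mul]
      refine integral_congr_ae ?_
      rw [map_smul]
      filter_upwards [Lp.coeFn_smul c (hdotFun d g)] with x hx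
      rw [hx, Pi.smul_apply, smul_eq_mul]
      ring)

theorem norm_hdotFun_le (g : hdotSpace d) : ‖hdotFun d g‖ ≤ sobConst d * ‖g‖ :=
  norm_hdotPot_le g

/-- The sesquilinear form `⟨v, Vu⟩` in terms of the gradients of `v` and `u`. -/
noncomputable def potForm {V : RSpace d → ℝ} (hV : MemLp V ((d : ℝ≥0∞) / 2)) :
    hdotSpace d →L⋆[ℂ] hdotSpace d →L[ℂ] ℂ :=
  (potFormLin hV).mkContinuous₂ ((eLpNorm V ((d : ℝ≥0∞) / 2) volume).toReal * sobConst d ^ 2)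
    fun k g => (norm_integral_potential_le hV (Lp.memLp _) (Lp.memLp _)).trans (by
      rw [← Lp.norm_def, ← Lp.norm_def]
      calc _ ≤ (eLpNorm V ((d : ℝ≥0∞) / 2) volume).toReal *
            ((sobConst d * ‖k‖) * (sobConst d * ‖g‖)) := by
            gcongr
            · exact norm_hdotFun_le k
            · exact norm_hdotFun_le g
        _ = _ := by ring)

theorem potForm_apply {V : RSpace d → ℝ} (hV : MemLp V ((d : ℝ≥0∞) / 2)) (k g : hdotSpace d) :
    potForm hV k g = ∫ x, (V x : ℂ) * (conj (hdotFun d k x) * hdotFun d g x) := rfl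

theorem potForm_conj {V : RSpace d → ℝ} (hV : MemLp V ((d : ℝ≥0∞) / 2)) (k g : hdotSpace d) :
    conj (potForm hV k g) = potForm hV g k := by
  rw [potForm_apply, potForm_apply, ← integral_conj]
  refine integral_congr_ae (Eventually.of_forall fun x => ?_)
  simp only [map_mul, Complex.conj_conj, Complex.conj_ofReal]
  ring

/-- The element of `hdotSpace` given by a function and its gradient. -/
noncomputable def InHDot.elem {u : RSpace d → ℂ} {g : RSpace d → EuclideanSpace ℂ (Fin d)}
    (h : InHDot u g) : hdotSpace d := ⟨h.memLp_grad.toLp g, mem_hdotSpace_of_mem h.toLp_mem⟩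

theorem InHDot.coe_elem {u : RSpace d → ℂ} {g : RSpace d → EuclideanSpace ℂ (Fin d)}
    (h : InHDot u g) : ((h.elem : GradSpace d) : RSpace d → EuclideanSpace ℂ (Fin d)) =ᵐ[volume] g :=
  h.memLp_grad.coeFn_toLp

theorem InHDot.hdotFun_elem {u : RSpace d → ℂ} {g : RSpace d → EuclideanSpace ℂ (Fin d)}
    (h : InHDot u g) : hdotFun d h.elem =ᵐ[volume] u := by
  have : hdotFun d h.elem = h.memLp.toLp u :=
    hdotGraph_fst_unique (hdotFun_mem h.elem) h.toLp_mem
  rw [this]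
  exact h.memLp.coeFn_toLp

theorem InHDot.potForm_elem {V : RSpace d → ℝ} (hV : MemLp V ((d : ℝ≥0∞) / 2))
    {u v : RSpace d → ℂ} {g k : RSpace d → EuclideanSpace ℂ (Fin d)}
    (hu : InHDot u g) (hv : InHDot v k) :
    potForm hV hv.elem hu.elem = ∫ x, (V x : ℂ) * (conj (v x) * u x) := by
  rw [potForm_apply]
  refine integral_congr_ae ?_
  filter_upwards [hu.hdotFun_elem, hv.hdotFun_elem] with x h1 h2
  rw [h1, h2]

theorem InHDot.inner_elem {u v : RSpace d → ℂ} {g k : RSpace d → EuclideanSpace ℂ (Fin d)}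
    (hu : InHDot u g) (hv : InHDot v k) :
    inner ℂ hv.elem hu.elem = ∫ x, inner ℂ (k x) (g x) := by
  rw [Submodule.coe_inner, L2.inner_def]
  refine integral_congr_ae ?_
  filter_upwards [hu.coe_elem, hv.coe_elem] with x h1 h2
  rw [h1, h2]

theorem InHDot.norm_elem_sq {u : RSpace d → ℂ} {g : RSpace d → EuclideanSpace ℂ (Fin d)}
    (h : InHDot u g) : ‖h.elem‖ ^ 2 = ∫ x, ‖g x‖ ^ 2 := by
  have h1 := h.inner_elem h
  have h2 : ∀ x, inner ℂ (g x) (g x) = ((‖g x‖ ^ 2 : ℝ) : ℂ) := fun x => by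
    simp
  have h3 : inner ℂ h.elem h.elem = ((‖h.elem‖ ^ 2 : ℝ) : ℂ) := by
    simp
  simp only [h2, h3, integral_complex_ofReal] at h1
  exact_mod_cast h1

theorem InHDot.potForm_self {V : RSpace d → ℝ} (hV : MemLp V ((d : ℝ≥0∞) / 2))
    {u : RSpace d → ℂ} {g : RSpace d → EuclideanSpace ℂ (Fin d)} (h : InHDot u g) :
    (potForm hV h.elem h.elem).re = ∫ x, V x * ‖u x‖ ^ 2 := by
  rw [h.potForm_elem hV h, integral_potential_self, Complex.ofReal_re]

theorem continuous_potForm_self {V : RSpace d → ℝ} (hV : MemLp V ((d : ℝ≥0∞) / 2)) :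
    Continuous fun g => (potForm hV g g).re :=
  Complex.continuous_re.comp ((potForm hV).continuous.clm_apply continuous_id)

theorem exists_testFun_tendsto (g : hdotSpace d) : ∃ η : ℕ → RSpace d → ℂ,
    ∃ h : ∀ n, IsTestFun (η n), Tendsto (fun n => (h n).inHDot.elem) atTop (𝓝 g) := by
  obtain ⟨η, h1, -, h3, -⟩ := (inHDot_hdotFun g).exists_seq
  refine ⟨η, h1, ?_⟩
  rw [tendsto_subtype_rng]
  have := (Lp.tendsto_Lp_iff_tendsto_eLpNorm'' _ (fun n => (h1 n).memLp_grad 2) _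
    (Lp.memLp (g : GradSpace d))).2 h3
  rwa [Lp.toLp_coeFn] at this

/-- Nonnegativity of the form extends from `H¹` to `Ḣ¹`. -/
theorem SchrodingerNonneg.nonneg {V : RSpace d → ℝ} (hV : MemLp V ((d : ℝ≥0∞) / 2))
    (h : SchrodingerNonneg V) (g : hdotSpace d) : 0 ≤ ‖g‖ ^ 2 + (potForm hV g g).re := by
  obtain ⟨η, h1, h2⟩ := exists_testFun_tendsto g
  have hc : Continuous fun g => ‖g‖ ^ 2 + (potForm hV g g).re :=
    (continuous_norm.pow 2).add (continuous_potForm_self hV)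
  refine ge_of_tendsto ((hc.tendsto g).comp h2) (Eventually.of_forall fun n => ?_)
  rw [Function.comp_apply, (h1 n).inHDot.norm_elem_sq, (h1 n).inHDot.potForm_self]
  exact h _ _ (MemFormDomain.of_contDiff (hV.locallyIntegrable one_le_potExp) (h1 n).1 (h1 n).2)

theorem MemH1.memFormDomain {V : RSpace d → ℝ} (hV : MemLp V ((d : ℝ≥0∞) / 2)) {u : RSpace d → ℂ}
    {g : RSpace d → EuclideanSpace ℂ (Fin d)} (h : MemH1 u g) : MemFormDomain V u g :=
  ⟨h, integrable_potential_sq hV h.inHDot.memLp⟩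

end PotentialForm

/-! ### An abstract Lax–Milgram argument. -/

section LaxMilgram

/-- The Lax–Milgram theorem for a form `c⟨Ev, Ew⟩ + ⟨Ev, K(Ew)⟩ + τ⟨Pv, Pw⟩`. -/
theorem exists_forall_form_eq_inner {W L E : Type*}
    [NormedAddCommGroup W] [InnerProductSpace ℂ W] [CompleteSpace W]
    [NormedAddCommGroup L] [InnerProductSpace ℂ L] [CompleteSpace L]
    [NormedAddCommGroup E] [InnerProductSpace ℂ E] [CompleteSpace E]
    (P : W →L[ℂ] L) (T : W →L[ℂ] E) (K : E →L[ℂ] E) {c τ κ : ℝ} (hτ : 0 < τ) (hκ : 0 < κ)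
    (hnorm : ∀ w, ‖w‖ ^ 2 = ‖P w‖ ^ 2 + ‖T w‖ ^ 2)
    (hco : ∀ e, κ * ‖e‖ ^ 2 ≤ c * ‖e‖ ^ 2 + (inner ℂ e (K e)).re) (f : L) :
    ∃ w, ∀ v, (c : ℂ) * inner ℂ (T v) (T w) + inner ℂ (T v) (K (T w))
      + (τ : ℂ) * inner ℂ (P v) (P w) = inner ℂ (P v) f := by
  -- Adjoints turn the form into one bounded operator on `W`; coercivity with constant `min κ τ`
  -- makes it invertible.
  let S : W →L[ℂ] W := (c : ℂ) • (T.adjoint ∘L T) + T.adjoint ∘L (K ∘L T)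
    + (τ : ℂ) • (P.adjoint ∘L P)
  have hS : ∀ v w, inner ℂ v (S w) = (c : ℂ) * inner ℂ (T v) (T w) + inner ℂ (T v) (K (T w))
      + (τ : ℂ) * inner ℂ (P v) (P w) := fun v w => by
    simp [S, ContinuousLinearMap.adjoint_inner_right]
  have hu : IsUnit S := by
    have hm : 0 < min κ τ := lt_min hκ hτ
    refine ContinuousLinearMap.isUnit_of_forall_le_norm_inner_map S (c := ⟨min κ τ, hm.le⟩) hm
      fun x => ?_
    rw [norm_inner_symm]
    refine le_trans ?_ (Complex.re_le_norm _)
    have e1 : ∀ y : E, inner ℂ y y = ((‖y‖ ^ 2 : ℝ) : ℂ) := fun y => by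
      simp
    have e2 : ∀ y : L, inner ℂ y y = ((‖y‖ ^ 2 : ℝ) : ℂ) := fun y => by
      simp
    rw [hS, e1, e2, Complex.add_re, Complex.add_re, ← Complex.ofReal_mul, ← Complex.ofReal_mul,
      Complex.ofReal_re, Complex.ofReal_re, hnorm]
    have h1 := hco (T x)
    have h2 : min κ τ ≤ κ := min_le_left _ _
    have h3 : min κ τ ≤ τ := min_le_right _ _
    change (‖P x‖ ^ 2 + ‖T x‖ ^ 2) * min κ τ ≤ _
    nlinarith [mul_le_mul_of_nonneg_right h2 (sq_nonneg ‖T x‖),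
      mul_le_mul_of_nonneg_right h3 (sq_nonneg ‖P x‖)]
  obtain ⟨U, hU⟩ := hu
  refine ⟨(↑U⁻¹ : W →L[ℂ] W) (P.adjoint f), fun v => ?_⟩
  rw [← hS, ← hU, ← mul_apply_eq_comp, Units.mul_inv, one_apply_eq_self,
    ContinuousLinearMap.adjoint_inner_right]

end LaxMilgram

/-! ### From coercivity of the form to the resolvent set of the operator. -/

section Resolvent

variable {d : ℕ} [Fact (3 ≤ d)]

/-- The Sobolev space `H¹` as a Hilbert space of pairs. -/
noncomputable def h1Space (d : ℕ) [Fact (3 ≤ d)] :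
    Submodule ℂ (WithLp 2 (L2Space d × GradSpace d)) where
  carrier := {w | InHDot w.fst w.snd}
  zero_mem' := by
    refine ((isTestFun_zero (d := d)).inHDot).congr (Lp.coeFn_zero _ _ _).symm ?_
    refine EventuallyEq.trans (Eventually.of_forall fun x => ?_) (Lp.coeFn_zero _ _ _).symm
    ext i
    simp [classicalGrad]
  add_mem' := fun ha hb => (InHDot.add ha hb).congr (Lp.coeFn_add _ _).symm
    (Lp.coeFn_add _ _).symm
  smul_mem' := fun c _ ha => (InHDot.const_smul ha c).congr (Lp.coeFn_smul _ _).symm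
    (Lp.coeFn_smul _ _).symm

/-- A convergent sequence of pairs has an `L²` limit from the ambient space and a critical Sobolev
limit from its gradients; uniqueness of limits in measure identifies the two. -/
theorem h1Space_isClosed : IsClosed (h1Space d : Set (WithLp 2 (L2Space d × GradSpace d))) := by
  refine IsSeqClosed.isClosed fun w w₀ hw hlim => ?_
  have t1 := ((WithLp.fstL 2 ℂ (L2Space d) (GradSpace d)).continuous.tendsto _).comp hlim
  have t2 := ((WithLp.sndL 2 ℂ (L2Space d) (GradSpace d)).continuous.tendsto _).comp hlim
  rw [Lp.tendsto_Lp_iff_tendsto_eLpNorm'] at t1 t2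
  have hw' : ∀ n, InHDot (w n).fst (w n).snd := hw
  obtain ⟨u, hu, l⟩ := exists_inHDot_of_tendsto (Lp.memLp _) hw' t2
  refine hu.congr ?_ EventuallyEq.rfl
  exact tendstoInMeasure_ae_unique
    (tendstoInMeasure_of_tendsto_eLpNorm sobExp_ne_zero (fun n => (hw' n).memLp.1)
      hu.memLp.1 l)
    (tendstoInMeasure_of_tendsto_eLpNorm two_ne_zero (fun n => (hw' n).memLp.1)
      (Lp.memLp _).1 t1)

instance h1Space_complete : CompleteSpace (h1Space d) := h1Space_isClosed.completeSpace_coe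

/-- The inclusion of `H¹` in `L²`. -/
noncomputable def h1Fun (d : ℕ) [Fact (3 ≤ d)] : h1Space d →L[ℂ] L2Space d :=
  (WithLp.fstL 2 ℂ _ _).comp (h1Space d).subtypeL

theorem snd_mem_hdotSpace (w : h1Space d) : w.1.snd ∈ hdotSpace d := by
  obtain ⟨z, hz, -, h2⟩ := w.2
  rw [← Lp.ext h2]
  exact mem_hdotSpace_of_mem hz

/-- The gradient on `H¹`. -/
noncomputable def h1Grad (d : ℕ) [Fact (3 ≤ d)] : h1Space d →L[ℂ] hdotSpace d :=
  ((WithLp.sndL 2 ℂ _ _).comp (h1Space d).subtypeL).codRestrict _ snd_mem_hdotSpace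

theorem h1_norm_sq (w : h1Space d) : ‖w‖ ^ 2 = ‖h1Fun d w‖ ^ 2 + ‖h1Grad d w‖ ^ 2 := by
  rw [Submodule.coe_norm, Submodule.coe_norm]
  exact WithLp.prod_norm_sq_eq_of_L2 w.1

/-- The bounded operator on `Ḣ¹` that represents the potential. -/
noncomputable def potOp {V : RSpace d → ℝ} (hV : MemLp V ((d : ℝ≥0∞) / 2)) :
    hdotSpace d →L[ℂ] hdotSpace d :=
  InnerProductSpace.continuousLinearMapOfBilin (potForm hV)

theorem inner_potOp {V : RSpace d → ℝ} (hV : MemLp V ((d : ℝ≥0∞) / 2)) (k g : hdotSpace d) :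
    inner ℂ k (potOp hV g) = potForm hV k g := by
  rw [← inner_conj_symm (𝕜 := ℂ) k, potOp, InnerProductSpace.continuousLinearMapOfBilin_apply, potForm_conj]

theorem h1Space_memH1 (w : h1Space d) : MemH1 w.1.fst w.1.snd :=
  ⟨Lp.memLp _, InHDot.hasWeakGrad w.2, Lp.memLp _⟩

theorem elem_eq_h1Grad (w : h1Space d) (h : InHDot w.1.fst w.1.snd) : h.elem = h1Grad d w :=
  Subtype.ext (Lp.toLp_coeFn w.1.snd (Lp.memLp _))

/-- Lets the form-domain test functions of `schrodingerGraph` be fed into the abstract Lax–Milgram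
identity. -/
theorem exists_h1Space {v : L2Space d} {k : RSpace d → EuclideanSpace ℂ (Fin d)}
    (h : MemH1 v k) : ∃ w : h1Space d, h1Fun d w = v ∧ h1Grad d w = h.inHDot.elem := by
  have hm : WithLp.toLp 2 (v, h.2.2.toLp k) ∈ h1Space d :=
    h.inHDot.congr EventuallyEq.rfl h.2.2.coeFn_toLp.symm
  exact ⟨⟨_, hm⟩, rfl, rfl⟩

/-- Surjectivity of `A - t`: Lax–Milgram on `H¹` with zeroth-order coefficient `τ = -t > 0` solves
`(A - t)u = f`, written as `Au = f + tu`. -/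
theorem exists_mem_schrodingerGraph {V : RSpace d → ℝ} (hV : MemLp V ((d : ℝ≥0∞) / 2))
    {c κ t : ℝ} (hκ : 0 < κ) (ht : t < 0)
    (hco : ∀ g : hdotSpace d, κ * ‖g‖ ^ 2 ≤ c * ‖g‖ ^ 2 + (potForm hV g g).re) (f : L2Space d) :
    ∃ u : L2Space d, (u, f + (t : ℂ) • u) ∈ schrodingerGraph c V := by
  obtain ⟨w, hw⟩ := exists_forall_form_eq_inner (h1Fun d) (h1Grad d) (potOp hV) (c := c)
    (neg_pos.2 ht) hκ h1_norm_sq (fun e => by rw [inner_potOp]; exact hco e) f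
  refine ⟨h1Fun d w, w.1.snd, (h1Space_memH1 w).memFormDomain hV, fun v k hv => ?_⟩
  obtain ⟨w', h1, h2⟩ := exists_h1Space hv.1
  have e := hw w'
  have hin : InHDot w.1.fst w.1.snd := w.2
  rw [inner_potOp, h1, h2, ← elem_eq_h1Grad w hin, hin.inner_elem hv.1.inHDot,
    hin.potForm_elem hV hv.1.inHDot] at e
  rw [inner_add_right, inner_smul_right, ← e]
  push_cast
  change _ + (∫ x, (V x : ℂ) * (conj (v x) * w.1.fst x)) = _
  ring

/-- Pair `(A - t)u` with `u`: the form part is nonnegative, leaving `-t‖u‖²`, and Cauchy–Schwarz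
finishes. For `t < 0` this gives both injectivity and the resolvent bound. -/
theorem mul_norm_le_of_mem_schrodingerGraph {V : RSpace d → ℝ} (hV : MemLp V ((d : ℝ≥0∞) / 2))
    {c t : ℝ} (hnn : ∀ g : hdotSpace d, 0 ≤ c * ‖g‖ ^ 2 + (potForm hV g g).re)
    {u f : L2Space d} (h : (u, f) ∈ schrodingerGraph c V) :
    -t * ‖u‖ ≤ ‖f - (t : ℂ) • u‖ := by
  obtain ⟨g, hg, he⟩ := h
  have e := he u g hg
  have hin := hg.1.inHDot
  have h1 := hnn hin.elem
  have e1 : inner ℂ hin.elem hin.elem = ((‖hin.elem‖ ^ 2 : ℝ) : ℂ) := by simp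
  simp only at e
  rw [← hin.inner_elem hin, ← hin.potForm_elem hV hin, e1] at e
  have e2 : (inner ℂ u (f - (t : ℂ) • u)).re =
      c * ‖hin.elem‖ ^ 2 + (potForm hV hin.elem hin.elem).re - t * ‖u‖ ^ 2 := by
    have e3 : inner ℂ u u = ((‖u‖ ^ 2 : ℝ) : ℂ) := by simp
    rw [inner_sub_right, inner_smul_right, ← e, e3, ← Complex.ofReal_mul, ← Complex.ofReal_mul,
      Complex.sub_re, Complex.add_re, Complex.ofReal_re, Complex.ofReal_re]
  have h2 : -t * ‖u‖ ^ 2 ≤ ‖u‖ * ‖f - (t : ℂ) • u‖ := by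
    have := (Complex.re_le_norm _).trans (norm_inner_le_norm (𝕜 := ℂ) u (f - (t : ℂ) • u))
    linarith
  rcases (norm_nonneg u).eq_or_lt with h0 | h0
  · rw [← h0]
    simp
  · refine le_of_mul_le_mul_left ?_ h0
    linarith

theorem schrodingerOp_graph (c : ℝ) {V : RSpace d → ℝ} (hV : MemLp V ((d : ℝ≥0∞) / 2)) :
    (schrodingerOp c V).graph = schrodingerGraph c V :=
  Submodule.toLinearPMap_graph_eq _
    (schrodingerGraph_eq_zero c (hV.locallyIntegrable one_le_potExp))

theorem neg_mem_opResolventSet {V : RSpace d → ℝ} (hV : MemLp V ((d : ℝ≥0∞) / 2))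
    {c κ t : ℝ} (hκ : 0 < κ) (ht : t < 0)
    (hco : ∀ g : hdotSpace d, κ * ‖g‖ ^ 2 ≤ c * ‖g‖ ^ 2 + (potForm hV g g).re) :
    (t : ℂ) ∈ opResolventSet (schrodingerOp c V) := by
  have hgr := schrodingerOp_graph c hV
  have hb : ∀ u : (schrodingerOp c V).domain, -t * ‖u‖ ≤ ‖shiftedOp (schrodingerOp c V) t u‖ := by
    intro u
    refine mul_norm_le_of_mem_schrodingerGraph hV
      (fun g => le_trans (by positivity) (hco g)) ?_
    rw [← hgr]
    exact (schrodingerOp c V).mem_graph u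
  refine ⟨⟨?_, fun f => ?_⟩, (-t)⁻¹, fun u => ?_⟩
  · rw [injective_iff_map_eq_zero]
    intro u hu
    have := hb u
    rw [hu, norm_zero] at this
    have h0 : ‖u‖ ≤ 0 := by
      by_contra hlt
      nlinarith [mul_pos (neg_pos.2 ht) (not_le.1 hlt)]
    exact norm_le_zero_iff.1 h0
  · obtain ⟨u, hu⟩ := exists_mem_schrodingerGraph hV hκ ht hco f
    rw [← hgr, LinearPMap.mem_graph_iff] at hu
    obtain ⟨y, h1, h2⟩ := hu
    refine ⟨y, ?_⟩
    change schrodingerOp c V y - (t : ℂ) • (y : L2Space d) = f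
    rw [h2, h1]
    simp
  · rw [← div_eq_inv_mul, le_div_iff₀ (neg_pos.2 ht), mul_comm]
    exact hb u

/-- If the operator `-cΔ + V` has negative spectrum, its form is not coercive. -/
theorem exists_form_lt_of_extInf_neg {V : RSpace d → ℝ} (hV : MemLp V ((d : ℝ≥0∞) / 2))
    {c κ : ℝ} (hκ : 0 < κ) (h : extInf (opSpectrum (schrodingerOp c V)) < 0) :
    ∃ g : hdotSpace d, c * ‖g‖ ^ 2 + (potForm hV g g).re < κ * ‖g‖ ^ 2 := by
  by_contra! hco
  refine absurd h (not_lt.2 (le_iInf₂ fun t ht => ?_))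
  by_contra! hlt
  exact ht (neg_mem_opResolventSet hV hκ (by exact_mod_cast hlt) hco)

end Resolvent

/-! ### Rellich compactness and weak continuity of the potential form. -/

section Compactness

variable {d : ℕ}

theorem enorm_integral_smul_le {p : ℝ≥0∞} (hp : 1 ≤ p) {ζ : RSpace d → ℝ} {f : RSpace d → ℂ}
    (hζ : AEStronglyMeasurable ζ volume) (hf : AEStronglyMeasurable f volume) :
    ‖∫ x, ζ x • f x‖ₑ ≤ eLpNorm ζ p.conjExponent volume * eLpNorm f p volume := by
  have hpq : p.HolderConjugate p.conjExponent := ENNReal.HolderConjugate.conjExponent hp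
  have hqp : p.conjExponent.HolderTriple p 1 := hpq.symm
  refine (enorm_integral_le_lintegral_enorm _).trans ?_
  have := eLpNorm_smul_le_mul_eLpNorm (p := p.conjExponent) (q := p) (r := 1) hf hζ
  rwa [eLpNorm_one_eq_lintegral_enorm] at this

variable [Fact (3 ≤ d)]

/-- Integration against a continuous compactly supported function, on `Ḣ¹`. -/
noncomputable def testFunctional {ζ : RSpace d → ℝ} (hζ : Continuous ζ)
    (hc : HasCompactSupport ζ) : hdotSpace d →L[ℂ] ℂ :=
  LinearMap.mkContinuous
    { toFun := fun g => ∫ x, ζ x • hdotFun d g x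
      map_add' := fun g k => by
        have hi : ∀ g : hdotSpace d, Integrable fun x => ζ x • hdotFun d g x := fun g =>
          ((Lp.memLp (hdotFun d g)).locallyIntegrable
            Fact.out).integrable_smul_left_of_hasCompactSupport hζ hc
        rw [← integral_add (hi g) (hi k), map_add]
        refine integral_congr_ae ?_
        filter_upwards [Lp.coeFn_add (hdotFun d g) (hdotFun d k)] with x hx
        rw [hx, Pi.add_apply, smul_add]
      map_smul' := fun c g => by
        rw [RingHom.id_apply, ← integral_smul, map_smul]
        refine integral_congr_ae ?_
        filter_upwards [Lp.coeFn_smul c (hdotFun d g)] with x hx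
        rw [hx, Pi.smul_apply, smul_comm] }
    ((eLpNorm ζ (sobExp d).conjExponent volume).toReal * sobConst d) fun g => by
      have h1 := enorm_integral_smul_le (p := sobExp d) Fact.out hζ.aestronglyMeasurable
        (Lp.memLp (hdotFun d g)).1
      have hq : eLpNorm ζ (sobExp d).conjExponent volume ≠ ⊤ :=
        (hζ.memLp_of_hasCompactSupport hc).eLpNorm_ne_top
      have h2 := ENNReal.toReal_mono (ENNReal.mul_ne_top hq (Lp.memLp _).eLpNorm_ne_top) h1
      rw [ENNReal.toReal_mul, toReal_enorm, ← Lp.norm_def] at h2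
      refine h2.trans ?_
      rw [mul_assoc]
      gcongr
      exact norm_hdotFun_le g

theorem testFunctional_apply {ζ : RSpace d → ℝ} (hζ : Continuous ζ)
    (hc : HasCompactSupport ζ) (g : hdotSpace d) :
    testFunctional hζ hc g = ∫ x, ζ x • hdotFun d g x := rfl

/-- Functions in `Ḣ¹` are approximated by their mollifications at a uniform rate. -/
theorem InHDot.eLpNorm_mollify_sub_le {u : RSpace d → ℂ}
    {g : RSpace d → EuclideanSpace ℂ (Fin d)} (h : InHDot u g) {ρ : RSpace d → ℝ} {δ : ℝ}
    (hρ : IsMollifier ρ δ) :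
    eLpNorm (mollify ρ u - u) 2 volume ≤ ENNReal.ofReal δ * eLpNorm g 2 volume := by
  obtain ⟨η, h1, h2, h3, h4⟩ := h.exists_seq
  have hp : 1 ≤ sobExp d := Fact.out
  have hb : ∀ n, eLpNorm (mollify ρ (η n) - η n) 2 volume ≤
      ENNReal.ofReal δ * eLpNorm (classicalGrad (η n)) 2 volume := fun n => by
    rw [eLpNorm_two_le_iff, mul_pow, eLpNorm_two_sq]
    refine hρ.eLpNorm_mollify_sub_le (h1 n).1.continuous.locallyIntegrable fun y hy => ?_
    refine (lintegral_sq_sub_translate_le (h1 n).1 y).trans ?_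
    gcongr
    rw [← ofReal_norm]
    exact ENNReal.ofReal_le_ofReal hy.le
  have hm : ∀ {f : RSpace d → ℂ}, LocallyIntegrable f →
      AEStronglyMeasurable (mollify ρ f) volume := fun hf =>
    (hρ.compact.contDiff_convolution_left (n := 0) _ (hρ.contDiff.of_le (by simp))
      hf).continuous.aestronglyMeasurable
  have hlim : ∀ᵐ x, Tendsto (fun n => (mollify ρ (η n) - η n) x) atTop
      (𝓝 ((mollify ρ u - u) x)) := by
    filter_upwards [h4] with x hx
    have hz : Continuous fun y => ρ (x - y) := hρ.contDiff.continuous.comp (by fun_prop)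
    have hzc : HasCompactSupport fun y => ρ (x - y) :=
      hρ.compact.comp_homeomorph (Homeomorph.subLeft x)
    have := tendsto_integral_smul_of_tendsto_eLpNorm hp (fun n => (h1 n).memLp _) h.memLp h2 hz hzc
    simp only [← mollify_apply_swap] at this
    exact this.sub hx
  -- Fatou: `mollify ρ u - u` is not known to lie in `L²` beforehand, so the bound for test
  -- functions is passed to the limit from a.e. convergence alone.
  have hF := Lp.eLpNorm_lim_le_liminf_eLpNorm (p := 2) (fun n =>
    (hm (h1 n).1.continuous.locallyIntegrable).sub ((h1 n).memLp 2).1) _ hlim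
  refine hF.trans ?_
  have t : Tendsto (fun n => eLpNorm (classicalGrad (η n)) 2 volume) atTop
      (𝓝 (eLpNorm g 2 volume)) := by
    have := ((Lp.tendsto_Lp_iff_tendsto_eLpNorm'' _ (fun n => (h1 n).memLp_grad 2) _
      h.memLp_grad).2 h3).enorm
    simpa only [Lp.enorm_toLp] using this
  have t2 := ENNReal.Tendsto.const_mul t (Or.inr (ENNReal.ofReal_ne_top (r := δ)))
  rw [← t2.liminf_eq]
  exact liminf_le_liminf (Eventually.of_forall hb)

/-- The Rellich theorem: weak convergence to zero in `Ḣ¹` implies convergence in `L²` on balls. -/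
theorem tendsto_lintegral_ball_of_weak {h : ℕ → hdotSpace d} {M : ℝ} (hM : ∀ n, ‖h n‖ ≤ M)
    (hw : ∀ ℓ : hdotSpace d →L[ℂ] ℂ, Tendsto (fun n => ℓ (h n)) atTop (𝓝 0)) (R : ℝ) :
    Tendsto (fun n => ∫⁻ x in Metric.closedBall 0 R, ‖hdotFun d (h n) x‖ₑ ^ 2) atTop (𝓝 0) := by
  have hM0 : 0 ≤ M := (norm_nonneg _).trans (hM 0)
  rw [ENNReal.tendsto_nhds_zero]
  intro ε hε
  -- The mollification error is at most `δM` in `L²` for every member of the sequence; `δ` is fixed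
  -- so that this error costs at most `ε / 2`.
  obtain ⟨δ, hδ, hδε⟩ : ∃ δ : ℝ, 0 < δ ∧
      2 * (ENNReal.ofReal δ * ENNReal.ofReal M) ^ 2 ≤ ε / 2 := by
    have t : Tendsto (fun δ : ℝ => 2 * (ENNReal.ofReal δ * ENNReal.ofReal M) ^ 2) (𝓝[>] 0)
        (𝓝 0) := by
      have a : Tendsto (fun δ : ℝ => ENNReal.ofReal (2 * (δ * M) ^ 2)) (𝓝[>] 0)
          (𝓝 (ENNReal.ofReal (2 * (0 * M) ^ 2))) :=
        ENNReal.tendsto_ofReal ((by fun_prop : Continuous fun δ : ℝ =>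
          2 * (δ * M) ^ 2).continuousWithinAt)
      simp only [zero_mul, ne_eq, OfNat.ofNat_ne_zero, not_false_eq_true, zero_pow, mul_zero,
        ENNReal.ofReal_zero] at a
      refine a.congr' ?_
      filter_upwards [self_mem_nhdsWithin] with δ hδ
      have hδ' : (0 : ℝ) ≤ δ := le_of_lt hδ
      rw [ENNReal.ofReal_mul (by norm_num), ENNReal.ofReal_pow (by positivity),
        ENNReal.ofReal_mul hδ', ENNReal.ofReal_ofNat]
    have e := t.eventually (ge_mem_nhds (ENNReal.half_pos hε.ne'))
    obtain ⟨δ, h1, h2⟩ := (e.and self_mem_nhdsWithin).exists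
    exact ⟨δ, h2, h1⟩
  obtain ⟨ρ, hρ⟩ := exists_isMollifier d hδ
  have hz : ∀ x : RSpace d, Continuous fun y => ρ (x - y) := fun x =>
    hρ.contDiff.continuous.comp (by fun_prop)
  have hzc : ∀ x : RSpace d, HasCompactSupport fun y => ρ (x - y) := fun x =>
    hρ.compact.comp_homeomorph (Homeomorph.subLeft x)
  have hloc : ∀ n, LocallyIntegrable (hdotFun d (h n)) := fun n =>
    (Lp.memLp _).locallyIntegrable Fact.out
  have hmeas : ∀ n, AEStronglyMeasurable (mollify ρ (hdotFun d (h n))) volume := fun n =>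
    (hρ.compact.contDiff_convolution_left (n := 0) _ (hρ.contDiff.of_le (by simp))
      (hloc n)).continuous.aestronglyMeasurable
  -- The value of a mollification at `x` is a bounded functional of the gradient, so weak
  -- convergence becomes pointwise convergence.
  have hpt : ∀ x, Tendsto (fun n => mollify ρ (hdotFun d (h n)) x) atTop (𝓝 0) := fun x => by
    refine (hw (testFunctional (hz x) (hzc x))).congr fun n => ?_
    rw [testFunctional_apply, mollify_apply_swap]
  let B : ℝ≥0∞ := eLpNorm ρ (sobExp d).conjExponent volume * (sobConst d * ENNReal.ofReal M)
  have hB : B ≠ ⊤ := ENNReal.mul_ne_top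
    (hρ.contDiff.continuous.memLp_of_hasCompactSupport hρ.compact).eLpNorm_ne_top
    (ENNReal.mul_ne_top ENNReal.coe_ne_top ENNReal.ofReal_ne_top)
  have hgn : ∀ n, eLpNorm (h n : GradSpace d) 2 volume ≤ ENNReal.ofReal M := fun n => by
    rw [← Lp.enorm_def, ← ofReal_norm]
    exact ENNReal.ofReal_le_ofReal (hM n)
  -- Translation invariance makes the bound independent of `x`; a constant is then a dominating
  -- function on the ball.
  have hbd : ∀ n x, ‖mollify ρ (hdotFun d (h n)) x‖ₑ ≤ B := fun n x => by
    rw [mollify_apply_swap]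
    refine (enorm_integral_smul_le (p := sobExp d) Fact.out (hz x).aestronglyMeasurable
      (Lp.memLp (hdotFun d (h n))).1).trans ?_
    have e : eLpNorm (fun y => ρ (x - y)) (sobExp d).conjExponent volume =
        eLpNorm ρ (sobExp d).conjExponent volume :=
      eLpNorm_comp_measurePreserving hρ.contDiff.continuous.aestronglyMeasurable
        (Measure.measurePreserving_sub_left volume x)
    rw [e]
    exact mul_le_mul' le_rfl
      ((inHDot_hdotFun (h n)).eLpNorm_le.trans (mul_le_mul' le_rfl (hgn n)))
  have hdct : Tendsto (fun n => ∫⁻ x in Metric.closedBall 0 R,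
      ‖mollify ρ (hdotFun d (h n)) x‖ₑ ^ 2) atTop (𝓝 0) := by
    have h0 : ∫⁻ x in Metric.closedBall (0 : RSpace d) R, (0 : ℝ≥0∞) = 0 := by simp
    rw [← h0]
    refine tendsto_lintegral_of_dominated_convergence' (fun _ => B ^ 2)
      (fun n => (hmeas n).restrict.enorm.pow_const 2)
      (fun n => Eventually.of_forall fun x => by simp only; gcongr; exact hbd n x) ?_
      (Eventually.of_forall fun x => ?_)
    · rw [setLIntegral_const]
      exact ENNReal.mul_ne_top (ENNReal.pow_ne_top hB) (isCompact_closedBall 0 R).measure_lt_top.ne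
    · simpa [Function.comp_def] using ((ENNReal.continuous_pow 2).tendsto _).comp (hpt x).enorm
  have hdct2 := ENNReal.Tendsto.const_mul hdct (Or.inr (ENNReal.ofNat_ne_top (n := 2)))
  rw [mul_zero] at hdct2
  filter_upwards [hdct2.eventually (ge_mem_nhds (ENNReal.half_pos hε.ne'))] with n hn
  calc ∫⁻ x in Metric.closedBall 0 R, ‖hdotFun d (h n) x‖ₑ ^ 2
      ≤ ∫⁻ x in Metric.closedBall 0 R, (2 * ‖mollify ρ (hdotFun d (h n)) x‖ₑ ^ 2 +
          2 * ‖(mollify ρ (hdotFun d (h n)) - hdotFun d (h n)) x‖ₑ ^ 2) := by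
        refine lintegral_mono fun x => ?_
        rw [← mul_add]
        have h1 : ‖hdotFun d (h n) x‖ₑ ≤ ‖mollify ρ (hdotFun d (h n)) x‖ₑ +
            ‖(mollify ρ (hdotFun d (h n)) - hdotFun d (h n)) x‖ₑ := by
          have := enorm_sub_le (a := mollify ρ (hdotFun d (h n)) x)
            (b := (mollify ρ (hdotFun d (h n)) - hdotFun d (h n)) x)
          simpa using this
        calc ‖hdotFun d (h n) x‖ₑ ^ 2 ≤ _ := pow_le_pow_left₀ zero_le h1 2
          _ ≤ _ := by
            have := ENNReal.rpow_add_le_mul_rpow_add_rpow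
              (‖mollify ρ (hdotFun d (h n)) x‖ₑ)
              (‖(mollify ρ (hdotFun d (h n)) - hdotFun d (h n)) x‖ₑ) (one_le_two (α := ℝ))
            simp only [ENNReal.rpow_ofNat] at this
            norm_num at this
            exact this
    _ = 2 * (∫⁻ x in Metric.closedBall 0 R, ‖mollify ρ (hdotFun d (h n)) x‖ₑ ^ 2) +
        2 * ∫⁻ x in Metric.closedBall 0 R,
          ‖(mollify ρ (hdotFun d (h n)) - hdotFun d (h n)) x‖ₑ ^ 2 := by
        rw [lintegral_add_left' (((hmeas n).restrict.enorm.pow_const 2).const_mul 2),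
          lintegral_const_mul'' _ ((hmeas n).restrict.enorm.pow_const 2),
          lintegral_const_mul'' _ (((hmeas n).sub (Lp.memLp _).1).restrict.enorm.pow_const 2)]
    _ ≤ ε / 2 + ε / 2 := by
        refine add_le_add hn (le_trans ?_ hδε)
        gcongr
        refine (setLIntegral_le_lintegral _ _).trans ?_
        rw [← eLpNorm_two_sq]
        gcongr
        exact ((inHDot_hdotFun (h n)).eLpNorm_mollify_sub_le hρ).trans (by gcongr; exact hgn n)
    _ = ε := ENNReal.add_halves ε

/-- Split `V = V₁ + (V - V₁)` with `V₁` continuous and compactly supported. The small part is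
uniformly small by Hölder and Sobolev, and the part with `V₁` tends to zero by Rellich on a ball
containing its support. -/
theorem tendsto_potForm_of_weak {V : RSpace d → ℝ} (hV : MemLp V ((d : ℝ≥0∞) / 2))
    {h : ℕ → hdotSpace d} {M : ℝ} (hM : ∀ n, ‖h n‖ ≤ M)
    (hw : ∀ ℓ : hdotSpace d →L[ℂ] ℂ, Tendsto (fun n => ℓ (h n)) atTop (𝓝 0)) :
    Tendsto (fun n => potForm hV (h n) (h n)) atTop (𝓝 0) := by
  have hM0 : 0 ≤ M := (norm_nonneg _).trans (hM 0)
  have hgn : ∀ n, eLpNorm (h n : GradSpace d) 2 volume ≤ ENNReal.ofReal M := fun n => by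
    rw [← Lp.enorm_def, ← ofReal_norm]
    exact ENNReal.ofReal_le_ofReal (hM n)
  have hen : Tendsto (fun n => ‖potForm hV (h n) (h n)‖ₑ) atTop (𝓝 0) := by
    rw [ENNReal.tendsto_nhds_zero]
    intro ε hε
    let D : ℝ≥0∞ := (sobConst d * ENNReal.ofReal M) * (sobConst d * ENNReal.ofReal M)
    have hD : D ≠ ⊤ := by finiteness
    -- `D` bounds the square of the critical Sobolev norm along the sequence, so `δ` is the
    -- `L^{d/2}` error allowed in approximating `V`.
    obtain ⟨δ, hδ, hδε⟩ : ∃ δ : ℝ≥0∞, δ ≠ 0 ∧ δ * D ≤ ε / 2 := by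
      have t : Tendsto (fun δ : ℝ≥0∞ => δ * D) (𝓝[>] 0) (𝓝 (0 * D)) :=
        ENNReal.Tendsto.mul_const (tendsto_id.mono_left nhdsWithin_le_nhds) (Or.inr hD)
      rw [zero_mul] at t
      obtain ⟨δ, h1, h2⟩ := ((t.eventually (ge_mem_nhds (ENNReal.half_pos hε.ne'))).and
        self_mem_nhdsWithin).exists
      exact ⟨δ, (ne_of_gt h2), h1⟩
    obtain ⟨V₁, hc, hle, hcont, hmem⟩ := hV.exists_hasCompactSupport_eLpNorm_sub_le potExp_ne_top hδ
    obtain ⟨A, hA⟩ := hcont.bounded_above_of_compact_support hc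
    obtain ⟨R, hR⟩ := hc.isCompact.isBounded.subset_closedBall (0 : RSpace d)
    have tB := ENNReal.Tendsto.const_mul (tendsto_lintegral_ball_of_weak hM hw R)
      (Or.inr (ENNReal.ofReal_ne_top (r := A)))
    rw [mul_zero] at tB
    filter_upwards [tB.eventually (ge_mem_nhds (ENNReal.half_pos hε.ne'))] with n hn
    have hLp := Lp.memLp (hdotFun d (h n))
    have hsob : eLpNorm (hdotFun d (h n)) (sobExp d) volume ≤ sobConst d * ENNReal.ofReal M :=
      (inHDot_hdotFun (h n)).eLpNorm_le.trans (by gcongr; exact hgn n)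
    rw [potForm_apply]
    refine (enorm_integral_le_lintegral_enorm _).trans ?_
    calc ∫⁻ x, ‖(V x : ℂ) * (conj (hdotFun d (h n) x) * hdotFun d (h n) x)‖ₑ
        ≤ ∫⁻ x, (‖V₁ x‖ₑ * ‖hdotFun d (h n) x‖ₑ ^ 2 +
          ‖(V - V₁) x‖ₑ * (‖hdotFun d (h n) x‖ₑ * ‖hdotFun d (h n) x‖ₑ)) := by
          refine lintegral_mono fun x => ?_
          have e : ‖(V x : ℂ) * (conj (hdotFun d (h n) x) * hdotFun d (h n) x)‖ₑ =
              ‖V x‖ₑ * (‖hdotFun d (h n) x‖ₑ * ‖hdotFun d (h n) x‖ₑ) := by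
            simp [enorm_eq_nnnorm]
          rw [e, ← sq, ← add_mul]
          gcongr
          have := enorm_add_le (V₁ x) ((V - V₁) x)
          simpa using this
      _ = (∫⁻ x, ‖V₁ x‖ₑ * ‖hdotFun d (h n) x‖ₑ ^ 2) +
          ∫⁻ x, ‖(V - V₁) x‖ₑ * (‖hdotFun d (h n) x‖ₑ * ‖hdotFun d (h n) x‖ₑ) :=
          lintegral_add_left' (hcont.enorm.measurable.aemeasurable.mul (hLp.1.enorm.pow_const 2)) _
      _ ≤ ε / 2 + ε / 2 := by
          refine add_le_add (le_trans ?_ hn) (le_trans (lintegral_potential_le (hV.sub hmem) hLp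
            hLp) (le_trans ?_ hδε))
          · have hs : ∀ x, ‖V₁ x‖ₑ * ‖hdotFun d (h n) x‖ₑ ^ 2 ≤
                (Metric.closedBall 0 R).indicator
                  (fun x => ENNReal.ofReal A * ‖hdotFun d (h n) x‖ₑ ^ 2) x := fun x => by
              by_cases hx : x ∈ Metric.closedBall 0 R
              · rw [Set.indicator_of_mem hx]
                gcongr
                rw [← ofReal_norm]
                exact ENNReal.ofReal_le_ofReal (hA x)
              · have : V₁ x = 0 := by
                  by_contra h0
                  exact hx (hR (subset_tsupport _ h0))
                simp [this]
            refine (lintegral_mono hs).trans ?_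
            rw [lintegral_indicator measurableSet_closedBall,
              lintegral_const_mul'' _ (hLp.1.restrict.enorm.pow_const 2)]
          · gcongr
            exact mul_le_mul' hsob hsob
      _ = ε := ENNReal.add_halves ε
  rw [tendsto_zero_iff_norm_tendsto_zero]
  have := (ENNReal.tendsto_toReal ENNReal.zero_ne_top).comp hen
  simpa [Function.comp_def] using this

end Compactness

/-! ### A zero of the form in `Ḣ¹` and its Euler–Lagrange equation. -/

section Minimizer

/-- Sequential Banach–Alaoglu in the dual, carried back by Riesz. The Riesz map is conjugate-linear,
which accounts for the conjugations. -/
theorem exists_weak_limit {H : Type*} [NormedAddCommGroup H] [InnerProductSpace ℂ H]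
    [CompleteSpace H] [TopologicalSpace.SeparableSpace H] {x : ℕ → H} {M : ℝ}
    (hM : ∀ n, ‖x n‖ ≤ M) : ∃ (x₀ : H) (ns : ℕ → ℕ), StrictMono ns ∧
      ∀ ℓ : H →L[ℂ] ℂ, Tendsto (fun n => ℓ (x (ns n))) atTop (𝓝 (ℓ x₀)) := by
  let y : ℕ → WeakDual ℂ H := fun n =>
    StrongDual.toWeakDual (InnerProductSpace.toDual ℂ H (x n))
  have hy : ∀ n, y n ∈ WeakDual.toStrongDual ⁻¹' Metric.closedBall (0 : StrongDual ℂ H) M :=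
    fun n => by
      rw [Set.mem_preimage, mem_closedBall_zero_iff]
      exact ((InnerProductSpace.toDual ℂ H).norm_map (x n)).trans_le (hM n)
  obtain ⟨y₀, -, ns, hns, hlim⟩ := WeakDual.isSeqCompact_closedBall ℂ H 0 M hy
  refine ⟨(InnerProductSpace.toDual ℂ H).symm (WeakDual.toStrongDual y₀), ns, hns, fun ℓ => ?_⟩
  have h1 := ((WeakDual.eval_continuous ((InnerProductSpace.toDual ℂ H).symm ℓ)).tendsto y₀).comp
    hlim
  have h2 := (Complex.continuous_conj.tendsto _).comp h1
  have e : ∀ z : H, ℓ z = inner ℂ ((InnerProductSpace.toDual ℂ H).symm ℓ) z := fun z =>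
    (InnerProductSpace.toDual_symm_apply (𝕜 := ℂ)).symm
  have e1 : conj (y₀ ((InnerProductSpace.toDual ℂ H).symm ℓ)) =
      ℓ ((InnerProductSpace.toDual ℂ H).symm (WeakDual.toStrongDual y₀)) := by
    rw [e, ← inner_conj_symm (𝕜 := ℂ), InnerProductSpace.toDual_symm_apply]
    rfl
  rw [e1] at h2
  refine h2.congr fun n => ?_
  rw [e, ← inner_conj_symm (𝕜 := ℂ)]
  rfl

theorem eq_zero_of_forall_quadratic_nonneg {a b : ℝ} (h : ∀ s : ℝ, 0 ≤ 2 * s * a + s ^ 2 * b) :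
    a = 0 := by
  by_contra ha
  have hb : 0 ≤ b := by
    have h1 := h 1
    have h2 := h (-1)
    nlinarith
  -- The minimizer would be `-a / b`; the shift by one avoids `b = 0` and still gives the negative
  -- value `-a²(b+2)/(b+1)²`.
  have h1 := h (-a / (b + 1))
  have hp : 0 < b + 1 := by linarith
  have e : 2 * (-a / (b + 1)) * a + (-a / (b + 1)) ^ 2 * b = -(a ^ 2 * (b + 2)) / (b + 1) ^ 2 := by
    field_simp
    ring
  rw [e] at h1
  have h2 : 0 < a ^ 2 * (b + 2) / (b + 1) ^ 2 := by positivity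
  have h3 : -(a ^ 2 * (b + 2)) / (b + 1) ^ 2 = -(a ^ 2 * (b + 2) / (b + 1) ^ 2) := neg_div _ _
  linarith

variable {d : ℕ} [Fact (3 ≤ d)]

/-- Needed for the separability assumption in `exists_weak_limit`. -/
instance gradSpace_secondCountable : SecondCountableTopology (GradSpace d) := by
  have : Fact ((2 : ℝ≥0∞) ≠ ⊤) := ⟨by norm_num⟩
  infer_instance

theorem potForm_add_self {V : RSpace d → ℝ} (hV : MemLp V ((d : ℝ≥0∞) / 2)) (g h : hdotSpace d) :
    (potForm hV (g + h) (g + h)).re =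
      (potForm hV g g).re + 2 * (potForm hV h g).re + (potForm hV h h).re := by
  have : (potForm hV g h).re = (potForm hV h g).re := by
    rw [← potForm_conj hV h g, Complex.conj_re]
  simp only [map_add, add_apply, Complex.add_re]
  linarith

theorem norm_add_sq_hdot (g h : hdotSpace d) :
    ‖g + h‖ ^ 2 = ‖g‖ ^ 2 + 2 * (inner ℂ h g).re + ‖h‖ ^ 2 := by
  rw [add_comm g h, norm_add_sq (𝕜 := ℂ) h g, RCLike.re_to_complex]
  ring

/-- The Euler–Lagrange equation for a zero of a nonnegative form. -/
theorem euler_lagrange {V : RSpace d → ℝ} (hV : MemLp V ((d : ℝ≥0∞) / 2))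
    (hnn : ∀ g : hdotSpace d, 0 ≤ ‖g‖ ^ 2 + (potForm hV g g).re) {g : hdotSpace d}
    (hg : ‖g‖ ^ 2 + (potForm hV g g).re = 0) (k : hdotSpace d) :
    inner ℂ k g + potForm hV k g = 0 := by
  have key : ∀ k : hdotSpace d, (inner ℂ k g + potForm hV k g).re = 0 := fun k => by
    refine eq_zero_of_forall_quadratic_nonneg (b := ‖k‖ ^ 2 + (potForm hV k k).re) fun s => ?_
    have h := hnn (g + (s : ℂ) • k)
    rw [norm_add_sq_hdot, potForm_add_self, norm_smul, inner_smul_left (𝕜 := ℂ) k g] at h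
    simp only [map_smulₛₗ, RingHom.id_apply, smul_apply, Complex.conj_ofReal,
      smul_eq_mul, Complex.re_ofReal_mul, Complex.norm_real, mul_pow, Real.norm_eq_abs,
      sq_abs] at h
    rw [Complex.add_re]
    linarith
  -- The imaginary part follows from the real part with `k` replaced by `i k`.
  refine Complex.ext (key k) ?_
  have h := key (Complex.I • k)
  rw [inner_smul_left (𝕜 := ℂ) k g] at h
  simp only [map_smulₛₗ, smul_apply, Complex.conj_I, smul_eq_mul] at h
  rw [← mul_add] at h
  simpa using h

/-- Negative spectrum of `h_ε` excludes coercivity, so some normalized `g` nearly saturates the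
inequality `∫ V|u|² ≥ -‖∇u‖²`. -/
theorem exists_minimizing_seq {V : RSpace d → ℝ} (hV : MemLp V ((d : ℝ≥0∞) / 2))
    (hvl : HasVirtualLevelAtZero V) (n : ℕ) :
    ∃ g : hdotSpace d, ‖g‖ = 1 ∧ (potForm hV g g).re ≤ -(1 - 2 / ((n : ℝ) + 1)) := by
  have hpos : (0 : ℝ) < 1 / ((n : ℝ) + 1) := by positivity
  obtain ⟨ε, ⟨-, h1⟩, h2⟩ := (hvl.2.and (Ioo_mem_nhdsGT hpos)).exists
  -- Taken with `κ = ε`, so that the loss of `ε` in the kinetic energy and that in coercivity add up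
  -- to `2ε`, with `ε < 1/(n+1)`.
  obtain ⟨g, hg⟩ := exists_form_lt_of_extInf_neg hV h2.1 h1
  have h0 : g ≠ 0 := by
    rintro rfl
    simp at hg
  have hn : 0 < ‖g‖ := norm_pos_iff.2 h0
  refine ⟨((‖g‖⁻¹ : ℝ) : ℂ) • g, ?_, ?_⟩
  · rw [norm_smul, Complex.norm_real, norm_inv, norm_norm, inv_mul_cancel₀ hn.ne']
  · simp only [map_smulₛₗ, RingHom.id_apply, smul_apply, Complex.conj_ofReal,
      smul_eq_mul, Complex.re_ofReal_mul]
    have h3 : (potForm hV g g).re ≤ -(1 - 2 * ε) * ‖g‖ ^ 2 := by linarith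
    have h4 : ‖g‖⁻¹ * (‖g‖⁻¹ * (potForm hV g g).re) ≤ -(1 - 2 * ε) := by
      calc ‖g‖⁻¹ * (‖g‖⁻¹ * (potForm hV g g).re)
          ≤ ‖g‖⁻¹ * (‖g‖⁻¹ * (-(1 - 2 * ε) * ‖g‖ ^ 2)) := by gcongr
        _ = -(1 - 2 * ε) := by field_simp
    have h5 : 2 / ((n : ℝ) + 1) = 2 * (1 / ((n : ℝ) + 1)) := by ring
    have h6 := h2.2
    rw [h5]
    linarith

/-- A virtual level gives a nontrivial zero of the form in `Ḣ¹`. -/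
theorem exists_zero_of_virtualLevel {V : RSpace d → ℝ} (hV : MemLp V ((d : ℝ≥0∞) / 2))
    (hvl : HasVirtualLevelAtZero V) :
    ∃ g : hdotSpace d, g ≠ 0 ∧ ‖g‖ ^ 2 + (potForm hV g g).re = 0 := by
  choose x hx1 hx2 using exists_minimizing_seq hV hvl
  obtain ⟨g, ns, hns, hw⟩ := exists_weak_limit (x := x) (M := 1) fun n => (hx1 n).le
  have hh : ∀ ℓ : hdotSpace d →L[ℂ] ℂ, Tendsto (fun n => ℓ (x (ns n) - g)) atTop (𝓝 0) :=
    fun ℓ => by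
      simpa using (hw ℓ).sub_const (ℓ g)
  have hb : ∀ n, ‖x (ns n) - g‖ ≤ 1 + ‖g‖ := fun n =>
    (norm_sub_le _ _).trans (by rw [hx1])
  have t1 := tendsto_potForm_of_weak hV hb hh
  -- The form is conjugate-linear in this slot; conjugate symmetry exhibits it as the conjugate of a
  -- bounded linear functional.
  have t2 : Tendsto (fun n => potForm hV (x (ns n) - g) g) atTop (𝓝 0) := by
    have := (Complex.continuous_conj.tendsto _).comp (hh (potForm hV g))
    simpa [Function.comp_def, potForm_conj] using this
  have t3 : Tendsto (fun n => (potForm hV (x (ns n)) (x (ns n))).re) atTop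
      (𝓝 (potForm hV g g).re) := by
    have a := ((Complex.continuous_re.tendsto _).comp t2).const_mul 2
    have b := (Complex.continuous_re.tendsto _).comp t1
    have c := (a.const_add (potForm hV g g).re).add b
    simp only [Complex.zero_re, mul_zero, add_zero, Function.comp_apply] at c
    refine c.congr fun n => ?_
    rw [← potForm_add_self hV g, add_sub_cancel]
  have hle : (potForm hV g g).re ≤ -1 := by
    have t4 : Tendsto (fun n : ℕ => -(1 - 2 / ((ns n : ℝ) + 1))) atTop (𝓝 (-(1 - 0))) :=
      (((tendsto_const_nhds.div_atTop (tendsto_natCast_atTop_atTop.atTop_add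
        tendsto_const_nhds)).comp hns.tendsto_atTop).const_sub 1).neg
    rw [sub_zero] at t4
    exact le_of_tendsto_of_tendsto' t3 t4 fun n => hx2 (ns n)
  -- Weak lower semicontinuity of the norm, obtained by pairing the sequence with `g` itself.
  have hg1 : ‖g‖ ≤ 1 := by
    have t5 := (hw (innerSL ℂ g)).norm
    simp only [innerSL_apply_apply] at t5
    have h1 : ‖inner ℂ g g‖ ≤ ‖g‖ := le_of_tendsto' t5 fun n => by
      simpa [hx1] using norm_inner_le_norm (𝕜 := ℂ) g (x (ns n))
    have h2 : ‖inner ℂ g g‖ = ‖g‖ ^ 2 := by simp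
    rw [h2] at h1
    by_contra! h3
    nlinarith
  have h0 := hvl.1.nonneg hV g
  refine ⟨g, ?_, ?_⟩
  -- Mass cannot be lost: the potential term of the limit is at most `-1`, which excludes zero.
  · rintro rfl
    simp at hle
    linarith
  · nlinarith [norm_nonneg g]

end Minimizer

/-! ### The Hardy inequality with its sharp constant. -/

section Hardy

variable {d : ℕ}

theorem sum_coord_smul_coordVec (x : RSpace d) : ∑ i, x i • coordVec i = x := by
  ext j
  simp [Finset.sum_apply, Pi.single_apply]

theorem hasFDerivAt_normSq_add (δ : ℝ) (x : RSpace d) :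
    HasFDerivAt (fun y : RSpace d => ‖y‖ ^ 2 + δ) (2 • innerSL ℝ x) x :=
  (hasStrictFDerivAt_norm_sq x).hasFDerivAt.add_const δ

theorem contDiff_normSq_add (δ : ℝ) : ContDiff ℝ ∞ fun y : RSpace d => ‖y‖ ^ 2 + δ :=
  (contDiff_norm_sq ℝ).add contDiff_const

theorem inner_coordVec (x : RSpace d) (i : Fin d) : inner ℝ x (coordVec i) = x i :=
  (EuclideanSpace.inner_single_right i 1 x).trans (by simp)

/-- The integrated divergence identity for the field `x / (|x|² + δ)`. -/
theorem integral_div_field {s : RSpace d → ℝ} (hs : ContDiff ℝ ∞ s) (hc : HasCompactSupport s)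
    {δ : ℝ} (hδ : 0 < δ) :
    ∫ x, (d * (‖x‖ ^ 2 + δ)⁻¹ - 2 * ‖x‖ ^ 2 * ((‖x‖ ^ 2 + δ) ^ 2)⁻¹) * s x =
      -∫ x, (‖x‖ ^ 2 + δ)⁻¹ * fderiv ℝ s x x := by
  have hpos : ∀ x : RSpace d, ‖x‖ ^ 2 + δ ≠ 0 := fun x => by positivity
  have hN : ContDiff ℝ ∞ fun x : RSpace d => (‖x‖ ^ 2 + δ)⁻¹ := (contDiff_normSq_add δ).inv hpos
  have hx : ∀ i, ContDiff ℝ ∞ fun x : RSpace d => x i := fun i =>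
    (EuclideanSpace.proj (𝕜 := ℝ) i).contDiff
  have hF : ∀ i, ContDiff ℝ ∞ fun x : RSpace d => x i * (‖x‖ ^ 2 + δ)⁻¹ := fun i => (hx i).mul hN
  have hdF : ∀ i (x : RSpace d), fderiv ℝ (fun x : RSpace d => x i * (‖x‖ ^ 2 + δ)⁻¹) x
      (coordVec i) = (‖x‖ ^ 2 + δ)⁻¹ - 2 * x i ^ 2 * ((‖x‖ ^ 2 + δ) ^ 2)⁻¹ := fun i x => by
    have h1 : HasFDerivAt (fun x : RSpace d => x i) (EuclideanSpace.proj (𝕜 := ℝ) i) x :=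
      (EuclideanSpace.proj (𝕜 := ℝ) i : RSpace d →L[ℝ] ℝ).hasFDerivAt
    have h2 := (hasDerivAt_inv (hpos x)).comp_hasFDerivAt x (hasFDerivAt_normSq_add δ x)
    have h3 := h1.mul h2
    change fderiv ℝ ((fun x : RSpace d => x i) * (Inv.inv ∘ fun x : RSpace d => ‖x‖ ^ 2 + δ)) x
      (coordVec i) = _
    rw [h3.fderiv]
    simp [inner_coordVec]
    ring
  have cs : Continuous s := hs.continuous
  have cds : ∀ i, Continuous fun x => fderiv ℝ s x (coordVec i) := fun i =>
    (hs.continuous_fderiv (by simp)).clm_apply continuous_const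
  have cdF : ∀ i, Continuous fun x => fderiv ℝ (fun x : RSpace d => x i * (‖x‖ ^ 2 + δ)⁻¹) x
      (coordVec i) := fun i => ((hF i).continuous_fderiv (by simp)).clm_apply continuous_const
  have i1 : ∀ i, Integrable fun x => fderiv ℝ (fun x : RSpace d => x i * (‖x‖ ^ 2 + δ)⁻¹) x
      (coordVec i) * s x := fun i =>
    ((cdF i).mul cs).integrable_of_hasCompactSupport hc.mul_left
  have i2 : ∀ i, Integrable fun x : RSpace d =>
      (x i * (‖x‖ ^ 2 + δ)⁻¹) * fderiv ℝ s x (coordVec i) := fun i =>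
    ((hF i).continuous.mul (cds i)).integrable_of_hasCompactSupport
      (hc.fderiv_apply (𝕜 := ℝ) (coordVec i)).mul_left
  have hi : ∀ i, ∫ x, fderiv ℝ (fun x : RSpace d => x i * (‖x‖ ^ 2 + δ)⁻¹) x (coordVec i) * s x =
      -∫ x : RSpace d, (x i * (‖x‖ ^ 2 + δ)⁻¹) * fderiv ℝ s x (coordVec i) := fun i => by
    have := integral_mul_fderiv_eq_neg_fderiv_mul_of_integrable (μ := volume)
      (f := fun x : RSpace d => x i * (‖x‖ ^ 2 + δ)⁻¹) (g := s) (v := coordVec i) (i1 i) (i2 i)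
      (((hF i).continuous.mul cs).integrable_of_hasCompactSupport hc.mul_left)
      (fun x _ => ((hF i).differentiable (by simp)) x) (fun x _ => (hs.differentiable (by simp)) x)
    rw [this, neg_neg]
  have hsum := Finset.sum_congr (rfl : (Finset.univ : Finset (Fin d)) = Finset.univ)
    fun i _ => hi i
  rw [← integral_finsetSum _ fun i _ => i1 i, Finset.sum_neg_distrib,
    ← integral_finsetSum _ fun i _ => i2 i] at hsum
  have e1 : ∀ x : RSpace d, ∑ i, fderiv ℝ (fun x : RSpace d => x i * (‖x‖ ^ 2 + δ)⁻¹) x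
      (coordVec i) * s x =
      (d * (‖x‖ ^ 2 + δ)⁻¹ - 2 * ‖x‖ ^ 2 * ((‖x‖ ^ 2 + δ) ^ 2)⁻¹) * s x := fun x => by
    simp only [hdF]
    rw [← Finset.sum_mul, Finset.sum_sub_distrib, Finset.sum_const, Finset.card_univ,
      Fintype.card_fin, nsmul_eq_mul, ← Finset.sum_mul, ← Finset.mul_sum,
      EuclideanSpace.real_norm_sq_eq]
  have e2 : ∀ x : RSpace d, ∑ i, (x i * (‖x‖ ^ 2 + δ)⁻¹) * fderiv ℝ s x (coordVec i) =
      (‖x‖ ^ 2 + δ)⁻¹ * fderiv ℝ s x x := fun x => by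
    conv_rhs => rw [← sum_coord_smul_coordVec x]
    rw [map_sum, Finset.mul_sum]
    simp only [sum_coord_smul_coordVec, map_smul, smul_eq_mul]
    exact Finset.sum_congr rfl fun i _ => by ring
  simpa only [e1, e2] using hsum

/-- Cauchy–Schwarz bounds the radial derivative, then `2XY ≤ ((d-2)/2)X² + (2/(d-2))Y²`. These
weights use up half of the divergence `d-2` and lead to the constant `2/(d-2)`. -/
theorem IsTestFun.hardy_pointwise {η : RSpace d → ℂ} (hη : IsTestFun η) (hd : (3 : ℝ) ≤ d)
    {δ : ℝ} (hδ : 0 < δ) (x : RSpace d) :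
    -((‖x‖ ^ 2 + δ)⁻¹ * fderiv ℝ (fun x => ‖η x‖ ^ 2) x x) ≤
      (d - 2) / 2 * ((‖x‖ ^ 2 + δ)⁻¹ * ‖η x‖ ^ 2) +
        2 / (d - 2) * ‖classicalGrad η x‖ ^ 2 := by
  have hd2 : (0 : ℝ) < d - 2 := by linarith
  have hpos : 0 < ‖x‖ ^ 2 + δ := by positivity
  have h1 : fderiv ℝ (fun x => ‖η x‖ ^ 2) x x = 2 * inner ℝ (η x) (fderiv ℝ η x x) := by
    rw [((hη.differentiable x).hasFDerivAt.norm_sq).fderiv]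
    simp
    ring
  have h2 : |inner ℝ (η x) (fderiv ℝ η x x)| ≤ ‖η x‖ * (‖classicalGrad η x‖ * ‖x‖) :=
    (abs_real_inner_le_norm _ _).trans (mul_le_mul_of_nonneg_left (norm_fderiv_apply_le η x x)
      (norm_nonneg _))
  rw [h1]
  have hNp : 0 ≤ (‖x‖ ^ 2 + δ)⁻¹ := (inv_pos.2 hpos).le
  have h6 : (‖x‖ ^ 2 + δ)⁻¹ * ‖x‖ ^ 2 ≤ 1 := by
    rw [inv_mul_le_iff₀ hpos]
    linarith
  generalize inner ℝ (η x) (fderiv ℝ η x x) = I at *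
  generalize ‖classicalGrad η x‖ = Y at *
  generalize ‖η x‖ = t at *
  generalize (‖x‖ ^ 2 + δ)⁻¹ = N at *
  have h4 : -(N * (2 * I)) ≤ 2 * (N * t * ‖x‖) * Y := by
    have h7 := mul_le_mul_of_nonneg_left ((neg_le_abs I).trans h2) hNp
    linarith
  have h5 : (N * t * ‖x‖) ^ 2 ≤ N * t ^ 2 := by
    have h7 := mul_le_mul_of_nonneg_left h6 (mul_nonneg hNp (sq_nonneg t))
    linarith
  refine h4.trans ?_
  generalize N * t * ‖x‖ = X at *
  have h9 : (d - 2) / 2 * X ^ 2 + 2 / (d - 2) * Y ^ 2 - 2 * X * Y =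
      (d - 2) / 2 * (X - 2 / (d - 2) * Y) ^ 2 := by
    field_simp
    ring
  have h10 : 0 ≤ ((d : ℝ) - 2) / 2 * (X - 2 / (d - 2) * Y) ^ 2 := by positivity
  have h11 := mul_le_mul_of_nonneg_left h5 (by linarith : 0 ≤ ((d : ℝ) - 2) / 2)
  linarith

theorem integrable_hardy_weight {s : RSpace d → ℝ} (hs : Continuous s) (hc : HasCompactSupport s)
    {δ : ℝ} (hδ : 0 < δ) : Integrable fun x : RSpace d => (‖x‖ ^ 2 + δ)⁻¹ * s x := by
  have hN : Continuous fun x : RSpace d => (‖x‖ ^ 2 + δ)⁻¹ :=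
    (contDiff_normSq_add δ).continuous.inv₀ fun x => by positivity
  exact (hN.mul hs).integrable_of_hasCompactSupport hc.mul_left

/-- The divergence of `x/(|x|²+δ)` is at least `(d-2)/(|x|²+δ)`, because `|x|² ≤ |x|² + δ`. -/
theorem hardy_divergence_lower {s : RSpace d → ℝ} (hs : Continuous s) (hc : HasCompactSupport s)
    (hs0 : ∀ x, 0 ≤ s x) {δ : ℝ} (hδ : 0 < δ) :
    ((d : ℝ) - 2) * ∫ x, (‖x‖ ^ 2 + δ)⁻¹ * s x ≤
      ∫ x, (d * (‖x‖ ^ 2 + δ)⁻¹ - 2 * ‖x‖ ^ 2 * ((‖x‖ ^ 2 + δ) ^ 2)⁻¹) * s x := by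
  have hpos : ∀ x : RSpace d, 0 < ‖x‖ ^ 2 + δ := fun x => by positivity
  have hN : Continuous fun x : RSpace d => (‖x‖ ^ 2 + δ)⁻¹ :=
    (contDiff_normSq_add δ).continuous.inv₀ fun x => (hpos x).ne'
  have hN2 : Continuous fun x : RSpace d => ((‖x‖ ^ 2 + δ) ^ 2)⁻¹ :=
    ((contDiff_normSq_add δ).continuous.pow 2).inv₀ fun x => (pow_pos (hpos x) 2).ne'
  have hc2 : Continuous fun x : RSpace d =>
      (d * (‖x‖ ^ 2 + δ)⁻¹ - 2 * ‖x‖ ^ 2 * ((‖x‖ ^ 2 + δ) ^ 2)⁻¹) * s x :=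
    ((continuous_const.mul hN).sub
      ((continuous_const.mul (continuous_norm.pow 2)).mul hN2)).mul hs
  rw [← integral_const_mul]
  refine integral_mono ((integrable_hardy_weight hs hc hδ).const_mul _)
    (hc2.integrable_of_hasCompactSupport hc.mul_left) fun x => ?_
  simp only
  rw [← mul_assoc]
  refine mul_le_mul_of_nonneg_right ?_ (hs0 x)
  have h1 : ‖x‖ ^ 2 * ((‖x‖ ^ 2 + δ) ^ 2)⁻¹ ≤ (‖x‖ ^ 2 + δ)⁻¹ := by
    rw [← div_eq_mul_inv, ← one_div, div_le_div_iff₀ (pow_pos (hpos x) 2) (hpos x)]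
    nlinarith [hpos x]
  linarith

theorem continuous_fderiv_self {s : RSpace d → ℝ} (hs : ContDiff ℝ ∞ s) :
    Continuous fun x => fderiv ℝ s x x :=
  (hs.continuous_fderiv (by simp)).clm_apply continuous_id

theorem hasCompactSupport_fderiv_self {s : RSpace d → ℝ} (hs : HasCompactSupport s) :
    HasCompactSupport fun x => fderiv ℝ s x x := by
  refine (hs.fderiv (𝕜 := ℝ)).mono fun x hx => ?_
  rw [Function.mem_support] at hx ⊢
  intro h0
  simp [h0] at hx

theorem IsTestFun.hardy_divergence_upper {η : RSpace d → ℂ} (hη : IsTestFun η) (hd : (3 : ℝ) ≤ d)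
    {δ : ℝ} (hδ : 0 < δ) :
    -∫ x, (‖x‖ ^ 2 + δ)⁻¹ * fderiv ℝ (fun x => ‖η x‖ ^ 2) x x ≤
      ((d : ℝ) - 2) / 2 * (∫ x, (‖x‖ ^ 2 + δ)⁻¹ * ‖η x‖ ^ 2) +
        2 / (d - 2) * ∫ x, ‖classicalGrad η x‖ ^ 2 := by
  have hs : ContDiff ℝ ∞ fun x => ‖η x‖ ^ 2 := hη.1.norm_sq ℝ
  have hsc : HasCompactSupport fun x => ‖η x‖ ^ 2 :=
    hη.2.comp_left (g := fun z : ℂ => ‖z‖ ^ 2) (by simp)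
  have ia := integrable_hardy_weight hs.continuous hsc hδ
  have ib : Integrable fun x => ‖classicalGrad η x‖ ^ 2 :=
    (hη.memLp_grad 2).integrable_norm_pow two_ne_zero
  have ic := integrable_hardy_weight (continuous_fderiv_self hs)
    (hasCompactSupport_fderiv_self hsc) hδ
  have id : Integrable fun x : RSpace d => ((d : ℝ) - 2) / 2 * ((‖x‖ ^ 2 + δ)⁻¹ * ‖η x‖ ^ 2) +
      2 / ((d : ℝ) - 2) * ‖classicalGrad η x‖ ^ 2 := (ia.const_mul _).add (ib.const_mul _)
  have hmono := integral_mono ic.neg id fun x => hη.hardy_pointwise hd hδ x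
  rw [integral_add (ia.const_mul _) (ib.const_mul _), integral_const_mul, integral_const_mul]
    at hmono
  rw [← integral_neg]
  exact hmono

/-- The Hardy inequality with a regularized weight, on test functions. -/
theorem IsTestFun.hardy {η : RSpace d → ℂ} (hη : IsTestFun η) (hd : 3 ≤ d) {δ : ℝ} (hδ : 0 < δ) :
    ∫ x, (‖x‖ ^ 2 + δ)⁻¹ * ‖η x‖ ^ 2 ≤
      (2 / ((d : ℝ) - 2)) ^ 2 * ∫ x, ‖classicalGrad η x‖ ^ 2 := by
  have h3 : (3 : ℝ) ≤ d := by exact_mod_cast hd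
  have hd2 : (0 : ℝ) < d - 2 := by linarith
  have hs : ContDiff ℝ ∞ fun x => ‖η x‖ ^ 2 := hη.1.norm_sq ℝ
  have hsc : HasCompactSupport fun x => ‖η x‖ ^ 2 :=
    hη.2.comp_left (g := fun z : ℂ => ‖z‖ ^ 2) (by simp)
  have lower := hardy_divergence_lower hs.continuous hsc (fun x => by positivity) hδ
  rw [integral_div_field hs hsc hδ] at lower
  have h4 := lower.trans (hη.hardy_divergence_upper h3 hδ)
  generalize ∫ x, (‖x‖ ^ 2 + δ)⁻¹ * ‖η x‖ ^ 2 = a at *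
  generalize ∫ x, ‖classicalGrad η x‖ ^ 2 = b at *
  -- Half of the left side has been absorbed; this uses that `a` is finite, which the regularization
  -- by `δ` guarantees.
  have h5 : ((d : ℝ) - 2) / 2 * a ≤ 2 / (d - 2) * b := by linarith
  have h6 : a = 2 / (d - 2) * (((d : ℝ) - 2) / 2 * a) := by field_simp
  rw [h6, sq, mul_assoc]
  exact mul_le_mul_of_nonneg_left h5 (by positivity)

theorem toReal_eLpNorm_two_sq {α F : Type*} [MeasurableSpace α] [NormedAddCommGroup F]
    {μ : Measure α} {f : α → F} (hf : MemLp f 2 μ) :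
    (eLpNorm f 2 μ).toReal ^ 2 = ∫ x, ‖f x‖ ^ 2 ∂μ := by
  rw [← ENNReal.toReal_pow, eLpNorm_two_sq, integral_eq_lintegral_of_nonneg_ae
    (Eventually.of_forall fun x => by positivity) (hf.1.norm.aemeasurable.pow_const 2).aestronglyMeasurable]
  congr 1
  refine lintegral_congr fun x => ?_
  rw [← ofReal_norm, ENNReal.ofReal_pow (norm_nonneg _)]

theorem tendsto_eLpNorm_of_sub {F : Type*} [NormedAddCommGroup F] {f : ℕ → RSpace d → F}
    {f₀ : RSpace d → F} (hf : ∀ n, MemLp (f n) 2) (hf₀ : MemLp f₀ 2)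
    (h : Tendsto (fun n => eLpNorm (f n - f₀) 2 volume) atTop (𝓝 0)) :
    Tendsto (fun n => eLpNorm (f n) 2 volume) atTop (𝓝 (eLpNorm f₀ 2 volume)) := by
  have := ((Lp.tendsto_Lp_iff_tendsto_eLpNorm'' _ hf _ hf₀).2 h).enorm
  simpa only [Lp.enorm_toLp] using this

variable [Fact (3 ≤ d)]

theorem eLpNorm_hardy_testFun {η : RSpace d → ℂ} (hη : IsTestFun η) {δ : ℝ} (hδ : 0 < δ) :
    eLpNorm (fun x => (√(‖x‖ ^ 2 + δ))⁻¹ • η x) 2 volume ≤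
      ENNReal.ofReal (2 / ((d : ℝ) - 2)) * eLpNorm (classicalGrad η) 2 volume := by
  have h3 := three_le_cast (d := d)
  have hd2 : (0 : ℝ) < d - 2 := by linarith
  have hN : Continuous fun x : RSpace d => (√(‖x‖ ^ 2 + δ))⁻¹ :=
    (Real.continuous_sqrt.comp (contDiff_normSq_add δ).continuous).inv₀ fun x => by
      have : 0 < ‖x‖ ^ 2 + δ := by positivity
      exact (Real.sqrt_pos.2 this).ne'
  have hm : MemLp (fun x => (√(‖x‖ ^ 2 + δ))⁻¹ • η x) 2 :=
    (hN.smul hη.1.continuous).memLp_of_hasCompactSupport hη.2.smul_left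
  have hgm := hη.memLp_grad 2
  rw [← ENNReal.toReal_le_toReal hm.eLpNorm_ne_top
    (ENNReal.mul_ne_top ENNReal.ofReal_ne_top hgm.eLpNorm_ne_top), ENNReal.toReal_mul,
    ENNReal.toReal_ofReal (by positivity)]
  refine le_of_sq_le_sq ?_ (by positivity)
  rw [mul_pow, toReal_eLpNorm_two_sq hm, toReal_eLpNorm_two_sq hgm]
  refine le_of_eq_of_le (integral_congr_ae (Eventually.of_forall fun x => ?_))
    (hη.hardy Fact.out hδ)
  have : 0 ≤ ‖x‖ ^ 2 + δ := by positivity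
  simp only [norm_smul, mul_pow, norm_inv, inv_pow, Real.norm_eq_abs, sq_abs, Real.sq_sqrt this]

/-- The Hardy inequality with a regularized weight. -/
theorem InHDot.hardy {u : RSpace d → ℂ} {g : RSpace d → EuclideanSpace ℂ (Fin d)}
    (h : InHDot u g) {δ : ℝ} (hδ : 0 < δ) :
    eLpNorm (fun x => (√(‖x‖ ^ 2 + δ))⁻¹ • u x) 2 volume ≤
      ENNReal.ofReal (2 / ((d : ℝ) - 2)) * eLpNorm g 2 volume := by
  obtain ⟨η, h1, -, h3, h4⟩ := h.exists_seq
  have hN : Measurable fun x : RSpace d => (√(‖x‖ ^ 2 + δ))⁻¹ := by fun_prop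
  have hF := Lp.eLpNorm_lim_le_liminf_eLpNorm (p := 2) (μ := volume)
    (f := fun n (x : RSpace d) => (√(‖x‖ ^ 2 + δ))⁻¹ • η n x)
    (fun n => hN.aestronglyMeasurable.smul ((h1 n).memLp 2).1)
    (fun x => (√(‖x‖ ^ 2 + δ))⁻¹ • u x) (by
      filter_upwards [h4] with x hx
      exact hx.const_smul _)
  refine hF.trans ?_
  have t := tendsto_eLpNorm_of_sub (fun n => (h1 n).memLp_grad 2) h.memLp_grad h3
  have t2 := ENNReal.Tendsto.const_mul t
    (Or.inr (ENNReal.ofReal_ne_top (r := 2 / ((d : ℝ) - 2))))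
  rw [← t2.liminf_eq]
  exact liminf_le_liminf (Eventually.of_forall fun n => eLpNorm_hardy_testFun (h1 n) hδ)

theorem InHDot.memLp_hardy {u : RSpace d → ℂ} {g : RSpace d → EuclideanSpace ℂ (Fin d)}
    (h : InHDot u g) {δ : ℝ} (hδ : 0 < δ) :
    MemLp (fun x => (√(‖x‖ ^ 2 + δ))⁻¹ • u x) 2 := by
  have hN : Measurable fun x : RSpace d => (√(‖x‖ ^ 2 + δ))⁻¹ := by fun_prop
  exact ⟨hN.aestronglyMeasurable.smul h.memLp.1, (h.hardy hδ).trans_lt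
    (ENNReal.mul_lt_top ENNReal.ofReal_lt_top h.memLp_grad.2)⟩

/-- The Hardy inequality: `|x|⁻¹ u` is square integrable. -/
theorem InHDot.memLp_inv_norm {u : RSpace d → ℂ} {g : RSpace d → EuclideanSpace ℂ (Fin d)}
    (h : InHDot u g) : MemLp (fun x => ‖x‖⁻¹ • u x) 2 := by
  have hd0 : Nonempty (Fin d) := ⟨⟨0, by have := (Fact.out : 3 ≤ d); omega⟩⟩
  have hδ : ∀ n : ℕ, (0 : ℝ) < 1 / ((n : ℝ) + 1) := fun n => by positivity
  have hF := Lp.eLpNorm_lim_le_liminf_eLpNorm (p := 2) (μ := volume)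
    (f := fun (n : ℕ) (x : RSpace d) => (√(‖x‖ ^ 2 + 1 / ((n : ℝ) + 1)))⁻¹ • u x)
    (fun n => (h.memLp_hardy (hδ n)).1)
    (fun x => ‖x‖⁻¹ • u x) (by
      -- At the origin the regularized weights blow up whereas `‖0‖⁻¹ = 0`; a single point is null
      -- since `d > 0`.
      filter_upwards [compl_mem_ae_iff.2 (measure_singleton (μ := volume) (0 : RSpace d))] with x hx
      have hx0 : ‖x‖ ≠ 0 := by simpa using hx
      have t := (tendsto_one_div_add_atTop_nhds_zero_nat (𝕜 := ℝ)).const_add (‖x‖ ^ 2)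
      rw [add_zero] at t
      have t2 := (Real.continuous_sqrt.tendsto _).comp t
      rw [Real.sqrt_sq (norm_nonneg x)] at t2
      exact (t2.inv₀ hx0).smul_const _)
  have hm : Measurable fun x : RSpace d => ‖x‖⁻¹ := by fun_prop
  refine ⟨hm.aestronglyMeasurable.smul h.memLp.1, hF.trans_lt ?_⟩
  refine lt_of_le_of_lt (liminf_le_liminf (Eventually.of_forall fun n => h.hardy (hδ n))) ?_
  simp only [liminf_const]
  exact ENNReal.mul_lt_top ENNReal.ofReal_lt_top h.memLp_grad.2

end Hardy

/-! ### Smooth bounded multipliers acting on `Ḣ¹`. -/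

section Multiplier

variable {d : ℕ}

/-- The product rule for the gradient of `m u`. -/
noncomputable def mulGrad (m u : RSpace d → ℂ) (g : RSpace d → EuclideanSpace ℂ (Fin d)) :
    RSpace d → EuclideanSpace ℂ (Fin d) :=
  fun x => m x • g x + u x • classicalGrad m x

/-- A smooth bounded multiplier whose gradient decays like `1 / (1 + |x|)`. -/
structure IsMultiplier (m : RSpace d → ℂ) (A : ℝ) : Prop where
  contDiff : ContDiff ℝ ∞ m
  bound : ∀ x, ‖m x‖ ≤ A
  grad_bound : ∀ x, ‖classicalGrad m x‖ ≤ A * (√(‖x‖ ^ 2 + 1))⁻¹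

theorem IsMultiplier.eLpNorm_mul_le {m : RSpace d → ℂ} {A : ℝ} (hm : IsMultiplier m A)
    (u : RSpace d → ℂ) (p : ℝ≥0∞) :
    eLpNorm (fun x => m x * u x) p volume ≤ ENNReal.ofReal A * eLpNorm u p volume :=
  eLpNorm_le_mul_eLpNorm_of_ae_le_mul (Eventually.of_forall fun x => by
    rw [norm_mul]
    gcongr
    exact hm.bound x) p

theorem IsMultiplier.eLpNorm_smul_le {m : RSpace d → ℂ} {A : ℝ} (hm : IsMultiplier m A)
    (g : RSpace d → EuclideanSpace ℂ (Fin d)) (p : ℝ≥0∞) :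
    eLpNorm (fun x => m x • g x) p volume ≤ ENNReal.ofReal A * eLpNorm g p volume :=
  eLpNorm_le_mul_eLpNorm_of_ae_le_mul (Eventually.of_forall fun x => by
    rw [norm_smul]
    gcongr
    exact hm.bound x) p

theorem IsMultiplier.memLp_smul {m : RSpace d → ℂ} {A : ℝ} (hm : IsMultiplier m A)
    {g : RSpace d → EuclideanSpace ℂ (Fin d)} (h : MemLp g 2) : MemLp (fun x => m x • g x) 2 :=
  ⟨hm.contDiff.continuous.aestronglyMeasurable.smul h.1,
    (hm.eLpNorm_smul_le g 2).trans_lt (ENNReal.mul_lt_top ENNReal.ofReal_lt_top h.2)⟩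

variable [Fact (3 ≤ d)]

/-- Functions in `Ḣ¹` need not be in `L²`; the decay of `∇m` makes `u∇m` a Hardy term. -/
theorem IsMultiplier.eLpNorm_smul_grad_le {m : RSpace d → ℂ} {A : ℝ} (hm : IsMultiplier m A)
    {u : RSpace d → ℂ} {g : RSpace d → EuclideanSpace ℂ (Fin d)} (h : InHDot u g) :
    eLpNorm (fun x => u x • classicalGrad m x) 2 volume ≤
      ENNReal.ofReal A * (ENNReal.ofReal (2 / ((d : ℝ) - 2)) * eLpNorm g 2 volume) := by
  refine (eLpNorm_le_mul_eLpNorm_of_ae_le_mul (g := fun x => (√(‖x‖ ^ 2 + 1))⁻¹ • u x) (c := A)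
    (Eventually.of_forall fun x => ?_) 2).trans ?_
  · rw [norm_smul, norm_smul, norm_inv, Real.norm_of_nonneg (Real.sqrt_nonneg _), mul_comm,
      ← mul_assoc]
    gcongr
    exact hm.grad_bound x
  · gcongr
    exact h.hardy one_pos

theorem IsMultiplier.memLp_smul_grad {m : RSpace d → ℂ} {A : ℝ} (hm : IsMultiplier m A)
    {u : RSpace d → ℂ} {g : RSpace d → EuclideanSpace ℂ (Fin d)} (h : InHDot u g) :
    MemLp (fun x => u x • classicalGrad m x) 2 :=
  ⟨h.memLp.1.smul (continuous_classicalGrad hm.contDiff).aestronglyMeasurable,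
    (hm.eLpNorm_smul_grad_le h).trans_lt (ENNReal.mul_lt_top ENNReal.ofReal_lt_top
      (ENNReal.mul_lt_top ENNReal.ofReal_lt_top h.memLp_grad.2))⟩

/-- Multipliers act on `Ḣ¹`. -/
theorem IsMultiplier.inHDot {m : RSpace d → ℂ} {A : ℝ} (hm : IsMultiplier m A)
    {u : RSpace d → ℂ} {g : RSpace d → EuclideanSpace ℂ (Fin d)} (h : InHDot u g) :
    InHDot (fun x => m x * u x) (mulGrad m u g) := by
  obtain ⟨η, h1, h2, h3, -⟩ := h.exists_seq
  have hmem : MemLp (fun x => m x * u x) (sobExp d) :=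
    ⟨hm.contDiff.continuous.aestronglyMeasurable.mul h.memLp.1, (hm.eLpNorm_mul_le u _).trans_lt
      (ENNReal.mul_lt_top ENNReal.ofReal_lt_top h.memLp.2)⟩
  have ht : ∀ n, IsTestFun fun x => m x * η n x := fun n =>
    ⟨hm.contDiff.mul (h1 n).1, (h1 n).2.mul_left⟩
  refine InHDot.of_tendsto hmem ((hm.memLp_smul h.memLp_grad).add (hm.memLp_smul_grad h))
    (fun n => (ht n).inHDot) ?_ ?_
  · have t := ENNReal.Tendsto.const_mul h2 (Or.inr (ENNReal.ofReal_ne_top (r := A)))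
    rw [mul_zero] at t
    refine tendsto_of_tendsto_of_tendsto_of_le_of_le tendsto_const_nhds t (fun _ => zero_le)
      fun n => ?_
    have e : ((fun x => m x * η n x) - fun x => m x * u x) = fun x => m x * (η n - u) x := by
      ext x
      simp [mul_sub]
    simp only [e]
    exact hm.eLpNorm_mul_le _ _
  · have t1 := ENNReal.Tendsto.const_mul h3 (Or.inr (ENNReal.ofReal_ne_top (r := A)))
    have t2 := ENNReal.Tendsto.const_mul (ENNReal.Tendsto.const_mul h3
      (Or.inr (ENNReal.ofReal_ne_top (r := 2 / ((d : ℝ) - 2)))))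
      (Or.inr (ENNReal.ofReal_ne_top (r := A)))
    have t := t1.add t2
    simp only [mul_zero, add_zero] at t
    refine tendsto_of_tendsto_of_tendsto_of_le_of_le tendsto_const_nhds t (fun _ => zero_le)
      fun n => ?_
    -- The Hardy bound must be applied to the difference `ηₙ - u`, so that the term with `∇m` also
    -- tends to zero.
    have hsub := (h1 n).inHDot.sub h
    have e : classicalGrad (fun x => m x * η n x) - mulGrad m u g =
        (fun x => m x • (classicalGrad (η n) - g) x) + fun x => (η n - u) x • classicalGrad m x := by
      ext1 x
      rw [Pi.sub_apply, classicalGrad_mul (hm.contDiff.differentiable (by simp) x)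
        ((h1 n).differentiable x), mulGrad]
      simp only [Pi.add_apply, Pi.sub_apply, smul_sub, sub_smul]
      abel
    simp only [e]
    exact (eLpNorm_add_le (hm.memLp_smul hsub.memLp_grad).1 (hm.memLp_smul_grad hsub).1
      one_le_two).trans (add_le_add (hm.eLpNorm_smul_le _ _) (hm.eLpNorm_smul_grad_le hsub))

end Multiplier

/-! ### Truncated power weights and their logarithmic derivative. -/

section Weights

variable {d : ℕ}

/-- A real vector as a complex vector. -/
noncomputable def complexify (x : RSpace d) : EuclideanSpace ℂ (Fin d) :=
  WithLp.toLp 2 fun i => (x i : ℂ)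

theorem norm_complexify (x : RSpace d) : ‖complexify x‖ = ‖x‖ := by
  simp [complexify, EuclideanSpace.norm_eq]

theorem classicalGrad_radial {φ : ℝ → ℝ} {φ' δ : ℝ} {x : RSpace d}
    (h : HasDerivAt φ φ' (‖x‖ ^ 2 + δ)) :
    classicalGrad (fun y => ((φ (‖y‖ ^ 2 + δ) : ℝ) : ℂ)) x =
      ((2 * φ' : ℝ) : ℂ) • complexify x := by
  ext i
  have h1 := (Complex.ofRealCLM.hasFDerivAt (x := φ (‖x‖ ^ 2 + δ))).comp x
    (h.comp_hasFDerivAt x (hasFDerivAt_normSq_add δ x))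
  simp only [classicalGrad, complexify, PiLp.smul_apply]
  change fderiv ℝ (Complex.ofRealCLM ∘ φ ∘ fun y : RSpace d => ‖y‖ ^ 2 + δ) x (coordVec i) = _
  rw [h1.fderiv]
  simp [inner_coordVec]
  ring

/-- The weight `(J / (1 + sJ)) ^ (α / 2)` as a function of `J = 1 + |x|²`. -/
noncomputable def truncPow (s α : ℝ) (t : ℝ) : ℝ := (t / (1 + s * t)) ^ (α / 2)

theorem hasDerivAt_truncPow {s α t : ℝ} (hs : 0 < s) (ht : 0 < t) :
    HasDerivAt (truncPow s α) (α / 2 * truncPow s α t / (t * (1 + s * t))) t := by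
  have h0 : 0 < 1 + s * t := by positivity
  have h1 : HasDerivAt (fun t => t / (1 + s * t)) (((1 + s * t) ^ 2)⁻¹) t := by
    have h2 := (hasDerivAt_id t).div (((hasDerivAt_id t).const_mul s).const_add 1) h0.ne'
    have e : ((1 + s * t) ^ 2)⁻¹ =
        (1 * (1 + s * id t) - id t * (s * 1)) / (1 + s * id t) ^ 2 := by
      simp only [id]
      rw [inv_eq_one_div]
      congr 1
      ring
    rw [e]
    exact h2
  have h3 := h1.rpow_const (p := α / 2) (Or.inl (by positivity))
  have h4 : 0 < t / (1 + s * t) := by positivity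
  have e : α / 2 * truncPow s α t / (t * (1 + s * t)) =
      ((1 + s * t) ^ 2)⁻¹ * (α / 2) * (t / (1 + s * t)) ^ (α / 2 - 1) := by
    rw [Real.rpow_sub_one h4.ne', truncPow]
    field_simp
  rw [e]
  exact h3

theorem truncPow_pos {s α t : ℝ} (hs : 0 < s) (ht : 0 < t) : 0 < truncPow s α t :=
  Real.rpow_pos_of_pos (by positivity) _

theorem truncPow_le {s α t : ℝ} (hs : 0 < s) (ht : 0 < t) (hα : 0 ≤ α) :
    truncPow s α t ≤ t ^ (α / 2) :=
  Real.rpow_le_rpow (by positivity) (div_le_self ht.le (by nlinarith [mul_pos hs ht]))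
    (by positivity)

theorem truncPow_le_const {s α t : ℝ} (hs : 0 < s) (ht : 0 < t) (hα : 0 ≤ α) :
    truncPow s α t ≤ (s⁻¹) ^ (α / 2) := by
  refine Real.rpow_le_rpow (by positivity) ?_ (by positivity)
  rw [div_le_iff₀ (by positivity), mul_add, ← mul_assoc, inv_mul_cancel₀ hs.ne', one_mul]
  have : 0 < s⁻¹ := by positivity
  linarith

theorem tendsto_truncPow {α t : ℝ} (ht : 0 < t) :
    Tendsto (fun n : ℕ => truncPow (1 / ((n : ℝ) + 1)) α t) atTop (𝓝 (t ^ (α / 2))) := by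
  have h1 := (((tendsto_one_div_add_atTop_nhds_zero_nat (𝕜 := ℝ)).mul_const t).const_add 1)
  rw [zero_mul, add_zero] at h1
  have h2 := (tendsto_const_nhds (x := t)).div h1 one_ne_zero
  rw [div_one] at h2
  exact h2.rpow_const (Or.inl ht.ne')

/-- The truncated weight on space. -/
noncomputable def weight (s α : ℝ) (x : RSpace d) : ℂ := (truncPow s α (‖x‖ ^ 2 + 1) : ℝ)

theorem norm_weight {s : ℝ} (hs : 0 < s) (α : ℝ) (x : RSpace d) :
    ‖weight s α x‖ = truncPow s α (‖x‖ ^ 2 + 1) := by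
  rw [weight, Complex.norm_real, Real.norm_of_nonneg (truncPow_pos hs (by positivity)).le]

/-- The truncation only improves the logarithmic derivative: with `J = |x|² + 1` it contributes a
factor `1/(1+sJ) ≤ 1`. The constant `α` is independent of `s`, and this drives the uniform bound. -/
theorem norm_classicalGrad_weight_le {s α : ℝ} (hs : 0 < s) (hα : 0 ≤ α) (x : RSpace d) :
    ‖classicalGrad (weight s α) x‖ ≤ α * ‖weight s α x‖ * (√(‖x‖ ^ 2 + 1))⁻¹ := by
  have ht : 0 < ‖x‖ ^ 2 + 1 := by positivity
  have hp := truncPow_pos (α := α) hs ht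
  have e : classicalGrad (weight s α) x = _ := classicalGrad_radial (hasDerivAt_truncPow hs ht)
  rw [e, norm_smul, norm_complexify, Complex.norm_real, norm_weight hs]
  have hsq : ‖x‖ ≤ √(‖x‖ ^ 2 + 1) := Real.le_sqrt_of_sq_le (by linarith)
  have hsp : 0 < √(‖x‖ ^ 2 + 1) := Real.sqrt_pos.2 ht
  have hss : √(‖x‖ ^ 2 + 1) ^ 2 = ‖x‖ ^ 2 + 1 := Real.sq_sqrt ht.le
  rw [Real.norm_of_nonneg (by positivity)]
  generalize truncPow s α (‖x‖ ^ 2 + 1) = T at *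
  generalize √(‖x‖ ^ 2 + 1) = J at *
  rw [← hss] at ht ⊢
  have h1 : 2 * (α / 2 * T / (J ^ 2 * (1 + s * J ^ 2))) * ‖x‖ =
      (α * T * J⁻¹) * (‖x‖ / J * (1 + s * J ^ 2)⁻¹) := by
    field_simp
  rw [h1]
  have h2 : ‖x‖ / J ≤ 1 := (div_le_one hsp).2 hsq
  have h3 : (1 + s * J ^ 2)⁻¹ ≤ 1 := inv_le_one_of_one_le₀ (by nlinarith [mul_pos hs ht])
  have h4 : 0 ≤ (1 + s * J ^ 2)⁻¹ := by positivity
  have h5 : 0 ≤ α * T * J⁻¹ := by positivity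
  have h6 : ‖x‖ / J * (1 + s * J ^ 2)⁻¹ ≤ 1 := mul_le_one₀ h2 h4 h3
  exact mul_le_of_le_one_right h5 h6

theorem contDiff_weight {s : ℝ} (hs : 0 < s) (α : ℝ) :
    ContDiff ℝ ∞ (weight s α : RSpace d → ℂ) := by
  refine Complex.ofRealCLM.contDiff.comp ?_
  have h : ContDiff ℝ ∞ fun x : RSpace d => (‖x‖ ^ 2 + 1) / (1 + s * (‖x‖ ^ 2 + 1)) :=
    (contDiff_normSq_add 1).div (contDiff_const.add (contDiff_const.mul (contDiff_normSq_add 1)))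
      fun x => by positivity
  exact h.rpow_const_of_ne fun x => by positivity

/-- For fixed `s` the weight is bounded, hence admissible in test functions. The constant depends on
`s`; it serves only for membership, and the uniform estimates do not use it. -/
theorem isMultiplier_weight {s α : ℝ} (hs : 0 < s) (hα : 0 ≤ α) :
    IsMultiplier (weight s α : RSpace d → ℂ) ((1 + α) * (s⁻¹) ^ (α / 2)) := by
  have hc : 0 ≤ (s⁻¹) ^ (α / 2) := by positivity
  have hb : ∀ x : RSpace d, ‖weight s α x‖ ≤ (s⁻¹) ^ (α / 2) := fun x => by
    rw [norm_weight hs]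
    exact truncPow_le_const hs (by positivity) hα
  refine ⟨contDiff_weight hs α, fun x => (hb x).trans ?_, fun x =>
    (norm_classicalGrad_weight_le hs hα x).trans ?_⟩
  · nlinarith
  · gcongr
    · linarith
    · exact hb x

end Weights

/-! ### Weighted energy estimate for solutions. -/

section Decay

variable {d : ℕ} [Fact (3 ≤ d)]

theorem InHDot.memLp_ball {u : RSpace d → ℂ} {g : RSpace d → EuclideanSpace ℂ (Fin d)}
    (h : InHDot u g) (R : ℝ) : MemLp u 2 (volume.restrict (Metric.closedBall 0 R)) := by
  have : IsFiniteMeasure (volume.restrict (Metric.closedBall (0 : RSpace d) R)) :=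
    ⟨by rw [Measure.restrict_apply_univ]; exact (isCompact_closedBall 0 R).measure_lt_top⟩
  exact (h.memLp.restrict _).mono_exponent two_le_sobExp

/-- The potential is form bounded with relative bound zero, modulo a local term. -/
theorem exists_potential_le {V : RSpace d → ℝ} (hV : MemLp V ((d : ℝ≥0∞) / 2)) {ν : ℝ}
    (hν : 0 < ν) : ∃ A R : ℝ, 0 ≤ A ∧ ∀ (u : RSpace d → ℂ)
      (g : RSpace d → EuclideanSpace ℂ (Fin d)), InHDot u g →
      |∫ x, V x * ‖u x‖ ^ 2| ≤ A * (∫ x in Metric.closedBall 0 R, ‖u x‖ ^ 2) +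
        ν * (eLpNorm g 2 volume).toReal ^ 2 := by
  -- Sobolev turns an `L^{d/2}` error `δ` in the potential into `δ S²` in the form, with `S` the
  -- Sobolev constant.
  obtain ⟨δ, hδ, hδν⟩ : ∃ δ : ℝ, 0 < δ ∧ δ * (sobConst d : ℝ) ^ 2 ≤ ν := by
    refine ⟨ν / ((sobConst d : ℝ) ^ 2 + 1), by positivity, ?_⟩
    rw [div_mul_eq_mul_div, div_le_iff₀ (by positivity)]
    nlinarith
  obtain ⟨V₁, hc, hle, hcont, hmem⟩ := hV.exists_hasCompactSupport_eLpNorm_sub_le potExp_ne_top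
    (ENNReal.ofReal_pos.2 hδ).ne'
  obtain ⟨A, hA⟩ := hcont.bounded_above_of_compact_support hc
  obtain ⟨R, hR⟩ := hc.isCompact.isBounded.subset_closedBall (0 : RSpace d)
  have hA0 : 0 ≤ A := (norm_nonneg _).trans (hA 0)
  refine ⟨A, R, hA0, fun u g h => ?_⟩
  have i1 := integrable_potential_sq hmem h.memLp
  have i2 := integrable_potential_sq (hV.sub hmem) h.memLp
  have e : ∫ x, V x * ‖u x‖ ^ 2 = (∫ x, V₁ x * ‖u x‖ ^ 2) + ∫ x, (V - V₁) x * ‖u x‖ ^ 2 := by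
    rw [← integral_add i1 i2]
    refine integral_congr_ae (Eventually.of_forall fun x => ?_)
    simp only [Pi.sub_apply]
    ring
  have b1 : |∫ x, V₁ x * ‖u x‖ ^ 2| ≤ A * ∫ x in Metric.closedBall 0 R, ‖u x‖ ^ 2 := by
    have hs : ∫ x in Metric.closedBall 0 R, V₁ x * ‖u x‖ ^ 2 = ∫ x, V₁ x * ‖u x‖ ^ 2 :=
      setIntegral_eq_integral_of_forall_compl_eq_zero fun x hx => by
        have : V₁ x = 0 := by
          by_contra h0
          exact hx (hR (subset_tsupport _ h0))
        simp [this]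
    rw [← hs, ← Real.norm_eq_abs, ← integral_const_mul]
    refine norm_integral_le_of_norm_le
      (((h.memLp_ball R).integrable_norm_pow two_ne_zero).const_mul A)
      (Eventually.of_forall fun x => ?_)
    rw [norm_mul, norm_pow, norm_norm]
    gcongr
    exact hA x
  have b2 : |∫ x, (V - V₁) x * ‖u x‖ ^ 2| ≤ ν * (eLpNorm g 2 volume).toReal ^ 2 := by
    have h1 := norm_integral_potential_le (hV.sub hmem) h.memLp h.memLp
    rw [integral_potential_self, Complex.norm_real, Real.norm_eq_abs] at h1
    have h2 : (eLpNorm u (sobExp d) volume).toReal ≤ sobConst d * (eLpNorm g 2 volume).toReal := by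
      have := ENNReal.toReal_mono (ENNReal.mul_ne_top ENNReal.coe_ne_top
        h.memLp_grad.eLpNorm_ne_top) h.eLpNorm_le
      rwa [ENNReal.toReal_mul, ENNReal.coe_toReal] at this
    have h3 : (eLpNorm (V - V₁) ((d : ℝ≥0∞) / 2) volume).toReal ≤ δ := by
      have := ENNReal.toReal_mono ENNReal.ofReal_ne_top hle
      rwa [ENNReal.toReal_ofReal hδ.le] at this
    calc |∫ x, (V - V₁) x * ‖u x‖ ^ 2| ≤ _ := h1
      _ ≤ δ * ((sobConst d * (eLpNorm g 2 volume).toReal) *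
          (sobConst d * (eLpNorm g 2 volume).toReal)) := by gcongr
      _ = δ * (sobConst d : ℝ) ^ 2 * (eLpNorm g 2 volume).toReal ^ 2 := by ring
      _ ≤ _ := by gcongr
  rw [e]
  exact (abs_add_le _ _).trans (add_le_add b1 b2)

/-- The pointwise identity `Re⟨∇(G²u), ∇u⟩ = |∇(Gu)|² - |u∇G|²` behind the energy method, with `r =
G` real and `D = ∇G`. -/
theorem re_inner_mulGrad {E : Type*} [NormedAddCommGroup E] [InnerProductSpace ℂ E] (r : ℝ) (u : ℂ)
    (g D : E) :
    (inner ℂ ((r : ℂ) • ((r : ℂ) • g + u • D) + ((r : ℂ) * u) • D) g).re =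
      ‖(r : ℂ) • g + u • D‖ ^ 2 - ‖u • D‖ ^ 2 := by
  have e1 : ‖(r : ℂ) • g + u • D‖ ^ 2 =
      ‖(r : ℂ) • g‖ ^ 2 + 2 * (inner ℂ ((r : ℂ) • g) (u • D)).re + ‖u • D‖ ^ 2 :=
    norm_add_sq (𝕜 := ℂ) _ _
  have e2 : ‖(r : ℂ) • g‖ ^ 2 = r ^ 2 * (inner ℂ g g).re := by
    rw [norm_smul, mul_pow, Complex.norm_real, Real.norm_eq_abs, sq_abs]
    simp [← Complex.ofReal_pow]
  have e3 : (inner ℂ ((r : ℂ) • g) (u • D)).re = r * (inner ℂ (u • D) g).re := by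
    rw [inner_smul_left, Complex.conj_ofReal, Complex.re_ofReal_mul, ← inner_conj_symm,
      Complex.conj_re]
  rw [e1, e2, e3, mul_smul, ← smul_add, inner_smul_left, Complex.conj_ofReal,
    Complex.re_ofReal_mul, inner_add_left, inner_add_left, inner_smul_left, Complex.conj_ofReal,
    Complex.add_re, Complex.add_re, Complex.re_ofReal_mul]
  ring

/-- The energy identity obtained by testing the equation with `G²u`. -/
theorem energy_identity {V : RSpace d → ℝ} {u : RSpace d → ℂ}
    {g : RSpace d → EuclideanSpace ℂ (Fin d)} (h : InHDot u g)
    (hEL : ∀ (v : RSpace d → ℂ) (k : RSpace d → EuclideanSpace ℂ (Fin d)), InHDot v k →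
      (∫ x, inner ℂ (k x) (g x)) + ∫ x, (V x : ℂ) * (conj (v x) * u x) = 0)
    {G : RSpace d → ℝ} {A : ℝ} (hG : IsMultiplier (fun x => (G x : ℂ)) A) :
    (∫ x, ‖mulGrad (fun x => (G x : ℂ)) u g x‖ ^ 2) -
      (∫ x, ‖u x • classicalGrad (fun x => (G x : ℂ)) x‖ ^ 2) +
      ∫ x, V x * ‖(G x : ℂ) * u x‖ ^ 2 = 0 := by
  have h1 := hG.inHDot h
  -- The test function is `G(Gu)`, so its membership in `Ḣ¹` comes from applying the multiplier
  -- twice.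
  have h2 := hG.inHDot h1
  have e := congrArg Complex.re (hEL _ _ h2)
  rw [Complex.add_re, Complex.zero_re] at e
  have hi : Integrable fun x => inner ℂ (mulGrad (fun x => (G x : ℂ)) (fun x => (G x : ℂ) * u x)
      (mulGrad (fun x => (G x : ℂ)) u g) x) (g x) := by
    refine (L2.integrable_inner (𝕜 := ℂ) (h2.memLp_grad.toLp _) (h.memLp_grad.toLp _)).congr ?_
    filter_upwards [h2.memLp_grad.coeFn_toLp, h.memLp_grad.coeFn_toLp] with x hx hy
    rw [hx, hy]
  have e1 : (∫ x, inner ℂ (mulGrad (fun x => (G x : ℂ)) (fun x => (G x : ℂ) * u x)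
      (mulGrad (fun x => (G x : ℂ)) u g) x) (g x)).re =
      (∫ x, ‖mulGrad (fun x => (G x : ℂ)) u g x‖ ^ 2) -
        ∫ x, ‖u x • classicalGrad (fun x => (G x : ℂ)) x‖ ^ 2 := by
    have := integral_re hi
    simp only [RCLike.re_to_complex] at this
    rw [← this, ← integral_sub (h1.memLp_grad.integrable_norm_pow two_ne_zero)
      ((hG.memLp_smul_grad h).integrable_norm_pow two_ne_zero)]
    refine integral_congr_ae (Eventually.of_forall fun x => ?_)
    exact re_inner_mulGrad (G x) (u x) (g x) (classicalGrad (fun x => (G x : ℂ)) x)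
  have e2 : ∫ x, (V x : ℂ) * (conj ((G x : ℂ) * ((G x : ℂ) * u x)) * u x) =
      ((∫ x, V x * ‖(G x : ℂ) * u x‖ ^ 2 : ℝ) : ℂ) := by
    rw [← integral_potential_self]
    refine integral_congr_ae (Eventually.of_forall fun x => ?_)
    simp only [map_mul, Complex.conj_ofReal]
    ring
  rw [e1, e2, Complex.ofReal_re] at e
  exact e

/-- Hardy is applied to `Gu`, not to `u`, so that the error is compared with the very quantity to be
estimated. -/
theorem eLpNorm_smul_grad_weight_le {u : RSpace d → ℂ} {g : RSpace d → EuclideanSpace ℂ (Fin d)}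
    (h : InHDot u g) {s α : ℝ} (hs : 0 < s) (hα : 0 ≤ α) :
    eLpNorm (fun x => u x • classicalGrad (weight s α) x) 2 volume ≤
      ENNReal.ofReal (α * (2 / ((d : ℝ) - 2))) * eLpNorm (mulGrad (weight s α) u g) 2 volume := by
  have h1 := (isMultiplier_weight hs hα).inHDot h
  rw [ENNReal.ofReal_mul hα, mul_assoc]
  refine (eLpNorm_le_mul_eLpNorm_of_ae_le_mul (c := α)
    (g := fun x => (√(‖x‖ ^ 2 + 1))⁻¹ • (weight s α x * u x))
    (Eventually.of_forall fun x => ?_) 2).trans ?_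
  · rw [norm_smul, norm_smul, norm_mul, norm_inv, Real.norm_of_nonneg (Real.sqrt_nonneg _)]
    calc ‖u x‖ * ‖classicalGrad (weight s α) x‖
        ≤ ‖u x‖ * (α * ‖weight s α x‖ * (√(‖x‖ ^ 2 + 1))⁻¹) := by
          gcongr
          exact norm_classicalGrad_weight_le hs hα x
      _ = _ := by ring
  · gcongr
    exact h1.hardy one_pos

/-- Uniform bound for the weighted gradients of a solution. -/
theorem exists_weighted_bound {V : RSpace d → ℝ} (hV : MemLp V ((d : ℝ≥0∞) / 2))
    {u : RSpace d → ℂ} {g : RSpace d → EuclideanSpace ℂ (Fin d)} (h : InHDot u g)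
    (hEL : ∀ (v : RSpace d → ℂ) (k : RSpace d → EuclideanSpace ℂ (Fin d)), InHDot v k →
      (∫ x, inner ℂ (k x) (g x)) + ∫ x, (V x : ℂ) * (conj (v x) * u x) = 0)
    {α : ℝ} (hα : 0 ≤ α) (hα' : α < ((d : ℝ) - 2) / 2) :
    ∃ C : ℝ, ∀ s : ℝ, 0 < s → eLpNorm (mulGrad (weight s α) u g) 2 volume ≤ ENNReal.ofReal C := by
  have h3 := three_le_cast (d := d)
  have hd2 : (0 : ℝ) < d - 2 := by linarith
  have hθ0 : 0 ≤ α * (2 / ((d : ℝ) - 2)) := by positivity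
  -- The bound on `α` enters here: the commutator term is strictly smaller than the main term.
  have hθ1 : α * (2 / ((d : ℝ) - 2)) < 1 := by
    rw [← mul_div_assoc, div_lt_one hd2]
    linarith
  have hθ2 : (α * (2 / ((d : ℝ) - 2))) ^ 2 < 1 := by nlinarith
  generalize hθ : α * (2 / ((d : ℝ) - 2)) = θ at *
  -- Half of the gap `1 - θ²` pays for the potential and the other half remains on the left, giving
  -- `((1-θ²)/2)N² ≤ B`.
  obtain ⟨A, R, hA, hpot⟩ := exists_potential_le hV (ν := (1 - θ ^ 2) / 2) (by linarith)
  let B : ℝ := A * ∫ x in Metric.closedBall 0 R, (R ^ 2 + 1) ^ α * ‖u x‖ ^ 2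
  refine ⟨√(B / ((1 - θ ^ 2) / 2)), fun s hs => ?_⟩
  have hm := isMultiplier_weight (d := d) hs hα
  have h1 := hm.inHDot h
  have hid := energy_identity h hEL (G := fun x => truncPow s α (‖x‖ ^ 2 + 1)) hm
  change (∫ x, ‖mulGrad (weight s α) u g x‖ ^ 2) -
      (∫ x, ‖u x • classicalGrad (weight s α) x‖ ^ 2) +
      ∫ x, V x * ‖weight s α x * u x‖ ^ 2 = 0 at hid
  rw [← toReal_eLpNorm_two_sq h1.memLp_grad, ← toReal_eLpNorm_two_sq (hm.memLp_smul_grad h)] at hid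
  have hD : (eLpNorm (fun x => u x • classicalGrad (weight s α) x) 2 volume).toReal ≤
      θ * (eLpNorm (mulGrad (weight s α) u g) 2 volume).toReal := by
    have := ENNReal.toReal_mono (ENNReal.mul_ne_top ENNReal.ofReal_ne_top
      h1.memLp_grad.eLpNorm_ne_top) (eLpNorm_smul_grad_weight_le h hs hα)
    rwa [ENNReal.toReal_mul, hθ, ENNReal.toReal_ofReal hθ0] at this
  have hP := hpot _ _ h1
  -- On the ball the weight is bounded by its untruncated form, so `B` does not depend on `s`.
  have hB : A * (∫ x in Metric.closedBall 0 R, ‖weight s α x * u x‖ ^ 2) ≤ B := by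
    refine mul_le_mul_of_nonneg_left ?_ hA
    refine setIntegral_mono_on ((h1.memLp_ball R).integrable_norm_pow two_ne_zero)
      (((h.memLp_ball R).integrable_norm_pow two_ne_zero).const_mul _)
      measurableSet_closedBall fun x hx => ?_
    rw [norm_mul, mul_pow, norm_weight hs]
    gcongr
    have hxR : ‖x‖ ≤ R := by simpa using hx
    have hJ : 0 < ‖x‖ ^ 2 + 1 := by positivity
    calc truncPow s α (‖x‖ ^ 2 + 1) ^ 2 ≤ ((‖x‖ ^ 2 + 1) ^ (α / 2)) ^ 2 :=
          pow_le_pow_left₀ (truncPow_pos hs hJ).le (truncPow_le hs hJ hα) 2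
      _ = (‖x‖ ^ 2 + 1) ^ α := by
          rw [← Real.rpow_natCast, ← Real.rpow_mul hJ.le]
          norm_num
      _ ≤ (R ^ 2 + 1) ^ α := by
          gcongr
  have hN0 : 0 ≤ (eLpNorm (mulGrad (weight s α) u g) 2 volume).toReal := ENNReal.toReal_nonneg
  have hD0 : 0 ≤ (eLpNorm (fun x => u x • classicalGrad (weight s α) x) 2 volume).toReal :=
    ENNReal.toReal_nonneg
  rw [← ENNReal.ofReal_toReal h1.memLp_grad.eLpNorm_ne_top]
  refine ENNReal.ofReal_le_ofReal (Real.le_sqrt_of_sq_le ?_)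
  rw [le_div_iff₀ (by linarith)]
  generalize (eLpNorm (mulGrad (weight s α) u g) 2 volume).toReal = N at *
  generalize (eLpNorm (fun x => u x • classicalGrad (weight s α) x) 2 volume).toReal = D at *
  have hD2 : D ^ 2 ≤ θ ^ 2 * N ^ 2 := by
    rw [← mul_pow]
    exact pow_le_pow_left₀ hD0 hD 2
  have := (neg_le_abs _).trans hP
  linarith

/-- Weighted integrability of a solution and of its gradient. -/
theorem memLp_weighted {V : RSpace d → ℝ} (hV : MemLp V ((d : ℝ≥0∞) / 2))
    {u : RSpace d → ℂ} {g : RSpace d → EuclideanSpace ℂ (Fin d)} (h : InHDot u g)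
    (hEL : ∀ (v : RSpace d → ℂ) (k : RSpace d → EuclideanSpace ℂ (Fin d)), InHDot v k →
      (∫ x, inner ℂ (k x) (g x)) + ∫ x, (V x : ℂ) * (conj (v x) * u x) = 0)
    {α : ℝ} (hα : 0 ≤ α) (hα' : α < ((d : ℝ) - 2) / 2) :
    MemLp (fun x => (√(‖x‖ ^ 2 + 1))⁻¹ • ((((‖x‖ ^ 2 + 1) ^ (α / 2) : ℝ) : ℂ) * u x)) 2 ∧
      MemLp (fun x => (((‖x‖ ^ 2 + 1) ^ (α / 2) : ℝ) : ℂ) • g x) 2 := by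
  obtain ⟨C, hC⟩ := exists_weighted_bound hV h hEL hα hα'
  have hs : ∀ n : ℕ, (0 : ℝ) < 1 / ((n : ℝ) + 1) := fun n => by positivity
  have hm := fun n => isMultiplier_weight (d := d) (hs n) hα
  have hlim : ∀ x : RSpace d, Tendsto (fun n : ℕ => weight (1 / ((n : ℝ) + 1)) α x) atTop
      (𝓝 (((‖x‖ ^ 2 + 1) ^ (α / 2) : ℝ) : ℂ)) := fun x =>
    (Complex.continuous_ofReal.tendsto _).comp (tendsto_truncPow (by positivity))
  have hJ : Measurable fun x : RSpace d => (((‖x‖ ^ 2 + 1) ^ (α / 2) : ℝ) : ℂ) := by fun_prop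
  have hN : Measurable fun x : RSpace d => (√(‖x‖ ^ 2 + 1))⁻¹ := by fun_prop
  constructor
  · refine ⟨hN.aestronglyMeasurable.smul (hJ.aestronglyMeasurable.mul h.memLp.1), ?_⟩
    have hF := Lp.eLpNorm_lim_le_liminf_eLpNorm (p := 2) (μ := volume)
      (f := fun (n : ℕ) (x : RSpace d) =>
        (√(‖x‖ ^ 2 + 1))⁻¹ • (weight (1 / ((n : ℝ) + 1)) α x * u x))
      (fun n => (((hm n).inHDot h).memLp_hardy one_pos).1) _
      (Eventually.of_forall fun x => ((hlim x).mul_const (u x)).const_smul _)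
    refine hF.trans_lt (lt_of_le_of_lt (liminf_le_liminf (Eventually.of_forall fun n =>
      (((hm n).inHDot h).hardy one_pos).trans (mul_le_mul' le_rfl (hC _ (hs n))))) ?_)
    simp only [liminf_const]
    exact ENNReal.mul_lt_top ENNReal.ofReal_lt_top ENNReal.ofReal_lt_top
  · refine ⟨hJ.aestronglyMeasurable.smul h.memLp_grad.1, ?_⟩
    have hF := Lp.eLpNorm_lim_le_liminf_eLpNorm (p := 2) (μ := volume)
      (f := fun (n : ℕ) (x : RSpace d) => weight (1 / ((n : ℝ) + 1)) α x • g x)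
      (fun n => ((hm n).memLp_smul h.memLp_grad).1) _
      (Eventually.of_forall fun x => (hlim x).smul_const (g x))
    have hb : ∀ n : ℕ, eLpNorm (fun x => weight (1 / ((n : ℝ) + 1)) α x • g x) 2 volume ≤
        ENNReal.ofReal C + ENNReal.ofReal (α * (2 / ((d : ℝ) - 2))) * ENNReal.ofReal C := by
      intro n
      -- `G∇u = ∇(Gu) - u∇G`, and both terms on the right are bounded uniformly in the truncation.
      have e : (fun x => weight (1 / ((n : ℝ) + 1)) α x • g x) =
          mulGrad (weight (1 / ((n : ℝ) + 1)) α) u g -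
            fun x => u x • classicalGrad (weight (1 / ((n : ℝ) + 1)) α) x := by
        ext1 x
        simp [mulGrad]
      rw [e]
      refine (eLpNorm_sub_le ((hm n).inHDot h).memLp_grad.1 ((hm n).memLp_smul_grad h).1
        one_le_two).trans (add_le_add (hC _ (hs n)) ?_)
      exact (eLpNorm_smul_grad_weight_le h (hs n) hα).trans (mul_le_mul' le_rfl (hC _ (hs n)))
    refine hF.trans_lt (lt_of_le_of_lt (liminf_le_liminf (Eventually.of_forall hb)) ?_)
    simp only [liminf_const]
    exact ENNReal.add_lt_top.2 ⟨ENNReal.ofReal_lt_top,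
      ENNReal.mul_lt_top ENNReal.ofReal_lt_top ENNReal.ofReal_lt_top⟩

end Decay

/-! ### Product rule for weak gradients with a smooth factor. -/

section ProductRule

variable {d : ℕ}

theorem MeasureTheory.LocallyIntegrable.coord {f : RSpace d → EuclideanSpace ℂ (Fin d)}
    (hf : LocallyIntegrable f) (i : Fin d) : LocallyIntegrable fun x => f x i := fun x => by
  obtain ⟨s, hs, h⟩ := hf x
  exact ⟨s, hs, (EuclideanSpace.proj (𝕜 := ℂ) i).integrable_comp h⟩

/-- Test the weak gradient of `u` with `ηW`. Everything is local, so `W` may grow, unlike the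
bounded multipliers above. -/
theorem HasWeakGrad.mul_contDiff {u : RSpace d → ℂ} {g : RSpace d → EuclideanSpace ℂ (Fin d)}
    (h : HasWeakGrad u g) {W : RSpace d → ℝ} (hW : ContDiff ℝ ∞ W) :
    HasWeakGrad (fun x => (W x : ℂ) * u x) (mulGrad (fun x => (W x : ℂ)) u g) := by
  have hWc : ContDiff ℝ ∞ fun x => (W x : ℂ) := Complex.ofRealCLM.contDiff.comp hW
  have lu : LocallyIntegrable fun x => (W x : ℂ) * u x := h.1.continuous_smul hWc.continuous
  have lg : LocallyIntegrable fun x => (W x : ℂ) • g x := h.2.1.continuous_smul hWc.continuous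
  have lc : LocallyIntegrable fun x => u x • classicalGrad (fun x => (W x : ℂ)) x :=
    h.1.smul_continuous (continuous_classicalGrad hWc)
  refine ⟨lu, lg.add lc, fun η hη hc i => ?_⟩
  have e := h.2.2 (fun x => η x * W x) (hη.mul hW) hc.mul_right i
  have cη : Continuous fun x => fderiv ℝ η x (coordVec i) :=
    (hη.continuous_fderiv (by simp)).clm_apply continuous_const
  have sη : HasCompactSupport fun x => fderiv ℝ η x (coordVec i) :=
    hc.fderiv_apply (𝕜 := ℝ) (coordVec i)
  have hd : ∀ x, fderiv ℝ (fun x => η x * W x) x (coordVec i) • u x =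
      fderiv ℝ η x (coordVec i) • ((W x : ℂ) * u x) +
        η x • (u x • classicalGrad (fun x => (W x : ℂ)) x) i := fun x => by
    have dW := (hW.differentiable (by simp)).differentiableAt (x := x)
    have dη := (hη.differentiable (by simp)).differentiableAt (x := x)
    have e1 : fderiv ℝ (fun x => (W x : ℂ)) x (coordVec i) =
        ((fderiv ℝ W x (coordVec i) : ℝ) : ℂ) := by
      have := (Complex.ofRealCLM.hasFDerivAt (x := W x)).comp x dW.hasFDerivAt
      change fderiv ℝ (Complex.ofRealCLM ∘ W) x (coordVec i) = _
      rw [this.fderiv]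
      simp
    rw [fderiv_fun_mul dη dW, PiLp.smul_apply, classicalGrad]
    simp only [e1, add_apply, smul_apply, smul_eq_mul,
      Complex.real_smul, Complex.ofReal_add, Complex.ofReal_mul]
    ring
  simp_rw [hd] at e
  rw [integral_add (lu.integrable_smul_left_of_hasCompactSupport cη sη)
    ((lc.coord i).integrable_smul_left_of_hasCompactSupport hη.continuous hc)] at e
  have e2 : ∫ x, η x • mulGrad (fun x => (W x : ℂ)) u g x i = (∫ x, (η x * W x) • g x i) +
      ∫ x, η x • (u x • classicalGrad (fun x => (W x : ℂ)) x) i := by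
    rw [← integral_add]
    · refine integral_congr_ae (Eventually.of_forall fun x => ?_)
      simp only [mulGrad, PiLp.add_apply, PiLp.smul_apply, smul_eq_mul, Complex.real_smul,
        Complex.ofReal_mul]
      ring
    · exact (h.2.1.coord i).integrable_smul_left_of_hasCompactSupport
        (hη.continuous.mul hW.continuous) hc.mul_right
    · exact (lc.coord i).integrable_smul_left_of_hasCompactSupport
        hη.continuous hc
  rw [e2, eq_sub_of_add_eq e]
  ring

end ProductRule

/-! ### Smooth regularizations of `|x|^α`. -/

section PowerWeight

variable {d : ℕ}

/-- The gradient of `|x| ^ α`. -/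
noncomputable def powGrad (α : ℝ) (x : RSpace d) : EuclideanSpace ℂ (Fin d) :=
  ((α * (‖x‖ ^ 2) ^ (α / 2 - 1) : ℝ) : ℂ) • complexify x

theorem norm_rpow_eq (α : ℝ) (x : RSpace d) : ‖x‖ ^ α = (‖x‖ ^ 2) ^ (α / 2) := by
  rw [← Real.rpow_natCast, ← Real.rpow_mul (norm_nonneg x)]
  congr 1
  push_cast
  ring

theorem classicalGrad_pow {δ : ℝ} (hδ : 0 < δ) (α : ℝ) (x : RSpace d) :
    classicalGrad (fun y => (((‖y‖ ^ 2 + δ) ^ (α / 2) : ℝ) : ℂ)) x =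
      ((α * (‖x‖ ^ 2 + δ) ^ (α / 2 - 1) : ℝ) : ℂ) • complexify x := by
  have h : HasDerivAt (fun t : ℝ => t ^ (α / 2)) (α / 2 * (‖x‖ ^ 2 + δ) ^ (α / 2 - 1))
      (‖x‖ ^ 2 + δ) := Real.hasDerivAt_rpow_const (Or.inl (by positivity))
  rw [classicalGrad_radial h]
  congr 2
  ring

theorem contDiff_pow {δ : ℝ} (hδ : 0 < δ) (α : ℝ) :
    ContDiff ℝ ∞ fun x : RSpace d => (‖x‖ ^ 2 + δ) ^ (α / 2) :=
  (contDiff_normSq_add δ).rpow_const_of_ne fun x => by positivity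

/-- The bound is uniform in `δ ≤ 1`, and its singularity `|x|⁻¹` is what Hardy controls; it provides
the dominating function as `δ → 0`. -/
theorem norm_classicalGrad_pow_le {δ α : ℝ} (hδ : 0 < δ) (hδ1 : δ ≤ 1) (hα : 0 ≤ α)
    (x : RSpace d) :
    ‖classicalGrad (fun y => (((‖y‖ ^ 2 + δ) ^ (α / 2) : ℝ) : ℂ)) x‖ ≤
      α * (‖x‖ ^ 2 + 1) ^ (α / 2) * ‖x‖⁻¹ := by
  have ht : 0 < ‖x‖ ^ 2 + δ := by positivity
  rw [classicalGrad_pow hδ, norm_smul, norm_complexify, Complex.norm_real,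
    Real.norm_of_nonneg (by positivity), Real.rpow_sub_one ht.ne', mul_assoc, mul_assoc]
  refine mul_le_mul_of_nonneg_left ?_ hα
  rcases eq_or_ne x 0 with rfl | hx
  · simp
  have hx0 : 0 < ‖x‖ := norm_pos_iff.2 hx
  calc (‖x‖ ^ 2 + δ) ^ (α / 2) / (‖x‖ ^ 2 + δ) * ‖x‖
      ≤ (‖x‖ ^ 2 + 1) ^ (α / 2) / ‖x‖ ^ 2 * ‖x‖ := by
        gcongr
        linarith
    _ = _ := by field_simp

theorem tendsto_pow {α : ℝ} (hα : 0 ≤ α) (x : RSpace d) :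
    Tendsto (fun n : ℕ => (‖x‖ ^ 2 + 1 / ((n : ℝ) + 1)) ^ (α / 2)) atTop (𝓝 (‖x‖ ^ α)) := by
  have t := (tendsto_one_div_add_atTop_nhds_zero_nat (𝕜 := ℝ)).const_add (‖x‖ ^ 2)
  rw [add_zero] at t
  rw [norm_rpow_eq]
  exact (Real.continuousAt_rpow_const _ _ (Or.inr (by positivity))).tendsto.comp t

theorem tendsto_classicalGrad_pow (α : ℝ) (x : RSpace d) :
    Tendsto (fun n : ℕ => classicalGrad
      (fun y : RSpace d => (((‖y‖ ^ 2 + 1 / ((n : ℝ) + 1)) ^ (α / 2) : ℝ) : ℂ)) x)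
      atTop (𝓝 (powGrad α x)) := by
  have e : ∀ n : ℕ, classicalGrad
      (fun y : RSpace d => (((‖y‖ ^ 2 + 1 / ((n : ℝ) + 1)) ^ (α / 2) : ℝ) : ℂ)) x = _ :=
    fun n => classicalGrad_pow (by positivity) α x
  simp_rw [e, powGrad]
  rcases eq_or_ne x 0 with rfl | hx
  · have : complexify (0 : RSpace d) = 0 := norm_eq_zero.1 (by rw [norm_complexify, norm_zero])
    simp [this]
  have t := (tendsto_one_div_add_atTop_nhds_zero_nat (𝕜 := ℝ)).const_add (‖x‖ ^ 2)
  rw [add_zero] at t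
  have t2 := (Real.continuousAt_rpow_const (‖x‖ ^ 2) (α / 2 - 1)
    (Or.inl (by simpa using hx))).tendsto.comp t
  exact ((Complex.continuous_ofReal.tendsto _).comp (t2.const_mul α)).smul_const _

theorem norm_powGrad {α : ℝ} (hα : 0 ≤ α) (x : RSpace d) :
    ‖powGrad α x‖ = α * (‖x‖ ^ α * ‖x‖⁻¹) := by
  rcases eq_or_ne x 0 with rfl | hx
  · have : complexify (0 : RSpace d) = 0 := norm_eq_zero.1 (by rw [norm_complexify, norm_zero])
    simp [powGrad, this]
  have hx0 : 0 < ‖x‖ := norm_pos_iff.2 hx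
  rw [powGrad, norm_smul, norm_complexify, Complex.norm_real, Real.norm_of_nonneg (by positivity),
    Real.rpow_sub_one (by positivity), ← norm_rpow_eq]
  field_simp

theorem measurable_powGrad (α : ℝ) : Measurable (powGrad α : RSpace d → EuclideanSpace ℂ (Fin d)) := by
  have h : Continuous (complexify : RSpace d → EuclideanSpace ℂ (Fin d)) := by
    unfold complexify
    fun_prop
  have h1 : Measurable fun x : RSpace d => ((α * (‖x‖ ^ 2) ^ (α / 2 - 1) : ℝ) : ℂ) := by fun_prop
  exact h1.smul h.measurable

end PowerWeight

/-! ### Weighted integrability with the weights of the theorem, and the eigenvector. -/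

section WeightedSolution

variable {d : ℕ}

/-- `1 + |x|` and `√(|x|²+1)` are comparable within a factor of two, at the cost of `2^α`. -/
theorem memLp_one_add_norm_pow {u : RSpace d → ℂ} (hu : AEStronglyMeasurable u volume) {α : ℝ}
    (hα : 0 ≤ α)
    (h1 : MemLp (fun x => (√(‖x‖ ^ 2 + 1))⁻¹ • ((((‖x‖ ^ 2 + 1) ^ (α / 2) : ℝ) : ℂ) * u x)) 2) :
    MemLp (fun x => (((1 + ‖x‖) ^ (α - 1) : ℝ) : ℂ) * u x) 2 := by
  have hm : Measurable fun x : RSpace d => (((1 + ‖x‖) ^ (α - 1) : ℝ) : ℂ) := by fun_prop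
  refine (h1.norm.const_mul (2 ^ α)).mono (hm.aestronglyMeasurable.mul hu)
    (Eventually.of_forall fun x => ?_)
  refine le_trans ?_ (le_abs_self _)
  have hx := norm_nonneg x
  have hu := norm_nonneg (u x)
  have hs : 0 < √(‖x‖ ^ 2 + 1) := Real.sqrt_pos.2 (by positivity)
  have h2 : √(‖x‖ ^ 2 + 1) ≤ 1 + ‖x‖ := Real.sqrt_le_iff.2 ⟨by positivity, by nlinarith⟩
  have h3 : 1 + ‖x‖ ≤ 2 * √(‖x‖ ^ 2 + 1) := by
    have a1 : 1 ≤ √(‖x‖ ^ 2 + 1) := Real.le_sqrt_of_sq_le (by nlinarith)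
    have a2 : ‖x‖ ≤ √(‖x‖ ^ 2 + 1) := Real.le_sqrt_of_sq_le (by linarith)
    linarith
  have h4 : (√(‖x‖ ^ 2 + 1)) ^ α = (‖x‖ ^ 2 + 1) ^ (α / 2) := by
    rw [Real.sqrt_eq_rpow, ← Real.rpow_mul (by positivity)]
    congr 1
    ring
  rw [norm_mul, norm_smul, norm_mul, Complex.norm_real, Complex.norm_real, norm_inv,
    Real.norm_of_nonneg (by positivity), Real.norm_of_nonneg (by positivity),
    Real.norm_of_nonneg (by positivity), Real.rpow_sub_one (by positivity)]
  calc (1 + ‖x‖) ^ α / (1 + ‖x‖) * ‖u x‖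
      ≤ (2 * √(‖x‖ ^ 2 + 1)) ^ α / √(‖x‖ ^ 2 + 1) * ‖u x‖ := by gcongr
    _ = _ := by
      rw [Real.mul_rpow zero_le_two hs.le, h4]
      ring

variable [Fact (3 ≤ d)]

/-- `|x|^α` need not be smooth at the origin, so the product rule is applied to `(|x|²+δ)^{α/2}` and
`δ → 0` by dominated convergence. The term `u∇|x|^α` is locally integrable because `|x|⁻¹u ∈ L²`. -/
theorem InHDot.hasWeakGrad_pow {u : RSpace d → ℂ} {g : RSpace d → EuclideanSpace ℂ (Fin d)}
    (h : InHDot u g) {α : ℝ} (hα : 0 ≤ α) :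
    HasWeakGrad (fun x => ((‖x‖ ^ α : ℝ) : ℂ) * u x)
      (fun x => ((‖x‖ ^ α : ℝ) : ℂ) • g x + u x • powGrad α x) := by
  have hw := h.hasWeakGrad
  have cα : Continuous fun x : RSpace d => ((‖x‖ ^ α : ℝ) : ℂ) :=
    Complex.continuous_ofReal.comp (continuous_norm.rpow_const fun _ => Or.inr hα)
  have cJ : Continuous fun x : RSpace d => (‖x‖ ^ 2 + 1) ^ (α / 2) :=
    (contDiff_pow one_pos α).continuous
  have lh : LocallyIntegrable fun x => ‖x‖⁻¹ • u x :=
    h.memLp_inv_norm.locallyIntegrable one_le_two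
  have lp : LocallyIntegrable fun x => u x • powGrad α x := by
    have l1 : LocallyIntegrable fun x => (α * ‖x‖ ^ α) • (‖x‖⁻¹ • u x) :=
      lh.continuous_smul (continuous_const.mul (continuous_norm.rpow_const fun _ => Or.inr hα))
    refine l1.mono (hw.1.aestronglyMeasurable.smul (measurable_powGrad α).aestronglyMeasurable)
      (Eventually.of_forall fun x => le_of_eq ?_)
    rw [norm_smul, norm_powGrad hα, norm_smul, norm_smul, Real.norm_of_nonneg (by positivity),
      Real.norm_of_nonneg (by positivity)]
    ring
  have lJu : LocallyIntegrable fun x => ((‖x‖ ^ 2 + 1) ^ (α / 2)) • u x := hw.1.continuous_smul cJ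
  have lJg : LocallyIntegrable fun x => ((‖x‖ ^ 2 + 1) ^ (α / 2)) • g x := hw.2.1.continuous_smul cJ
  have lJh : LocallyIntegrable fun x => (α * (‖x‖ ^ 2 + 1) ^ (α / 2)) • (‖x‖⁻¹ • u x) :=
    lh.continuous_smul (continuous_const.mul cJ)
  refine ⟨hw.1.continuous_smul cα, (hw.2.1.continuous_smul cα).add lp, fun η hη hc i => ?_⟩
  have cη : Continuous fun x => fderiv ℝ η x (coordVec i) :=
    (hη.continuous_fderiv (by simp)).clm_apply continuous_const
  have sη : HasCompactSupport fun x => fderiv ℝ η x (coordVec i) :=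
    hc.fderiv_apply (𝕜 := ℝ) (coordVec i)
  have hδ : ∀ n : ℕ, (0 : ℝ) < 1 / ((n : ℝ) + 1) := fun n => by positivity
  have hδ1 : ∀ n : ℕ, 1 / ((n : ℝ) + 1) ≤ 1 := fun n => by
    rw [div_le_one (by positivity)]
    linarith [n.cast_nonneg (α := ℝ)]
  have hn := fun n : ℕ => hw.mul_contDiff (contDiff_pow (d := d) (hδ n) α)
  have hle : ∀ (n : ℕ) (x : RSpace d), ‖(((‖x‖ ^ 2 + 1 / ((n : ℝ) + 1)) ^ (α / 2) : ℝ) : ℂ)‖ ≤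
      (‖x‖ ^ 2 + 1) ^ (α / 2) := fun n x => by
    have := hδ n
    rw [Complex.norm_real, Real.norm_of_nonneg (by positivity)]
    gcongr
    exact hδ1 n
  have hlim : ∀ x : RSpace d, Tendsto
      (fun n : ℕ => (((‖x‖ ^ 2 + 1 / ((n : ℝ) + 1)) ^ (α / 2) : ℝ) : ℂ)) atTop
      (𝓝 ((‖x‖ ^ α : ℝ) : ℂ)) := fun x =>
    (Complex.continuous_ofReal.tendsto _).comp (tendsto_pow hα x)
  have t1 : Tendsto (fun n : ℕ => ∫ x, fderiv ℝ η x (coordVec i) •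
      ((((‖x‖ ^ 2 + 1 / ((n : ℝ) + 1)) ^ (α / 2) : ℝ) : ℂ) * u x)) atTop
      (𝓝 (∫ x, fderiv ℝ η x (coordVec i) • (((‖x‖ ^ α : ℝ) : ℂ) * u x))) := by
    refine tendsto_integral_of_dominated_convergence
      (fun x => ‖fderiv ℝ η x (coordVec i) • (((‖x‖ ^ 2 + 1) ^ (α / 2)) • u x)‖)
      (fun n => ((hn n).1.integrable_smul_left_of_hasCompactSupport cη sη).1)
      (lJu.integrable_smul_left_of_hasCompactSupport cη sη).norm (fun n => ?_)
      (Eventually.of_forall fun x => ((hlim x).mul_const _).const_smul _)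
    refine Eventually.of_forall fun x => ?_
    rw [norm_smul, norm_smul, norm_smul, norm_mul]
    gcongr
    exact (hle n x).trans (le_abs_self _)
  have t2 : Tendsto (fun n : ℕ => ∫ x, η x • mulGrad
      (fun x => (((‖x‖ ^ 2 + 1 / ((n : ℝ) + 1)) ^ (α / 2) : ℝ) : ℂ)) u g x i) atTop
      (𝓝 (∫ x, η x • (((‖x‖ ^ α : ℝ) : ℂ) • g x + u x • powGrad α x) i)) := by
    refine tendsto_integral_of_dominated_convergence
      (fun x => ‖η x • (((‖x‖ ^ 2 + 1) ^ (α / 2)) • g x)‖ +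
        ‖η x • ((α * (‖x‖ ^ 2 + 1) ^ (α / 2)) • (‖x‖⁻¹ • u x))‖)
      (fun n => (((hn n).2.1.coord i).integrable_smul_left_of_hasCompactSupport
        hη.continuous hc).1)
      ((lJg.integrable_smul_left_of_hasCompactSupport hη.continuous hc).norm.add
        (lJh.integrable_smul_left_of_hasCompactSupport hη.continuous hc).norm) (fun n => ?_)
      (Eventually.of_forall fun x => ?_)
    · refine Eventually.of_forall fun x => ?_
      rw [norm_smul, norm_smul (η x), norm_smul (η x), ← mul_add]
      refine mul_le_mul_of_nonneg_left ((PiLp.norm_apply_le _ i).trans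
        ((norm_add_le _ _).trans (add_le_add ?_ ?_))) (norm_nonneg _)
      · rw [norm_smul, norm_smul]
        gcongr
        exact (hle n x).trans (le_abs_self _)
      · have hb := norm_classicalGrad_pow_le (hδ n) (hδ1 n) hα x
        rw [norm_smul, norm_smul, norm_smul, norm_inv, norm_norm,
          Real.norm_of_nonneg (r := α * _) (by positivity), ← mul_assoc, mul_comm]
        gcongr
    · have t := ((hlim x).smul_const (g x)).add
        ((tendsto_classicalGrad_pow α x).const_smul (u x))
      exact (((EuclideanSpace.proj (𝕜 := ℂ) i).continuous.tendsto _).comp t).const_smul _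
  refine tendsto_nhds_unique t1 (t2.neg.congr fun n => ?_)
  exact ((hn n).2.2 η hη hc i).symm

/-- The term `|x|^{α-1}|u|` is controlled by the unweighted Hardy inequality for `|x| ≤ 1` and by
the weighted decay for `|x| ≥ 1`. -/
theorem memLp_grad_pow {u : RSpace d → ℂ} {g : RSpace d → EuclideanSpace ℂ (Fin d)}
    (h : InHDot u g) {α : ℝ} (hα : 0 ≤ α)
    (h1 : MemLp (fun x => (√(‖x‖ ^ 2 + 1))⁻¹ • ((((‖x‖ ^ 2 + 1) ^ (α / 2) : ℝ) : ℂ) * u x)) 2)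
    (h2 : MemLp (fun x => (((‖x‖ ^ 2 + 1) ^ (α / 2) : ℝ) : ℂ) • g x) 2) :
    MemLp (fun x => ((‖x‖ ^ α : ℝ) : ℂ) • g x + u x • powGrad α x) 2 := by
  have e : ∀ x : RSpace d, ‖x‖ ^ α ≤ (‖x‖ ^ 2 + 1) ^ (α / 2) := fun x => by
    rw [norm_rpow_eq]
    gcongr
    linarith
  have cα : Continuous fun x : RSpace d => ((‖x‖ ^ α : ℝ) : ℂ) :=
    Complex.continuous_ofReal.comp (continuous_norm.rpow_const fun _ => Or.inr hα)
  refine MemLp.add (h2.mono (cα.aestronglyMeasurable.smul h.memLp_grad.1)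
    (Eventually.of_forall fun x => ?_)) ?_
  · rw [norm_smul, norm_smul, Complex.norm_real, Complex.norm_real,
      Real.norm_of_nonneg (by positivity), Real.norm_of_nonneg (by positivity)]
    gcongr
    exact e x
  · refine ((h.memLp_inv_norm.norm.add (h1.norm.const_mul 2)).const_mul α).mono
      (h.memLp.1.smul (measurable_powGrad α).aestronglyMeasurable)
      (Eventually.of_forall fun x => ?_)
    refine le_trans ?_ (le_abs_self _)
    simp only [Pi.add_apply, norm_smul, norm_powGrad hα, norm_inv, norm_norm, norm_mul,
      Complex.norm_real]
    rw [Real.norm_of_nonneg (Real.sqrt_nonneg _), Real.norm_of_nonneg (r := (_ : ℝ) ^ (α / 2))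
      (by positivity), mul_left_comm]
    refine mul_le_mul_of_nonneg_left ?_ hα
    have hu := norm_nonneg (u x)
    have hs : 0 < √(‖x‖ ^ 2 + 1) := Real.sqrt_pos.2 (by positivity)
    rcases le_total ‖x‖ 1 with hx | hx
    · have : ‖x‖ ^ α ≤ 1 := Real.rpow_le_one (norm_nonneg x) hx hα
      calc ‖u x‖ * (‖x‖ ^ α * ‖x‖⁻¹) ≤ ‖u x‖ * (1 * ‖x‖⁻¹) := by gcongr
        _ = ‖x‖⁻¹ * ‖u x‖ := by ring
        _ ≤ _ := le_add_of_nonneg_right (by positivity)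
    · have hx0 : 0 < ‖x‖ := by linarith
      have h3 : √(‖x‖ ^ 2 + 1) ≤ 2 * ‖x‖ := Real.sqrt_le_iff.2 ⟨by positivity, by nlinarith⟩
      have h4 : ‖x‖⁻¹ ≤ 2 * (√(‖x‖ ^ 2 + 1))⁻¹ := by
        rw [← div_eq_mul_inv, le_div_iff₀ hs, inv_mul_le_iff₀ hx0]
        linarith
      calc ‖u x‖ * (‖x‖ ^ α * ‖x‖⁻¹)
          ≤ ‖u x‖ * ((‖x‖ ^ 2 + 1) ^ (α / 2) * (2 * (√(‖x‖ ^ 2 + 1))⁻¹)) := by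
            gcongr
            exact e x
        _ = 2 * ((√(‖x‖ ^ 2 + 1))⁻¹ * ((‖x‖ ^ 2 + 1) ^ (α / 2) * ‖u x‖)) := by ring
        _ ≤ _ := le_add_of_nonneg_left (by positivity)

/-- Restricted to `H¹` test functions, the Euler–Lagrange equation says that `(u, 0)` lies in the
operator graph; `u ∈ L²` is all that separates a zero-energy solution from an eigenfunction. -/
theorem exists_eigenvector {V : RSpace d → ℝ} (hV : MemLp V ((d : ℝ≥0∞) / 2))
    {u : RSpace d → ℂ} {g : RSpace d → EuclideanSpace ℂ (Fin d)} (h : InHDot u g)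
    (hEL : ∀ (v : RSpace d → ℂ) (k : RSpace d → EuclideanSpace ℂ (Fin d)), InHDot v k →
      (∫ x, inner ℂ (k x) (g x)) + ∫ x, (V x : ℂ) * (conj (v x) * u x) = 0)
    (hne : ¬ u =ᵐ[volume] 0) (hu : MemLp u 2) :
    ∃ w ∈ opEigenspace (schrodingerOp 1 V) 0,
      w ≠ 0 ∧ ((w : L2Space d) : RSpace d → ℂ) =ᵐ[volume] u := by
  have hcoe := hu.coeFn_toLp
  have hmem : ((hu.toLp u, 0) : L2Space d × L2Space d) ∈ schrodingerGraph 1 V := by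
    refine ⟨g, (MemH1.memFormDomain hV ⟨hu, h.hasWeakGrad, h.memLp_grad⟩).congr hcoe.symm,
      fun v k hv => ?_⟩
    rw [inner_zero_right, Complex.ofReal_one, one_mul, ← hEL v k hv.1.inHDot]
    congr 1
    refine integral_congr_ae ?_
    filter_upwards [hcoe] with x hx
    rw [hx]
  rw [← schrodingerOp_graph 1 hV, LinearPMap.mem_graph_iff] at hmem
  obtain ⟨w, hw1, hw2⟩ := hmem
  simp only at hw1 hw2
  have hwu : ((w : L2Space d) : RSpace d → ℂ) =ᵐ[volume] u := by
    rw [hw1]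
    exact hcoe
  refine ⟨w, ?_, ?_, hwu⟩
  · rw [opEigenspace, LinearMap.mem_ker, shiftedOp]
    simpa using hw2
  · rintro rfl
    exact hne (hwu.symm.trans (Lp.coeFn_zero ℂ 2 volume))

end WeightedSolution

theorem mainTheorem9 (d : ℕ) (hd : 3 ≤ d) (V : RSpace d → ℝ)
    (hV : ShortRange V) (hvl : HasVirtualLevelAtZero V) :
    ∃ (φ : RSpace d → ℂ) (g : RSpace d → EuclideanSpace ℂ (Fin d)),
      MemHDot1 φ g ∧ ¬ (φ =ᵐ[volume] 0) ∧
      (Integrable fun x => V x * ‖φ x‖ ^ 2) ∧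
      (∫ x, ‖g x‖ ^ 2) + (∫ x, V x * ‖φ x‖ ^ 2) = 0 ∧
      (∀ α : ℝ, 0 ≤ α → α < ((d : ℝ) - 2) / 2 →
        (∃ G : RSpace d → EuclideanSpace ℂ (Fin d),
          HasWeakGrad (fun x => ((‖x‖ ^ α : ℝ) : ℂ) * φ x) G ∧ MemLp G 2) ∧
        MemLp (fun x => (((1 + ‖x‖) ^ (α - 1) : ℝ) : ℂ) * φ x) 2) ∧
      (5 ≤ d → ∃ u ∈ opEigenspace (schrodingerOp 1 V) 0,
        u ≠ 0 ∧ ((u : L2Space d) : RSpace d → ℂ) =ᵐ[volume] φ) := by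
  have : Fact (3 ≤ d) := ⟨hd⟩
  have hp := hV.memLp
  obtain ⟨g₀, hne, hzero⟩ := exists_zero_of_virtualLevel hp hvl
  have h := inHDot_hdotFun g₀
  have helem : h.elem = g₀ := Subtype.ext (Lp.toLp_coeFn (g₀ : GradSpace d) (Lp.memLp _))
  have hEL : ∀ (v : RSpace d → ℂ) (k : RSpace d → EuclideanSpace ℂ (Fin d)), InHDot v k →
      (∫ x, inner ℂ (k x) ((g₀ : GradSpace d) x)) +
        ∫ x, (V x : ℂ) * (conj (v x) * hdotFun d g₀ x) = 0 := fun v k hv => by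
    have := euler_lagrange hp (hvl.1.nonneg hp) hzero hv.elem
    rwa [← helem, h.inner_elem hv, h.potForm_elem hp hv] at this
  -- Nontriviality is known for the gradient; a function vanishing a.e. would have zero weak
  -- gradient.
  have hφ : ¬ (hdotFun d g₀ : RSpace d → ℂ) =ᵐ[volume] 0 := fun h0 =>
    hne (Subtype.ext (Lp.ext ((h.hasWeakGrad.eq_zero h0).trans (Lp.coeFn_zero _ _ _).symm)))
  have hdecay : ∀ α : ℝ, 0 ≤ α → α < ((d : ℝ) - 2) / 2 →
      MemLp (fun x => (((1 + ‖x‖) ^ (α - 1) : ℝ) : ℂ) * hdotFun d g₀ x) 2 := fun α hα hα' =>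
    memLp_one_add_norm_pow h.memLp.1 hα (memLp_weighted hp h hEL hα hα').1
  refine ⟨hdotFun d g₀, (g₀ : GradSpace d), h.memHDot1, hφ, integrable_potential_sq hp h.memLp, ?_,
    fun α hα hα' => ⟨⟨_, h.hasWeakGrad_pow hα, ?_⟩, hdecay α hα hα'⟩, fun hd5 => ?_⟩
  · rw [← h.norm_elem_sq, ← h.potForm_self hp, helem]
    exact hzero
  · obtain ⟨h1, h2⟩ := memLp_weighted hp h hEL hα hα'
    exact memLp_grad_pow h hα h1 h2
  · refine exists_eigenvector hp h hEL hφ ?_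
    have h5 : (5 : ℝ) ≤ d := by exact_mod_cast hd5
    -- At `α = 1` the weight `(1+|x|)^{α-1}` is one, and `1 < (d-2)/2` holds for `d ≥ 5`.
    simpa using hdecay 1 zero_le_one (by linarith)
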